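/- Let $n\ge 1$, let $f$ be a holomorphic function near the origin of $\mathbb{C}^n$ with $f(\mathbf 0)=0$ and $df(\mathbf 0)=0$, and suppose that $V=\{f=0\}$ has an isolated singularity at $\mathbf 0$, i.e. there is no point $x\neq \mathbf 0$ near $\mathbf 0$ with $f(x)=0$ and $df(x)=0$. The Milnor number of a germ $g:(\mathbb{C}^m,\mathbf 0)\to(\mathbb{C},0)$ is $\dim_{\mathbb{C}}\mathbb{C}\{z_1,\dots,z_m\}/(\partial g/\partial z_1,\dots,\partial g/\partial z_m)$, and the $(n-1)$-th sectional Milnor number $\mu^{(n-1)}$ of $(V,\mathbf 0)$ is the Milnor number at $\mathbf 0$ of the restriction of $f$ to a general hyperplane through $\mathbf 0$ (so $\mu^{(0)}=1$). (i) If $\mu^{(n-1)}=1$, then $(V,\mathbf 0)$ is of type $A_k$ for some $k\ge1$: there are local holomorphic coordinates $x_1,\dots,x_n$ at $\mathbf 0$ in which $f=x_1^{k+1}+x_2^2+\cdots+x_n^2$. (ii) If $\mu^{(n-1)}=2$, then, for some $r\ge1$ and $i\ge0$, $(V,\mathbf 0)$ is of type $E_{6r}$, $E_{6r+1}$, $E_{6r+2}$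 or $J_{r,i}$: $n\ge2$ and there are local holomorphic coordinates $x,y,x_3,\dots,x_n$ at $\mathbf 0$ in which $f=g(x,y)+x_3^2+\cdots+x_n^2$, where $g$ is one of the following, with $a(y)=a_0+\cdots+a_{r-2}y^{r-2}$ ($a=0$ if $r=1$) and $c(y)=c_0+\cdots+c_{r-3}y^{r-3}$ ($c=0$ if $r=2$) polynomials with complex coefficients: - $E_{6r}$: $x^3+y^{3r+1}+a(y)\,x y^{2r+1}$; - $E_{6r+1}$: $x^3+x y^{2r+1}+a(y)\,y^{3r+2}$; - $E_{6r+2}$: $x^3+y^{3r+2}+a(y)\,x y^{2r+2}$; - $J_{1,i}=D_{4+i}$: $x^2y+y^{3+i}$; - $J_{r,0}$, $r\ge2$: $x^3+b x^2y^r+y^{3r}+c(y)\,x y^{2r+1}$ with $b\in\mathbb{C}$, $4b^3+27\neq0$; - $J_{r,i}$, $r\ge2$, $i\ge1$: $x^3+x^2y^r+a(y)\,y^{3r+i}$ with $a_0\neq0$. -/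

import Mathlib

open Filter Topology Polynomial

noncomputable section

namespace HypersurfaceGerm

/-- Germs of complex-valued functions form a `ℂ`-algebra, with the pointwise operations. -/
instance germAlgebra {α : Type*} (l : Filter α) : Algebra ℂ (Germ l ℂ) :=
  Algebra.ofModule
    (fun c x y => by
      induction x, y using Germ.inductionOn₂ with
      | _ f g => exact congrArg _ (smul_mul_assoc c f g))
    (fun c x y => by
      induction x, y using Germ.inductionOn₂ with
      | _ f g => exact congrArg _ (mul_smul_comm c f g))

/-- The local ring `ℂ{z₁, …, z_m}` of germs at the origin of holomorphic functions on `ℂ^m`. -/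
def analyticGerms (m : ℕ) : Subalgebra ℂ (Germ (𝓝 (0 : Fin m → ℂ)) ℂ) where
  carrier := {φ | ∃ f : (Fin m → ℂ) → ℂ, AnalyticAt ℂ f 0 ∧ φ = Germ.ofFun f}
  mul_mem' := by
    rintro _ _ ⟨f, hf, rfl⟩ ⟨g, hg, rfl⟩
    exact ⟨f * g, hf.mul hg, rfl⟩
  add_mem' := by
    rintro _ _ ⟨f, hf, rfl⟩ ⟨g, hg, rfl⟩
    exact ⟨f + g, hf.add hg, rfl⟩
  algebraMap_mem' := fun c => ⟨c • 1, analyticAt_const (v := c • (1 : ℂ)),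
    Algebra.algebraMap_eq_smul_one c⟩

/-- The Jacobian ideal: the ideal of `ℂ{z₁, …, z_m}` generated by the germs at the origin of the
partial derivatives of `g`. -/
def jacobianIdeal {m : ℕ} (g : (Fin m → ℂ) → ℂ) : Ideal (analyticGerms m) :=
  Ideal.span {φ | ∃ j : Fin m,
    (φ : Germ (𝓝 (0 : Fin m → ℂ)) ℂ) = Germ.ofFun (fun z => fderiv ℂ g z (Pi.single j 1))}

/-- The Milnor number at the origin of the hypersurface germ `g = 0` in `ℂ^m`, that is
`dim_ℂ ℂ{z₁, …, z_m} / (∂g/∂z₁, …, ∂g/∂z_m)`; it is `⊤` when this dimension is infinite. -/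
def milnorNumber {m : ℕ} (g : (Fin m → ℂ) → ℂ) : ℕ∞ :=
  Cardinal.toENat (Module.rank ℂ (analyticGerms m ⧸ jacobianIdeal g))

/-- `f` is a local equation of the germ at the origin of an isolated hypersurface singularity
`V = {f = 0}` in `ℂ^n`: the origin is a singular point of `V`, and `V` has no other singular
point near the origin. -/
structure IsIsolatedSingularity {n : ℕ} (f : (Fin n → ℂ) → ℂ) : Prop where
  analyticAt : AnalyticAt ℂ f 0
  map_zero : f 0 = 0
  fderiv_zero : fderiv ℂ f 0 = 0
  isolated : ∀ᶠ x in 𝓝[≠] (0 : Fin n → ℂ), f x = 0 → fderiv ℂ f x ≠ 0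

/-- The `i`-th sectional Milnor number of the germ `V = {f = 0}` in `ℂ^n` is `μ`: the intersection
of `V` with a general `i`-dimensional plane through the origin has Milnor number `μ`.

An `i`-dimensional plane is given as the image of an injective linear map `ℂ^i → ℂ^n`, with matrix
`M`, so that the section of `V` is the germ in `ℂ^i` with equation `f (M z) = 0`. "General" means
outside of a proper Zariski closed subset, here of the zero set of a nonzero polynomial `P` in the
entries of `M`. -/
def HasSectionalMilnorNumber {n : ℕ} (f : (Fin n → ℂ) → ℂ) (i : ℕ) (μ : ℕ∞) : Prop :=
  ∃ P : MvPolynomial (Fin n × Fin i) ℂ, P ≠ 0 ∧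
    ∀ M : Matrix (Fin n) (Fin i) ℂ, Function.Injective M.mulVec →
      MvPolynomial.eval (fun p => M p.1 p.2) P ≠ 0 →
      milnorNumber (fun z : Fin i → ℂ => f (M.mulVec z)) = μ

/-- The germs of `f` and `g` at the origin agree up to a local change of holomorphic coordinates:
`f ∘ φ = g` near the origin for the germ `φ` of a biholomorphic map `(ℂ^n, 0) → (ℂ^n, 0)`. -/
def RightEquivalent {n : ℕ} (f g : (Fin n → ℂ) → ℂ) : Prop :=
  ∃ φ ψ : (Fin n → ℂ) → (Fin n → ℂ),
    AnalyticAt ℂ φ 0 ∧ AnalyticAt ℂ ψ 0 ∧ φ 0 = 0 ∧ ψ 0 = 0 ∧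
    (∀ᶠ x in 𝓝 0, ψ (φ x) = x) ∧ (∀ᶠ x in 𝓝 0, φ (ψ x) = x) ∧
    ∀ᶠ x in 𝓝 0, f (φ x) = g x

/-- The singularity type `A_k`: in suitable local coordinates `f` is `x^(k+1)` plus the sum of the
squares of the other coordinates. -/
def IsTypeA {n : ℕ} (k : ℕ) (f : (Fin n → ℂ) → ℂ) : Prop :=
  ∃ p : Fin n, RightEquivalent f (fun z => z p ^ (k + 1) + ∑ j ∈ {p}ᶜ, z j ^ 2)

/-- In suitable local coordinates `f` is `g(x, y)` plus the sum of the squares of the other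
coordinates, where `x` and `y` are two different coordinates. -/
def IsStabilizationOf {n : ℕ} (g : ℂ → ℂ → ℂ) (f : (Fin n → ℂ) → ℂ) : Prop :=
  ∃ p q : Fin n, p ≠ q ∧
    RightEquivalent f (fun z => g (z p) (z q) + ∑ j ∈ {p, q}ᶜ, z j ^ 2)

/-- The singularity type `E_{6r}`: `x³ + y^(3r+1) + a(y) x y^(2r+1)`, where
`a = a₀ + ⋯ + a_{r-2} y^(r-2)` (and `a = 0` if `r = 1`). -/
def IsTypeE6r {n : ℕ} (r : ℕ) (f : (Fin n → ℂ) → ℂ) : Prop :=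
  ∃ a ∈ Polynomial.degreeLT ℂ (r - 1),
    IsStabilizationOf (fun x y => x ^ 3 + y ^ (3 * r + 1) + a.eval y * x * y ^ (2 * r + 1)) f

/-- The singularity type `E_{6r+1}`: `x³ + x y^(2r+1) + a(y) y^(3r+2)`, where
`a = a₀ + ⋯ + a_{r-2} y^(r-2)` (and `a = 0` if `r = 1`). -/
def IsTypeE6rAddOne {n : ℕ} (r : ℕ) (f : (Fin n → ℂ) → ℂ) : Prop :=
  ∃ a ∈ Polynomial.degreeLT ℂ (r - 1),
    IsStabilizationOf (fun x y => x ^ 3 + x * y ^ (2 * r + 1) + a.eval y * y ^ (3 * r + 2)) f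

/-- The singularity type `E_{6r+2}`: `x³ + y^(3r+2) + a(y) x y^(2r+2)`, where
`a = a₀ + ⋯ + a_{r-2} y^(r-2)` (and `a = 0` if `r = 1`). -/
def IsTypeE6rAddTwo {n : ℕ} (r : ℕ) (f : (Fin n → ℂ) → ℂ) : Prop :=
  ∃ a ∈ Polynomial.degreeLT ℂ (r - 1),
    IsStabilizationOf (fun x y => x ^ 3 + y ^ (3 * r + 2) + a.eval y * x * y ^ (2 * r + 2)) f

/-- The singularity type `D_k`, `k ≥ 4`: `x² y + y^(k-1)`. -/
def IsTypeD {n : ℕ} (k : ℕ) (f : (Fin n → ℂ) → ℂ) : Prop :=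
  IsStabilizationOf (fun x y => x ^ 2 * y + y ^ (k - 1)) f

/-- The singularity type `J_{r,i}`, `r ≥ 1`, `i ≥ 0`:
* `J_{1,i} = D_{4+i}`;
* `J_{r,0}`, `r ≥ 2`: `x³ + b x² y^r + y^(3r) + c(y) x y^(2r+1)` with `4b³ + 27 ≠ 0`, where
  `c = c₀ + ⋯ + c_{r-3} y^(r-3)` (and `c = 0` if `r = 2`);
* `J_{r,i}`, `r ≥ 2`, `i ≥ 1`: `x³ + x² y^r + a(y) y^(3r+i)` with `a₀ ≠ 0`, where
  `a = a₀ + ⋯ + a_{r-2} y^(r-2)`. -/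
def IsTypeJ {n : ℕ} (r i : ℕ) (f : (Fin n → ℂ) → ℂ) : Prop :=
  (r = 1 ∧ IsTypeD (4 + i) f) ∨
  (2 ≤ r ∧ i = 0 ∧ ∃ b : ℂ, 4 * b ^ 3 + 27 ≠ 0 ∧ ∃ c ∈ Polynomial.degreeLT ℂ (r - 2),
    IsStabilizationOf (fun x y =>
      x ^ 3 + b * x ^ 2 * y ^ r + y ^ (3 * r) + c.eval y * x * y ^ (2 * r + 1)) f) ∨
  (2 ≤ r ∧ 1 ≤ i ∧ ∃ a ∈ Polynomial.degreeLT ℂ (r - 1), a.coeff 0 ≠ 0 ∧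
    IsStabilizationOf (fun x y => x ^ 3 + x ^ 2 * y ^ r + a.eval y * y ^ (3 * r + i)) f)

end HypersurfaceGerm

end

/-! The sectional Milnor number is read off from the Hessian form of `f` at the origin. A hyperplane
meets the radical of this form in codimension at most one, and the intersection lies in the radical
of the restricted form. A germ whose Hessian radical has dimension at least `d ≥ 1` has Milnor
number at least `d + 1` (`corank_lt_milnorNumber`), while a nondegenerate germ has Milnor number at
most one (`milnorNumber_le_one`). Hence `μ^(n-1) = 1` forces corank at most one, and `μ^(n-1) = 2`
forces corank exactly two. In the second case the cubic part of `f` cannot vanish on the radical: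
each hyperplane would then contain a radical vector along which `f` is of order four, and
`three_le_milnorNumber` would give Milnor number at least three.

The splitting lemma leaves a germ in one or two variables plus squares. In one variable this germ is
a power times a unit, which is type `A`; isolatedness excludes the zero germ. In two variables the
cubic part contains `x³` after a linear change, and unfolding `x³` gives `x³ + y² α(y) x + y³ β(y)`.
Let `k` be maximal with `y^(2k) ∣ α` and `y^(3k) ∣ β`, and put `r = k + 1`. The leading coefficients
that remain decide the type: `E` if both constant terms vanish, `J_{r,0}` if the cubic they define
has distinct roots, `J_{r,i}` with `i ≥ 1` if it has a double root (`exists_type_of_cubic`).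

The main reductions (splitting lemma, unfolding, quasi-homogeneous normal forms, moduli of
`J_{r,i}`) are applications of local surjectivity in the Banach algebra of absolutely summable power
series. A weighted rescaling by a small `t`, followed by division by `t ^ d`, brings the germ close
to its principal part. Near the principal part all series with the right support are reached by
coordinate changes and moduli, as soon as the linearized equation is solvable; and that equation is
a division problem modulo the partial derivatives.

For `J_{r,i}` with `r ≥ 2` and `i ≥ 1` the principal part `x³ + x² y^r` is not isolated, and the
coordinate change is a symmetry of `x³ + x² y^r` followed by a perturbation of size `t ^ i`
(`jFamily`). -/

noncomputable section

namespace HypersurfaceGerm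

/-! ### The Banach algebra of absolutely summable power series -/

/-- The subalgebra of power series with absolutely summable coefficients. -/
def absSubalgebra (n : ℕ) : Subalgebra ℂ (MvPowerSeries (Fin n) ℂ) where
  carrier := {a | Summable fun m => ‖MvPowerSeries.coeff m a‖}
  mul_mem' := by
    intro a b ha hb
    have := summable_sum_mul_antidiagonal_of_summable_mul
      (Summable.mul_of_nonneg ha hb (fun _ => norm_nonneg _) fun _ => norm_nonneg _)
    refine this.of_nonneg_of_le (fun _ => norm_nonneg _) fun m => ?_
    rw [MvPowerSeries.coeff_mul]
    exact (norm_sum_le _ _).trans (Finset.sum_le_sum fun _ _ => norm_mul_le _ _)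
  add_mem' := by
    intro a b ha hb
    refine (Summable.add ha hb).of_nonneg_of_le (fun _ => norm_nonneg _) fun m => ?_
    rw [map_add]
    exact norm_add_le _ _
  algebraMap_mem' := by
    intro c
    refine summable_of_ne_finset_zero (s := {0}) fun m hm => ?_
    rw [MvPowerSeries.algebraMap_apply, MvPowerSeries.coeff_C, if_neg (by simpa using hm), norm_zero]

/-- Power series in `n` variables with absolutely summable coefficients. -/
def AbsSeries (n : ℕ) : Type := absSubalgebra n

namespace AbsSeries

variable {n : ℕ}

instance : CommRing (AbsSeries n) := inferInstanceAs (CommRing (absSubalgebra n))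

instance : Algebra ℂ (AbsSeries n) := inferInstanceAs (Algebra ℂ (absSubalgebra n))

/-- The power series underlying an element of `AbsSeries n`. -/
def toSeries : AbsSeries n →ₐ[ℂ] MvPowerSeries (Fin n) ℂ := (absSubalgebra n).val

/-- The coefficients of an absolutely summable power series. -/
def coeff (m : Fin n →₀ ℕ) : AbsSeries n →ₗ[ℂ] ℂ :=
  (MvPowerSeries.coeff m).comp (toSeries (n := n)).toLinearMap

theorem summable_coeff (a : AbsSeries n) : Summable fun m => ‖coeff m a‖ := a.2

@[ext]
theorem ext {a b : AbsSeries n} (h : ∀ m, coeff m a = coeff m b) : a = b :=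
  Subtype.ext (MvPowerSeries.ext h)

/-- The absolutely summable power series with given coefficients. -/
def mk (c : (Fin n →₀ ℕ) → ℂ) (hc : Summable fun m => ‖c m‖) : AbsSeries n := ⟨c, hc⟩

@[simp]
theorem coeff_mk (c : (Fin n →₀ ℕ) → ℂ) (hc : Summable fun m => ‖c m‖) (m : Fin n →₀ ℕ) :
    coeff m (mk c hc) = c m := rfl

theorem coeff_mul (m : Fin n →₀ ℕ) (a b : AbsSeries n) :
    coeff m (a * b) = ∑ p ∈ Finset.HasAntidiagonal.antidiagonal m, coeff p.1 a * coeff p.2 b :=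
  MvPowerSeries.coeff_mul m _ _

theorem coeff_one (m : Fin n →₀ ℕ) : coeff m (1 : AbsSeries n) = if m = 0 then 1 else 0 :=
  MvPowerSeries.coeff_one m

/-- The sequence of coefficients, as an element of `ℓ¹`. -/
def toLp : AbsSeries n →+ lp (fun _ : Fin n →₀ ℕ => ℂ) 1 where
  toFun a := ⟨fun m => coeff m a, by
    refine memℓp_gen ?_
    simpa using a.summable_coeff⟩
  map_zero' := Subtype.ext (funext fun m => map_zero (coeff m))
  map_add' a b := Subtype.ext (funext fun m => map_add (coeff m) a b)

theorem toLp_injective : Function.Injective (toLp (n := n)) := by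
  intro a b h
  ext m
  exact congrFun (congrArg Subtype.val h) m

theorem toLp_surjective : Function.Surjective (toLp (n := n)) := by
  intro f
  refine ⟨mk f.1 ?_, rfl⟩
  simpa using (lp.memℓp f).summable (by simp)

instance : NormedAddCommGroup (AbsSeries n) := NormedAddCommGroup.induced _ _ toLp toLp_injective

theorem norm_def (a : AbsSeries n) : ‖a‖ = ∑' m, ‖coeff m a‖ := by
  change ‖toLp a‖ = _
  rw [lp.norm_eq_tsum_rpow (by simp)]
  simp [toLp]

/-- Completeness makes the inverse and implicit function theorems available for equations whose
unknowns are power series. -/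
instance : CompleteSpace (AbsSeries n) := by
  have h : Isometry (toLp (n := n)) := AddMonoidHomClass.isometry_of_norm _ fun _ => rfl
  exact (IsometryEquiv.mk' toLp _ (Function.rightInverse_surjInv toLp_surjective) h).completeSpace

theorem norm_mul_le' (a b : AbsSeries n) : ‖a * b‖ ≤ ‖a‖ * ‖b‖ := by
  have hab : Summable fun x : (Fin n →₀ ℕ) × (Fin n →₀ ℕ) => ‖coeff x.1 a‖ * ‖coeff x.2 b‖ :=
    Summable.mul_of_nonneg (f := fun m => ‖coeff m a‖) (g := fun m => ‖coeff m b‖)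
      a.summable_coeff b.summable_coeff (fun m => norm_nonneg (coeff m a))
      fun m => norm_nonneg (coeff m b)
  have h := a.summable_coeff.tsum_mul_tsum_eq_tsum_sum_antidiagonal b.summable_coeff hab
  rw [norm_def, norm_def, norm_def, h]
  have h' := summable_sum_mul_antidiagonal_of_summable_mul (f := fun m => ‖coeff m a‖)
    (g := fun m => ‖coeff m b‖) hab
  refine Summable.tsum_le_tsum (fun m => ?_) (a * b).summable_coeff h'
  rw [coeff_mul]
  exact (norm_sum_le _ _).trans (Finset.sum_le_sum fun _ _ => norm_mul_le _ _)

instance : NormedCommRing (AbsSeries n) :=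
  { (inferInstance : NormedAddCommGroup (AbsSeries n)), (inferInstance : CommRing (AbsSeries n)) with
    norm_mul_le := norm_mul_le' }

instance : NormedAlgebra ℂ (AbsSeries n) where
  norm_smul_le c a := by
    rw [norm_def, norm_def, ← tsum_mul_left]
    simp

theorem norm_coeff_le (a : AbsSeries n) (m : Fin n →₀ ℕ) : ‖coeff m a‖ ≤ ‖a‖ := by
  rw [norm_def]
  exact a.summable_coeff.le_tsum m fun _ _ => norm_nonneg _

/-- The coefficients, as continuous linear forms. -/
def coeffL (m : Fin n →₀ ℕ) : AbsSeries n →L[ℂ] ℂ :=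
  (coeff m).mkContinuous 1 fun a => by simpa using norm_coeff_le a m

@[simp]
theorem coeffL_apply (m : Fin n →₀ ℕ) (a : AbsSeries n) : coeffL m a = coeff m a := rfl

/-- The monomial `z ^ m`. -/
def mono (m : Fin n →₀ ℕ) : AbsSeries n :=
  mk (Pi.single m 1) (summable_of_ne_finset_zero (s := {m}) fun k hk => by
    rw [Pi.single_eq_of_ne (by simpa using hk), norm_zero])

theorem coeff_mono (m k : Fin n →₀ ℕ) : coeff k (mono m) = if k = m then 1 else 0 := by
  rw [mono, coeff_mk, Pi.single_apply]

theorem toSeries_mono (m : Fin n →₀ ℕ) : toSeries (mono m) = MvPowerSeries.monomial m 1 := by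
  ext k
  rw [MvPowerSeries.coeff_monomial]
  exact coeff_mono m k

theorem mono_add (m k : Fin n →₀ ℕ) : mono (m + k) = mono m * mono k := by
  refine Subtype.ext ?_
  change toSeries (mono (m + k)) = toSeries (mono m * mono k)
  rw [map_mul, toSeries_mono, toSeries_mono, toSeries_mono, MvPowerSeries.monomial_mul_monomial,
    mul_one]

theorem mono_zero : mono (0 : Fin n →₀ ℕ) = 1 := by
  ext k
  rw [coeff_mono, coeff_one]

/-- The `i`-th variable. -/
def X (i : Fin n) : AbsSeries n := mono (Finsupp.single i 1)

theorem norm_mono (m : Fin n →₀ ℕ) : ‖mono m‖ = 1 := by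
  rw [norm_def, tsum_eq_single m fun k hk => by simp [coeff_mono, hk]]
  simp [coeff_mono]

theorem coeff_add_mono_mul (m k : Fin n →₀ ℕ) (a : AbsSeries n) :
    coeff (m + k) (mono m * a) = coeff k a := by
  change MvPowerSeries.coeff _ (toSeries (mono m * a)) = _
  rw [map_mul, toSeries_mono, MvPowerSeries.coeff_add_monomial_mul, one_mul]
  rfl

theorem coeff_mono_mul_of_not_le {m k : Fin n →₀ ℕ} (h : ¬ m ≤ k) (a : AbsSeries n) :
    coeff k (mono m * a) = 0 := by
  change MvPowerSeries.coeff _ (toSeries (mono m * a)) = _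
  rw [map_mul, toSeries_mono, MvPowerSeries.coeff_monomial_mul, if_neg h]

/-! #### Evaluation -/

/-- The sum of an absolutely summable power series at a point of the unit polydisc. -/
def eval (z : Fin n → ℂ) (a : AbsSeries n) : ℂ := ∑' m, coeff m a * m.prod fun i k => z i ^ k

theorem norm_prod_le_one {z : Fin n → ℂ} (hz : ‖z‖ ≤ 1) (m : Fin n →₀ ℕ) :
    ‖m.prod fun i k => z i ^ k‖ ≤ 1 := by
  rw [Finsupp.prod, norm_prod]
  refine Finset.prod_le_one (fun _ _ => norm_nonneg _) fun i _ => ?_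
  rw [norm_pow]
  exact pow_le_one₀ (norm_nonneg _) ((norm_le_pi_norm z i).trans hz)

theorem summable_norm_eval {z : Fin n → ℂ} (hz : ‖z‖ ≤ 1) (a : AbsSeries n) :
    Summable fun m => ‖coeff m a * m.prod fun i k => z i ^ k‖ := by
  refine a.summable_coeff.of_nonneg_of_le (fun _ => norm_nonneg _) fun m => ?_
  rw [norm_mul]
  exact mul_le_of_le_one_right (norm_nonneg _) (norm_prod_le_one hz m)

theorem norm_eval_le {z : Fin n → ℂ} (hz : ‖z‖ ≤ 1) (a : AbsSeries n) : ‖eval z a‖ ≤ ‖a‖ := by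
  rw [norm_def]
  refine (norm_tsum_le_tsum_norm (summable_norm_eval hz a)).trans ?_
  refine Summable.tsum_le_tsum (fun m => ?_) (summable_norm_eval hz a) a.summable_coeff
  rw [norm_mul]
  exact mul_le_of_le_one_right (norm_nonneg _) (norm_prod_le_one hz m)

theorem eval_mono (z : Fin n → ℂ) (m : Fin n →₀ ℕ) :
    eval z (mono m) = m.prod fun i k => z i ^ k := by
  rw [eval, tsum_eq_single m fun k hk => by simp [coeff_mono, hk]]
  simp [coeff_mono]

theorem tsum_mul_tsum_antidiagonal {c d : (Fin n →₀ ℕ) → ℂ} (hc : Summable fun m => ‖c m‖)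
    (hd : Summable fun m => ‖d m‖) :
    (∑' m, c m) * ∑' m, d m =
      ∑' m, ∑ p ∈ Finset.HasAntidiagonal.antidiagonal m, c p.1 * d p.2 :=
  hc.of_norm.tsum_mul_tsum_eq_tsum_sum_antidiagonal hd.of_norm
    (summable_mul_of_summable_norm hc hd)

/-- Evaluation at a point of the unit polydisc, as a homomorphism of algebras. -/
def evalHom (z : Fin n → ℂ) (hz : ‖z‖ ≤ 1) : AbsSeries n →ₐ[ℂ] ℂ :=
  AlgHom.ofLinearMap
    { toFun := eval z
      map_add' := fun a b => by
        rw [eval, eval, eval, ← (summable_norm_eval hz a).of_norm.tsum_add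
          (summable_norm_eval hz b).of_norm]
        simp [add_mul]
      map_smul' := fun c a => by
        simp [eval, mul_assoc, tsum_mul_left] }
    (by
      change eval z 1 = 1
      rw [← mono_zero, eval_mono, Finsupp.prod_zero_index])
    (fun a b => by
      change eval z (a * b) = eval z a * eval z b
      have h := tsum_mul_tsum_antidiagonal (summable_norm_eval hz a) (summable_norm_eval hz b)
      rw [eval, eval, eval, h]
      refine tsum_congr fun m => ?_
      rw [coeff_mul, Finset.sum_mul]
      refine Finset.sum_congr rfl fun p hp => ?_
      rw [← Finset.HasAntidiagonal.mem_antidiagonal.1 hp, Finsupp.prod_add_index' (by simp) (by simp [pow_add])]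
      ring)

@[simp]
theorem evalHom_apply (z : Fin n → ℂ) (hz : ‖z‖ ≤ 1) (a : AbsSeries n) :
    evalHom z hz a = eval z a := rfl

theorem eval_X (z : Fin n → ℂ) (i : Fin n) : eval z (X i) = z i := by
  rw [X, eval_mono]
  simp

theorem eval_zero_left (a : AbsSeries n) : eval 0 a = coeff 0 a := by
  rw [eval, tsum_eq_single 0 fun m hm => ?_]
  · simp
  · obtain ⟨i, hi⟩ := Finsupp.ne_iff.1 hm
    rw [Finsupp.prod, Finset.prod_eq_zero (Finsupp.mem_support_iff.2 hi), mul_zero]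
    exact zero_pow hi

end AbsSeries

open AbsSeries

theorem _root_.HasSum.congr_terms {ι : Type*} {f g : ι → ℂ} {a : ℂ} (h : HasSum f a)
    (hfg : ∀ i, g i = f i) : HasSum g a := by
  rwa [show g = f from funext hfg]

namespace AbsSeries

variable {n : ℕ}

/-- Evaluation at a point of the unit polydisc, as a continuous linear form. -/
def evalL (z : Fin n → ℂ) (hz : ‖z‖ ≤ 1) : AbsSeries n →L[ℂ] ℂ :=
  (evalHom z hz).toLinearMap.mkContinuous 1 fun a => by simpa using norm_eval_le hz a

@[simp]
theorem evalL_apply (z : Fin n → ℂ) (hz : ‖z‖ ≤ 1) (a : AbsSeries n) :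
    evalL z hz a = eval z a := rfl

/-! #### Analyticity of the sum -/

/-- The coordinate forms occurring in the monomial `z ^ m`, with multiplicities. -/
def formList (m : Fin n →₀ ℕ) : List ((Fin n → ℂ) →L[ℂ] ℂ) :=
  m.toMultiset.toList.map fun i => ContinuousLinearMap.proj i

theorem length_formList (m : Fin n →₀ ℕ) : (formList m).length = m.degree := by
  rw [formList, List.length_map, Multiset.length_toList, Finsupp.card_toMultiset]
  rfl

theorem prod_formList (m : Fin n →₀ ℕ) (z : Fin n → ℂ) :
    ((formList m).map fun l => l z).prod = m.prod fun i k => z i ^ k := by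
  rw [formList, List.map_map, ← Multiset.prod_coe, ← Multiset.map_coe, Multiset.coe_toList,
    Finsupp.toMultiset_map, Finsupp.prod_toMultiset,
    Finsupp.prod_mapDomain_index (by simp) (by simp [pow_add])]
  rfl

/-- The monomial `z ^ m` as a multilinear map. -/
def monoMultilinear (m : Fin n →₀ ℕ) (k : ℕ) :
    ContinuousMultilinearMap ℂ (fun _ : Fin k => Fin n → ℂ) ℂ :=
  (ContinuousMultilinearMap.mkPiAlgebraFin ℂ k ℂ).compContinuousLinearMap
    fun j => (formList m).getD j 0

theorem norm_monoMultilinear_le (m : Fin n →₀ ℕ) (k : ℕ) : ‖monoMultilinear m k‖ ≤ 1 := by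
  refine (ContinuousMultilinearMap.norm_compContinuousLinearMap_le _ _).trans ?_
  rw [ContinuousMultilinearMap.norm_mkPiAlgebraFin, one_mul]
  refine Finset.prod_le_one (fun _ _ => norm_nonneg _) fun j _ => ?_
  rw [List.getD_eq_getElem?_getD]
  rcases h : (formList m)[(j : ℕ)]? with _ | l
  · simp
  · have := List.mem_of_getElem? h
    rw [formList, List.mem_map] at this
    obtain ⟨i, -, rfl⟩ := this
    refine ContinuousLinearMap.opNorm_le_bound _ zero_le_one fun z => ?_
    simpa using norm_le_pi_norm z i

theorem monoMultilinear_apply_diag (m : Fin n →₀ ℕ) (z : Fin n → ℂ) :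
    monoMultilinear m m.degree (fun _ => z) = m.prod fun i k => z i ^ k := by
  rw [← prod_formList, monoMultilinear, ContinuousMultilinearMap.compContinuousLinearMap_apply,
    ContinuousMultilinearMap.mkPiAlgebraFin_apply]
  congr 1
  refine List.ext_getElem (by simp [length_formList]) fun i h1 h2 => ?_
  simp at h2
  simp [h2]

/-- The formal multilinear series with sum `fun z => eval z a`. -/
def toFormal (a : AbsSeries n) : FormalMultilinearSeries ℂ (Fin n → ℂ) ℂ :=
  fun k => ∑ m ∈ Finset.univ.finsuppAntidiag k, coeff m a • monoMultilinear m k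

/-- Monomials are collected by total degree. For the sup norm each monomial has norm at most one as
a multilinear map, so the term of degree `k` is bounded by `‖a‖` and the radius is at least one. -/
theorem hasFPowerSeriesOnBall_eval (a : AbsSeries n) :
    HasFPowerSeriesOnBall (fun z => eval z a) a.toFormal 0 1 where
  r_le := by
    refine FormalMultilinearSeries.le_radius_of_bound (r := 1) _ ‖a‖ fun k => ?_
    rw [NNReal.coe_one, one_pow, mul_one]
    refine (norm_sum_le _ _).trans ?_
    rw [norm_def]
    refine le_trans (Finset.sum_le_sum fun m _ => ?_)
      (a.summable_coeff.sum_le_tsum _ fun _ _ => norm_nonneg _)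
    rw [norm_smul]
    exact mul_le_of_le_one_right (norm_nonneg _) (norm_monoMultilinear_le m k)
  r_pos := one_pos
  hasSum := by
    intro z hz
    have hz' : ‖z‖ ≤ 1 := by
      have : edist z 0 < 1 := hz
      rw [edist_dist, dist_zero_right, ENNReal.ofReal_lt_one] at this
      exact this.le
    have h : HasSum _ (eval z a) :=
      (summable_norm_eval hz' a).of_norm.hasSum.tsum_fiberwise Finsupp.degree
    rw [zero_add]
    refine h.congr_terms fun k => ?_
    have hk : (Finsupp.degree ⁻¹' {k} : Set (Fin n →₀ ℕ)) =
        ((Finset.univ.finsuppAntidiag k : Finset (Fin n →₀ ℕ)) : Set (Fin n →₀ ℕ)) := by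
      ext m
      simp [Finsupp.degree_eq_sum]
    rw [hk, Finset.tsum_subtype' (Finset.univ.finsuppAntidiag k)
      (fun m : Fin n →₀ ℕ => coeff m a * m.prod fun i k => z i ^ k), toFormal,
      _root_.sum_apply]
    refine Finset.sum_congr rfl fun m hm => ?_
    have hm' : m.degree = k := by simpa [Finsupp.degree_eq_sum] using hm
    subst hm'
    rw [_root_.smul_apply, monoMultilinear_apply_diag, smul_eq_mul]

theorem analyticAt_eval (a : AbsSeries n) : AnalyticAt ℂ (fun z => eval z a) 0 :=
  a.hasFPowerSeriesOnBall_eval.analyticAt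

/-! #### Series with prescribed support -/

/-- The series supported in `S`. -/
def supp (S : Set (Fin n →₀ ℕ)) : Submodule ℂ (AbsSeries n) where
  carrier := {a | ∀ m ∉ S, coeff m a = 0}
  add_mem' := fun ha hb m hm => by rw [map_add, ha m hm, hb m hm, add_zero]
  zero_mem' := fun m _ => map_zero _
  smul_mem' := fun c a ha m hm => by rw [map_smul, ha m hm, smul_zero]

theorem mem_supp {S : Set (Fin n →₀ ℕ)} {a : AbsSeries n} :
    a ∈ supp S ↔ ∀ m ∉ S, coeff m a = 0 := Iff.rfl

/-- Coefficients are continuous forms. Closedness makes `supp S` a Banach space, hence usable both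
as a space of unknowns and as a target of the local surjectivity theorem. -/
theorem isClosed_supp (S : Set (Fin n →₀ ℕ)) : IsClosed (supp S : Set (AbsSeries n)) := by
  have : (supp S : Set (AbsSeries n)) = ⋂ m ∈ Sᶜ, {a | coeffL m a = 0} := by
    ext a
    simp [mem_supp]
  rw [this]
  exact isClosed_biInter fun m _ => isClosed_eq (coeffL m).continuous continuous_const

instance (S : Set (Fin n →₀ ℕ)) : CompleteSpace (supp S) :=
  (isClosed_supp S).completeSpace_coe

theorem supp_mono {S T : Set (Fin n →₀ ℕ)} (h : S ⊆ T) : supp S ≤ supp T :=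
  fun _ ha m hm => ha m fun hS => hm (h hS)

theorem supp_inter (S T : Set (Fin n →₀ ℕ)) : supp (S ∩ T) = supp S ⊓ supp T := by
  ext a
  simp only [Submodule.mem_inf, mem_supp, Set.mem_inter_iff, not_and_or]
  exact ⟨fun h => ⟨fun m hm => h m (Or.inl hm), fun m hm => h m (Or.inr hm)⟩,
    fun h m hm => hm.elim (h.1 m) (h.2 m)⟩

theorem mul_mem_supp {S T U : Set (Fin n →₀ ℕ)} (h : ∀ m ∈ S, ∀ k ∈ T, m + k ∈ U)
    {a b : AbsSeries n} (ha : a ∈ supp S) (hb : b ∈ supp T) : a * b ∈ supp U := by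
  intro m hm
  rw [coeff_mul]
  refine Finset.sum_eq_zero fun p hp => ?_
  rw [Finset.HasAntidiagonal.mem_antidiagonal] at hp
  by_cases h1 : p.1 ∈ S
  · by_cases h2 : p.2 ∈ T
    · exact absurd (hp ▸ h _ h1 _ h2) hm
    · rw [hb _ h2, mul_zero]
  · rw [ha _ h1, zero_mul]

theorem mono_mem_supp {S : Set (Fin n →₀ ℕ)} {m : Fin n →₀ ℕ} (h : m ∈ S) : mono m ∈ supp S := by
  intro k hk
  rw [coeff_mono, if_neg]
  rintro rfl
  exact hk h

open Classical in
/-- The part of a series supported in `S`. -/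
def restrict (S : Set (Fin n →₀ ℕ)) (a : AbsSeries n) : AbsSeries n :=
  mk (fun m => if m ∈ S then coeff m a else 0) (by
    refine a.summable_coeff.of_nonneg_of_le (fun _ => norm_nonneg _) fun m => ?_
    split_ifs <;> simp)

theorem coeff_restrict_of_mem {S : Set (Fin n →₀ ℕ)} {m : Fin n →₀ ℕ} (h : m ∈ S)
    (a : AbsSeries n) : coeff m (restrict S a) = coeff m a := by
  rw [restrict, coeff_mk, if_pos h]

theorem coeff_restrict_of_notMem {S : Set (Fin n →₀ ℕ)} {m : Fin n →₀ ℕ} (h : m ∉ S)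
    (a : AbsSeries n) : coeff m (restrict S a) = 0 := by
  rw [restrict, coeff_mk, if_neg h]

theorem restrict_mem {S T : Set (Fin n →₀ ℕ)} {a : AbsSeries n} (ha : a ∈ supp T) :
    restrict S a ∈ supp (S ∩ T) := by
  intro m hm
  by_cases hS : m ∈ S
  · rw [coeff_restrict_of_mem hS, ha m fun hT => hm ⟨hS, hT⟩]
  · rw [coeff_restrict_of_notMem hS]

theorem exists_add_eq (S : Set (Fin n →₀ ℕ)) {T : Set (Fin n →₀ ℕ)} {a : AbsSeries n}
    (ha : a ∈ supp T) : ∃ b ∈ supp (S ∩ T), ∃ c ∈ supp (Sᶜ ∩ T), a = b + c := by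
  refine ⟨_, restrict_mem ha, _, restrict_mem ha, ?_⟩
  ext m
  rw [map_add]
  by_cases hS : m ∈ S
  · rw [coeff_restrict_of_mem hS, coeff_restrict_of_notMem (S := Sᶜ) (by simpa using hS), add_zero]
  · rw [coeff_restrict_of_notMem hS, coeff_restrict_of_mem (S := Sᶜ) hS, zero_add]

/-- A series all of whose monomials are divisible by `z ^ m` is divisible by `z ^ m`. -/
theorem exists_eq_mono_mul {m : Fin n →₀ ℕ} {S : Set (Fin n →₀ ℕ)} {a : AbsSeries n}
    (ha : a ∈ supp S) (hS : ∀ k ∈ S, m ≤ k) : ∃ b ∈ supp {k | m + k ∈ S}, a = mono m * b := by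
  refine ⟨mk (fun k => coeff (m + k) a) (a.summable_coeff.comp_injective
    (add_right_injective m)), fun k hk => ha _ hk, ?_⟩
  ext k
  by_cases h : m ≤ k
  · obtain ⟨l, rfl⟩ := exists_add_of_le h
    rw [coeff_add_mono_mul, coeff_mk]
  · rw [coeff_mono_mul_of_not_le h, ha k fun hk => h (hS k hk)]

/-- The series all of whose monomials have weight at least `d`. -/
abbrev filt (w : Fin n → ℕ) (d : ℕ) : Submodule ℂ (AbsSeries n) :=
  supp {m | d ≤ Finsupp.weight w m}

theorem mul_mem_filt {w : Fin n → ℕ} {d e : ℕ} {a b : AbsSeries n} (ha : a ∈ filt w d)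
    (hb : b ∈ filt w e) : a * b ∈ filt w (d + e) :=
  mul_mem_supp (fun m hm k hk => by
    rw [Set.mem_ofPred_eq, map_add]
    exact add_le_add hm hk) ha hb

theorem filt_anti {w : Fin n → ℕ} {d e : ℕ} (h : d ≤ e) : filt w e ≤ filt w d :=
  supp_mono fun _ hm => le_trans h hm

theorem mem_filt_zero (w : Fin n → ℕ) (a : AbsSeries n) : a ∈ filt w 0 :=
  fun _ hm => absurd (Nat.zero_le _) hm

theorem X_mem_filt (w : Fin n → ℕ) (i : Fin n) : X i ∈ filt w (w i) :=
  mono_mem_supp (by simp [Finsupp.weight_single])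

theorem pow_mem_filt {w : Fin n → ℕ} {d : ℕ} {a : AbsSeries n} (ha : a ∈ filt w d) (k : ℕ) :
    a ^ k ∈ filt w (k * d) := by
  induction k with
  | zero => exact filt_anti (by simp) (mem_filt_zero w _)
  | succ k ih =>
    rw [pow_succ, Nat.succ_mul]
    exact mul_mem_filt ih ha

/-! #### Weighted scaling -/

/-- The series `a(t ^ w₁ z₁, …, t ^ wₙ zₙ)`. -/
def wscale (w : Fin n → ℕ) (t : ℂ) (ht : ‖t‖ ≤ 1) (a : AbsSeries n) : AbsSeries n :=
  mk (fun m => t ^ Finsupp.weight w m * coeff m a) (by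
    refine a.summable_coeff.of_nonneg_of_le (fun _ => norm_nonneg _) fun m => ?_
    rw [norm_mul, norm_pow]
    exact mul_le_of_le_one_left (norm_nonneg _) (pow_le_one₀ (norm_nonneg _) ht))

theorem coeff_wscale (w : Fin n → ℕ) (t : ℂ) (ht : ‖t‖ ≤ 1) (a : AbsSeries n) (m : Fin n →₀ ℕ) :
    coeff m (wscale w t ht a) = t ^ Finsupp.weight w m * coeff m a := rfl

theorem wscale_mem_supp {w : Fin n → ℕ} {t : ℂ} (ht : ‖t‖ ≤ 1) {S : Set (Fin n →₀ ℕ)}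
    {a : AbsSeries n} (ha : a ∈ supp S) : wscale w t ht a ∈ supp S := fun m hm => by
  rw [coeff_wscale, ha m hm, mul_zero]

theorem eval_wscale (w : Fin n → ℕ) (t : ℂ) (ht : ‖t‖ ≤ 1) (a : AbsSeries n) (z : Fin n → ℂ) :
    eval z (wscale w t ht a) = eval (fun i => t ^ w i * z i) a := by
  refine tsum_congr fun m => ?_
  rw [coeff_wscale, mul_comm (t ^ _), mul_assoc]
  congr 1
  simp only [Finsupp.prod, mul_pow, Finset.prod_mul_distrib, Finsupp.weight_apply, Finsupp.sum,
    Finset.prod_pow_eq_pow_sum, ← pow_mul, smul_eq_mul, mul_comm]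

/-- Each surviving coefficient is multiplied by a number of modulus at most `‖t‖ ^ d`. This gain
makes the terms above the principal part negligible after rescaling. -/
theorem norm_wscale_le {w : Fin n → ℕ} {t : ℂ} (ht : ‖t‖ ≤ 1) {d : ℕ} {a : AbsSeries n}
    (ha : a ∈ filt w d) : ‖wscale w t ht a‖ ≤ ‖t‖ ^ d * ‖a‖ := by
  rw [norm_def, norm_def, ← tsum_mul_left]
  refine Summable.tsum_le_tsum (fun m => ?_) (summable_coeff _) (a.summable_coeff.mul_left _)
  rw [coeff_wscale, norm_mul, norm_pow]
  by_cases h : d ≤ Finsupp.weight w m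
  · exact mul_le_mul_of_nonneg_right (pow_le_pow_of_le_one (norm_nonneg _) ht h) (norm_nonneg _)
  · rw [ha m h, norm_zero, mul_zero, mul_zero]

/-! #### Expansion of analytic germs -/

/-- An analytic germ at the origin whose homogeneous components of degree less than `d` vanish is,
in a small polydisc rescaled to the unit polydisc, the sum of an absolutely summable power series
without terms of degree less than `d`. -/
theorem exists_eval_eq {f : (Fin n → ℂ) → ℂ} {p : FormalMultilinearSeries ℂ (Fin n → ℂ) ℂ}
    (hp : HasFPowerSeriesAt f p 0) {d : ℕ} (hd : ∀ k < d, ∀ z, (p k fun _ => z) = 0) :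
    ∃ ρ > 0, ∀ t : ℝ, 0 < t → t ≤ ρ → ∃ a ∈ filt (fun _ : Fin n => 1) d,
      ∀ z, ‖z‖ ≤ 1 → f ((t : ℂ) • z) = eval z a := by
  obtain ⟨r, hr⟩ := hp
  obtain ⟨r', hr'0, hr'⟩ := ENNReal.lt_iff_exists_nnreal_btwn.1 hr.r_pos
  have hr'0 : (0 : ℝ) < r' := by exact_mod_cast hr'0
  -- The component of degree `k` has `n ^ k` coefficients, each at most `t ^ k * ‖p k‖`, so
  -- summability asks for `n * t ≤ r'`; the `+ 1` covers `n = 0`.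
  refine ⟨r' / (n + 1), by positivity, fun t ht0 ht => ?_⟩
  have htn : n * t ≤ r' := by
    rw [le_div_iff₀ (by positivity)] at ht
    linarith
  -- Indices are tuples of variables, collected into monomials by `e`. Degrees below `d` are set to
  -- zero by hand: only the diagonal values of `p k` are known to vanish, and `p k` need not be
  -- symmetric.
  let c : (Σ k : ℕ, Fin k → Fin n) → ℂ := fun x =>
    if x.1 < d then 0 else (t : ℂ) ^ x.1 * p x.1 fun j => Pi.single (x.2 j) 1
  let e : (Σ k : ℕ, Fin k → Fin n) → (Fin n →₀ ℕ) := fun x => ∑ j, Finsupp.single (x.2 j) 1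
  have hc : ∀ x, ‖c x‖ ≤ t ^ x.1 * ‖p x.1‖ := by
    intro x
    simp only [c]
    split_ifs
    · rw [norm_zero]
      positivity
    · rw [norm_mul, norm_pow, Complex.norm_real, Real.norm_of_nonneg ht0.le]
      refine mul_le_mul_of_nonneg_left ?_ (by positivity)
      refine ((p x.1).le_opNorm _).trans ?_
      refine mul_le_of_le_one_right (norm_nonneg _) (Finset.prod_le_one (fun _ _ => norm_nonneg _)
        fun j _ => ?_)
      rw [Pi.norm_single, norm_one]
  have hsum : Summable fun x => ‖c x‖ := by
    refine Summable.of_nonneg_of_le (fun _ => norm_nonneg _) hc ?_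
    refine (summable_sigma_of_nonneg fun x => by positivity).2 ⟨fun k => ?_, ?_⟩
    · exact (hasSum_fintype _).summable
    · have h1 := p.summable_norm_mul_pow (hr'.trans_le hr.r_le)
      refine h1.of_nonneg_of_le (fun k => tsum_nonneg fun _ => by positivity) fun k => ?_
      rw [tsum_fintype]
      change ∑ _x : Fin k → Fin n, t ^ k * ‖p k‖ ≤ _
      simp only [Finset.sum_const, Finset.card_univ, Fintype.card_pi, Fintype.card_fin,
        Finset.prod_const, nsmul_eq_mul, Nat.cast_pow]
      calc (n : ℝ) ^ k * (t ^ k * ‖p k‖) = ‖p k‖ * (n * t) ^ k := by ring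
        _ ≤ _ := by gcongr
  have hsumA : Summable fun x => c x • mono (e x) := by
    refine Summable.of_norm ?_
    simpa [norm_smul, norm_mono] using hsum
  refine ⟨∑' x, c x • mono (e x), ?_, fun z hz => ?_⟩
  · refine (isClosed_supp _).mem_of_tendsto hsumA.hasSum (Eventually.of_forall fun s => ?_)
    refine Submodule.sum_mem _ fun x _ => ?_
    by_cases hx : x.1 < d
    · simp [c, hx]
    · refine Submodule.smul_mem _ _ (mono_mem_supp ?_)
      simpa [e, map_sum, Finsupp.weight_single] using hx
  · have hz' : (t : ℂ) • z ∈ Metric.eball (0 : Fin n → ℂ) r := by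
      refine Metric.mem_eball.2 (lt_of_le_of_lt ?_ hr')
      rw [edist_zero_right, ← ofReal_norm, norm_smul, Complex.norm_real,
        Real.norm_of_nonneg ht0.le, ← ENNReal.ofReal_coe_nnreal]
      refine ENNReal.ofReal_le_ofReal ((mul_le_of_le_one_right ht0.le hz).trans (ht.trans ?_))
      exact div_le_self hr'0.le (by linarith [n.cast_nonneg (α := ℝ)])
    have h1 : HasSum (fun x => c x * (e x).prod fun i k => z i ^ k)
        (eval z (∑' x, c x • mono (e x))) := by
      have := hsumA.hasSum.mapL (evalL z hz)
      simpa [evalL_apply, eval_mono] using this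
    have h2 := h1.sigma fun k => hasSum_fintype _
    have h3 := hr.hasSum hz'
    rw [zero_add] at h3
    refine h3.unique (h2.congr_terms fun k => ?_)
    by_cases hk : k < d
    · simp [c, hk, hd k hk]
    · have hz2 : z = ∑ i, Pi.single i (z i) := (Finset.univ_sum_single z).symm
      have h4 : (p k fun _ => (t : ℂ) • z) = (t : ℂ) ^ k * p k fun _ => z := by
        have := (p k).map_smul_univ (fun _ => (t : ℂ)) fun _ => z
        simpa using this
      rw [h4]
      conv_lhs => rw [hz2]
      rw [ContinuousMultilinearMap.map_sum, Finset.mul_sum]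
      refine Finset.sum_congr rfl fun x _ => ?_
      have h5 : (fun j => Pi.single (x j) (z (x j)) : Fin k → Fin n → ℂ) =
          fun j => z (x j) • Pi.single (x j) (1 : ℂ) := by
        funext j
        rw [← Pi.single_smul, smul_eq_mul, mul_one]
      have h6 : ((∑ j, Finsupp.single (x j) 1 : Fin n →₀ ℕ).prod fun i k => z i ^ k) =
          ∏ j, z (x j) := by
        rw [← Finsupp.prod_finsetSum_index (by simp) (by simp [pow_add])]
        simp
      rw [h5, ContinuousMultilinearMap.map_smul_univ]
      simp only [c, e, hk, if_false, h6, smul_eq_mul]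
      ring

end AbsSeries

/-! ### Right equivalence -/

section RightEquivalence

variable {n : ℕ} {f g h : (Fin n → ℂ) → ℂ}

theorem RightEquivalent.symm (hfg : RightEquivalent f g) : RightEquivalent g f := by
  obtain ⟨φ, ψ, hφ, hψ, hφ0, hψ0, h1, h2, h3⟩ := hfg
  have hψt : Tendsto ψ (𝓝 0) (𝓝 0) := by simpa [hψ0] using hψ.continuousAt.tendsto
  refine ⟨ψ, φ, hψ, hφ, hψ0, hφ0, h2, h1, ?_⟩
  filter_upwards [h2, hψt.eventually h3] with x hx hx'
  rw [← hx', hx]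

theorem RightEquivalent.trans (hfg : RightEquivalent f g) (hgh : RightEquivalent g h) :
    RightEquivalent f h := by
  obtain ⟨φ, ψ, hφ, hψ, hφ0, hψ0, h1, h2, h3⟩ := hfg
  obtain ⟨φ', ψ', hφ', hψ', hφ0', hψ0', h1', h2', h3'⟩ := hgh
  have ht : Tendsto φ' (𝓝 0) (𝓝 0) := by simpa [hφ0'] using hφ'.continuousAt.tendsto
  have ht' : Tendsto ψ (𝓝 0) (𝓝 0) := by simpa [hψ0] using hψ.continuousAt.tendsto
  refine ⟨φ ∘ φ', ψ' ∘ ψ, AnalyticAt.comp (by rwa [hφ0']) hφ', AnalyticAt.comp (by rwa [hψ0]) hψ,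
    by simp [hφ0, hφ0'], by simp [hψ0, hψ0'], ?_, ?_, ?_⟩
  · filter_upwards [h1', ht.eventually h1] with x hx hx'
    simp [hx, hx']
  · filter_upwards [h2, ht'.eventually h2'] with x hx hx'
    simp [hx, hx']
  · filter_upwards [h3', ht.eventually h3] with x hx hx'
    simp [hx, hx']

theorem RightEquivalent.of_eventuallyEq (hfg : f =ᶠ[𝓝 0] g) : RightEquivalent f g :=
  ⟨id, id, analyticAt_id, analyticAt_id, rfl, rfl, Eventually.of_forall fun _ => rfl,
    Eventually.of_forall fun _ => rfl, hfg⟩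

/-- A germ with injective derivative at the origin has an analytic local inverse. -/
theorem exists_analytic_inverse {φ : (Fin n → ℂ) → (Fin n → ℂ)} (hφ : AnalyticAt ℂ φ 0)
    (hφ0 : φ 0 = 0) (hinj : Function.Injective (fderiv ℂ φ 0)) :
    ∃ ψ : (Fin n → ℂ) → (Fin n → ℂ), AnalyticAt ℂ ψ 0 ∧ ψ 0 = 0 ∧
      (∀ᶠ x in 𝓝 0, ψ (φ x) = x) ∧ ∀ᶠ x in 𝓝 0, φ (ψ x) = x := by
  let i : (Fin n → ℂ) ≃L[ℂ] (Fin n → ℂ) :=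
    (LinearEquiv.ofInjectiveEndo (fderiv ℂ φ 0 : (Fin n → ℂ) →ₗ[ℂ] (Fin n → ℂ))
      hinj).toContinuousLinearEquiv
  have hi : (i : (Fin n → ℂ) →L[ℂ] (Fin n → ℂ)) = fderiv ℂ φ 0 := by
    ext v
    rfl
  have hd : HasStrictFDerivAt φ (i : (Fin n → ℂ) →L[ℂ] (Fin n → ℂ)) 0 := by
    rw [hi]
    exact hφ.hasStrictFDerivAt
  let R := hd.toOpenPartialHomeomorph φ
  have h0 : (0 : Fin n → ℂ) ∈ R.source := hd.mem_toOpenPartialHomeomorph_source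
  have hR : AnalyticAt ℂ R.symm (R 0) := R.analyticAt_symm' h0 hφ hi.symm
  have hR0 : R 0 = 0 := hφ0
  rw [hR0] at hR
  have hinv : R.symm 0 = 0 := by
    conv_lhs => rw [← hR0]
    exact R.left_inv h0
  refine ⟨R.symm, hR, hinv, R.eventually_left_inverse h0, ?_⟩
  have := R.eventually_right_inverse' h0
  rwa [hR0] at this

/-- A germ of holomorphic map with injective derivative at the origin is a coordinate change. -/
theorem RightEquivalent.of_analyticAt {φ : (Fin n → ℂ) → (Fin n → ℂ)} (hφ : AnalyticAt ℂ φ 0)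
    (hφ0 : φ 0 = 0) (hinj : Function.Injective (fderiv ℂ φ 0))
    (hfg : ∀ᶠ x in 𝓝 0, f (φ x) = g x) : RightEquivalent f g := by
  obtain ⟨ψ, hψ, hψ0, h1, h2⟩ := exists_analytic_inverse hφ hφ0 hinj
  exact ⟨φ, ψ, hφ, hψ, hφ0, hψ0, h1, h2, hfg⟩

/-- Linear changes of coordinates. -/
theorem RightEquivalent.of_linear (T : (Fin n → ℂ) →L[ℂ] (Fin n → ℂ)) (hT : Function.Injective T)
    (hfg : ∀ᶠ x in 𝓝 0, f (T x) = g x) : RightEquivalent f g :=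
  .of_analyticAt (T.analyticAt 0) (map_zero T) (by rwa [T.fderiv]) hfg

/-- Rescaling the coordinates. -/
theorem RightEquivalent.of_scale (c : Fin n → ℂ) (hc : ∀ i, c i ≠ 0)
    (hfg : ∀ᶠ x in 𝓝 0, f (fun i => c i * x i) = g x) : RightEquivalent f g := by
  refine .of_linear (ContinuousLinearMap.pi fun i => c i • ContinuousLinearMap.proj i) ?_
    (by simpa using hfg)
  intro x y hxy
  funext i
  have := congrFun hxy i
  simpa [hc i] using this

/-- A Schwarz-type estimate: `z` is the unit vector `‖z‖⁻¹ • z` rescaled by `‖z‖`, and this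
rescaling contracts series without constant term by the factor `‖z‖`. -/
theorem AbsSeries.norm_eval_le_norm_mul {a : AbsSeries n} (ha : AbsSeries.coeff 0 a = 0)
    {z : Fin n → ℂ} (hz : ‖z‖ ≤ 1) : ‖AbsSeries.eval z a‖ ≤ ‖a‖ * ‖z‖ := by
  rcases eq_or_ne z 0 with rfl | h
  · simp [AbsSeries.eval_zero_left, ha]
  have hn : ‖z‖ ≠ 0 := norm_ne_zero_iff.2 h
  have hmem : a ∈ AbsSeries.filt (fun _ => 1) 1 := by
    intro m hm
    have : m = 0 := by
      simpa [Finsupp.weight_apply, Finsupp.sum, Finsupp.ext_iff] using hm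
    rw [this, ha]
  have ht : ‖((‖z‖ : ℝ) : ℂ)‖ ≤ 1 := by simpa using hz
  have h1 := AbsSeries.eval_wscale (fun _ => 1) ((‖z‖ : ℝ) : ℂ) ht a
    (((‖z‖ : ℝ) : ℂ)⁻¹ • z)
  have h2 : (fun i => ((‖z‖ : ℝ) : ℂ) ^ 1 * (((‖z‖ : ℝ) : ℂ)⁻¹ • z) i) = z := by
    funext i
    simp [hn]
  rw [h2] at h1
  rw [← h1]
  refine (AbsSeries.norm_eval_le ?_ _).trans ((AbsSeries.norm_wscale_le ht hmem).trans_eq ?_)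
  · rw [norm_smul]
    simp [hn]
  · simp [mul_comm]

/-- A change of coordinates `z ↦ z + ξ(z)` with `ξ` a small absolutely summable series. -/
theorem RightEquivalent.of_series (ξ : Fin n → AbsSeries n) (h0 : ∀ i, AbsSeries.coeff 0 (ξ i) = 0)
    (hξ : ∀ i, ‖ξ i‖ ≤ 1 / 2)
    (hfg : ∀ᶠ z in 𝓝 0, f (fun i => z i + AbsSeries.eval z (ξ i)) = g z) :
    RightEquivalent f g := by
  have han : AnalyticAt ℂ (fun z : Fin n → ℂ => fun i => AbsSeries.eval z (ξ i)) 0 :=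
    AnalyticAt.pi fun i => AbsSeries.analyticAt_eval (ξ i)
  -- A perturbation of the identity with derivative of norm less than one has injective derivative.
  have hle : ‖fderiv ℂ (fun z : Fin n → ℂ => fun i => AbsSeries.eval z (ξ i)) 0‖ ≤ 1 / 2 := by
    refine han.differentiableAt.hasFDerivAt.le_of_lip' (by norm_num) ?_
    filter_upwards [Metric.closedBall_mem_nhds (0 : Fin n → ℂ) one_pos] with z hz
    have hz : ‖z‖ ≤ 1 := by simpa using hz
    rw [sub_zero, pi_norm_le_iff_of_nonneg (by positivity)]
    intro i
    rw [Pi.sub_apply, AbsSeries.eval_zero_left, h0, sub_zero]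
    exact (AbsSeries.norm_eval_le_norm_mul (h0 i) hz).trans
      (mul_le_mul_of_nonneg_right (hξ i) (norm_nonneg _))
  refine .of_analyticAt (φ := fun z => z + fun i => AbsSeries.eval z (ξ i))
    (analyticAt_id.add han) ?_ ?_ hfg
  · funext i
    simp [AbsSeries.eval_zero_left, h0]
  · rw [fderiv_fun_add differentiableAt_fun_id han.differentiableAt, fderiv_fun_id]
    rw [injective_iff_map_eq_zero]
    intro v hv
    have h1 : v = -(fderiv ℂ (fun z : Fin n → ℂ => fun i => AbsSeries.eval z (ξ i)) 0 v) :=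
      eq_neg_of_add_eq_zero_left hv
    have h2 : ‖v‖ ≤ 1 / 2 * ‖v‖ := by
      conv_lhs => rw [h1, norm_neg]
      exact (ContinuousLinearMap.le_opNorm _ _).trans
        (mul_le_mul_of_nonneg_right hle (norm_nonneg _))
    exact norm_eq_zero.1 (by linarith [norm_nonneg v])

/-- The singular points of the zero set of `f` near the origin: right equivalence preserves
whether the origin is isolated among them. -/
theorem RightEquivalent.isolated (hfg : RightEquivalent f g) (hf : AnalyticAt ℂ f 0)
    (hi : ∀ᶠ x in 𝓝[≠] (0 : Fin n → ℂ), f x = 0 → fderiv ℂ f x ≠ 0) :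
    ∀ᶠ x in 𝓝[≠] (0 : Fin n → ℂ), g x = 0 → fderiv ℂ g x ≠ 0 := by
  obtain ⟨φ, ψ, hφ, hψ, hφ0, hψ0, h1, h2, h3⟩ := hfg
  rw [eventually_nhdsWithin_iff] at hi ⊢
  have ht : Tendsto φ (𝓝 0) (𝓝 0) := by simpa [hφ0] using hφ.continuousAt.tendsto
  have hfφ : ∀ᶠ x in 𝓝 0, AnalyticAt ℂ f (φ x) := ht.eventually hf.eventually_analyticAt
  have hψφ : ∀ᶠ x in 𝓝 0, AnalyticAt ℂ ψ (φ x) := ht.eventually hψ.eventually_analyticAt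
  filter_upwards [hφ.eventually_analyticAt, hfφ, hψφ, h1.eventually_nhds, h3.eventually_nhds,
    ht.eventually hi] with x hx hfx hψx h1x h3x hix hx0 hgx hdg
  have hφx : φ x ≠ 0 := by
    intro h
    apply hx0
    rw [Set.mem_singleton_iff, ← h1x.self_of_nhds, h, hψ0]
  refine hix hφx (by rw [h3x.self_of_nhds, hgx]) ?_
  have e1 : fderiv ℂ g x = (fderiv ℂ f (φ x)).comp (fderiv ℂ φ x) := by
    have : (f ∘ φ) =ᶠ[𝓝 x] g := h3x
    rw [← this.fderiv_eq]
    exact fderiv_comp x hfx.differentiableAt hx.differentiableAt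
  have e2 : (fderiv ℂ ψ (φ x)).comp (fderiv ℂ φ x) = ContinuousLinearMap.id ℂ _ := by
    rw [← fderiv_comp x hψx.differentiableAt hx.differentiableAt]
    have : (ψ ∘ φ) =ᶠ[𝓝 x] id := h1x
    rw [this.fderiv_eq, fderiv_id]
  -- The differential of `φ` at `x` has a left inverse, so it is onto by dimension; the vanishing of
  -- `dg` at `x` therefore forces that of `df` at `φ x`.
  have hsurj : Function.Surjective (fderiv ℂ φ x : (Fin n → ℂ) →ₗ[ℂ] (Fin n → ℂ)) := by
    refine LinearMap.surjective_of_injective fun u v huv => ?_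
    have hu := congrArg (fun T : (Fin n → ℂ) →L[ℂ] (Fin n → ℂ) => T u) e2
    have hv := congrArg (fun T : (Fin n → ℂ) →L[ℂ] (Fin n → ℂ) => T v) e2
    have huv' : fderiv ℂ φ x u = fderiv ℂ φ x v := huv
    simp only [ContinuousLinearMap.comp_apply, ContinuousLinearMap.id_apply] at hu hv
    rw [← hu, huv', hv]
  ext u
  obtain ⟨v, rfl⟩ := hsurj u
  have := congrArg (fun T : (Fin n → ℂ) →L[ℂ] ℂ => T v) e1
  rw [hdg] at this
  simpa using this.symm

end RightEquivalence

/-! ### Local surjectivity -/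

/-- A map which is strictly differentiable at the origin with derivative onto a closed subspace
`H`, and whose increments lie in `H`, is locally onto `H`. -/
theorem exists_eq_add_of_hasStrictFDerivAt {E F : Type*} [NormedAddCommGroup E] [NormedSpace ℂ E]
    [CompleteSpace E] [NormedAddCommGroup F] [NormedSpace ℂ F] [CompleteSpace F]
    {H : Submodule ℂ F} (hH : IsClosed (H : Set F)) {Φ : E → F} {L : E →L[ℂ] F}
    (hΦ : HasStrictFDerivAt Φ L 0) (hmem : ∀ u, Φ u - Φ 0 ∈ H)
    (hsurj : ∀ h ∈ H, ∃ u, L u = h) {ε : ℝ} (hε : 0 < ε) :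
    ∃ δ > 0, ∀ h ∈ H, ‖h‖ < δ → ∃ u, ‖u‖ < ε ∧ Φ u = Φ 0 + h := by
  have : CompleteSpace H := hH.completeSpace_coe
  -- The difference quotients of `Φ` lie in `H`, so their limits do too; `Φ - Φ 0` can thus be
  -- regarded as a map into the Banach space `H`.
  have hL : ∀ u, L u ∈ H := by
    intro u
    have h1 : HasDerivAt (fun t : ℂ => Φ (t • u)) (L u) 0 := by
      have h2 : HasFDerivAt Φ L ((0 : ℂ) • u) := by
        rw [zero_smul]
        exact hΦ.hasFDerivAt
      have h3 : HasDerivAt (fun t : ℂ => t • u) u 0 := by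
        simpa using (hasDerivAt_id (0 : ℂ)).smul_const u
      exact h2.comp_hasDerivAt 0 h3
    refine hH.mem_of_tendsto h1.tendsto_slope_zero (Eventually.of_forall fun t => ?_)
    rw [zero_smul]
    exact H.smul_mem _ (hmem _)
  let Ψ : E → H := fun u => ⟨Φ u - Φ 0, hmem u⟩
  have hΨ : HasStrictFDerivAt Ψ (L.codRestrict H hL) 0 := by
    have h := hΦ.isLittleO
    refine .of_isLittleO ?_
    refine (Asymptotics.isLittleO_norm_left.1 ?_)
    refine (Asymptotics.isLittleO_norm_left.2 h).congr_left fun p => ?_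
    change _ = ‖(Φ p.1 - Φ 0) - (Φ p.2 - Φ 0) - L (p.1 - p.2)‖
    rw [sub_sub_sub_cancel_right]
  have hrange : (L.codRestrict H hL).range = ⊤ := by
    rw [LinearMap.range_eq_top]
    intro h
    obtain ⟨u, hu⟩ := hsurj h h.2
    exact ⟨u, Subtype.ext hu⟩
  have hmap := hΨ.map_nhds_eq_of_surj hrange
  have hΨ0 : Ψ 0 = 0 := Subtype.ext (sub_self _)
  have hball : Ψ '' Metric.ball 0 ε ∈ 𝓝 (0 : H) := by
    rw [← hΨ0, ← hmap]
    exact image_mem_map (Metric.ball_mem_nhds 0 hε)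
  obtain ⟨δ, hδ, hsub⟩ := Metric.mem_nhds_iff.1 hball
  refine ⟨δ, hδ, fun h hh hn => ?_⟩
  obtain ⟨u, hu, hu'⟩ := hsub (show (⟨h, hh⟩ : H) ∈ Metric.ball 0 δ by simpa using hn)
  refine ⟨u, by simpa using hu, ?_⟩
  have := congrArg Subtype.val hu'
  simp only [Ψ] at this
  rw [← this]
  abel

/-! ### Germs whose expansion has prescribed support -/

section GermSupp

variable {n : ℕ}

/-- The germ at the origin of `g` is analytic and the monomials in its expansion belong to `S`. -/
def GermSupp (S : Set (Fin n →₀ ℕ)) (g : (Fin n → ℂ) → ℂ) : Prop :=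
  ∃ ρ > 0, ∀ t : ℝ, 0 < t → t ≤ ρ → ∃ a ∈ supp S, ∀ z, ‖z‖ ≤ 1 → g ((t : ℂ) • z) = eval z a

variable {S T U : Set (Fin n →₀ ℕ)} {f g : (Fin n → ℂ) → ℂ}

theorem GermSupp.mono (hg : GermSupp S g) (h : S ⊆ T) : GermSupp T g := by
  obtain ⟨ρ, hρ, H⟩ := hg
  refine ⟨ρ, hρ, fun t ht ht' => ?_⟩
  obtain ⟨a, ha, haz⟩ := H t ht ht'
  exact ⟨a, supp_mono h ha, haz⟩

theorem GermSupp.congr (hg : GermSupp S g) (h : f =ᶠ[𝓝 0] g) : GermSupp S f := by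
  obtain ⟨ρ, hρ, H⟩ := hg
  obtain ⟨ε, hε, hε'⟩ := Metric.eventually_nhds_iff_ball.1 h
  refine ⟨min ρ (ε / 2), by positivity, fun t ht ht' => ?_⟩
  obtain ⟨a, ha, haz⟩ := H t ht (ht'.trans (min_le_left _ _))
  refine ⟨a, ha, fun z hz => ?_⟩
  rw [← haz z hz]
  refine hε' _ ?_
  rw [mem_ball_zero_iff, norm_smul, Complex.norm_real, Real.norm_of_nonneg ht.le]
  have h1 := ht'.trans (min_le_right _ _)
  have h2 := mul_le_of_le_one_right ht.le hz
  linarith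

theorem GermSupp.add (hf : GermSupp S f) (hg : GermSupp S g) :
    GermSupp S (fun z => f z + g z) := by
  obtain ⟨ρ, hρ, H⟩ := hf
  obtain ⟨ρ', hρ', H'⟩ := hg
  refine ⟨min ρ ρ', by positivity, fun t ht ht' => ?_⟩
  obtain ⟨a, ha, haz⟩ := H t ht (ht'.trans (min_le_left _ _))
  obtain ⟨b, hb, hbz⟩ := H' t ht (ht'.trans (min_le_right _ _))
  refine ⟨a + b, add_mem ha hb, fun z hz => ?_⟩
  change f _ + g _ = _
  rw [haz z hz, hbz z hz]
  exact (map_add (evalHom z hz) a b).symm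

theorem GermSupp.mul (hf : GermSupp S f) (hg : GermSupp T g)
    (h : ∀ m ∈ S, ∀ k ∈ T, m + k ∈ U) : GermSupp U (fun z => f z * g z) := by
  obtain ⟨ρ, hρ, H⟩ := hf
  obtain ⟨ρ', hρ', H'⟩ := hg
  refine ⟨min ρ ρ', by positivity, fun t ht ht' => ?_⟩
  obtain ⟨a, ha, haz⟩ := H t ht (ht'.trans (min_le_left _ _))
  obtain ⟨b, hb, hbz⟩ := H' t ht (ht'.trans (min_le_right _ _))
  refine ⟨a * b, mul_mem_supp h ha hb, fun z hz => ?_⟩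
  change f _ * g _ = _
  rw [haz z hz, hbz z hz]
  exact (map_mul (evalHom z hz) a b).symm

theorem GermSupp.const_mul (c : ℂ) (hg : GermSupp S g) : GermSupp S (fun z => c * g z) := by
  obtain ⟨ρ, hρ, H⟩ := hg
  refine ⟨ρ, hρ, fun t ht ht' => ?_⟩
  obtain ⟨a, ha, haz⟩ := H t ht ht'
  refine ⟨c • a, Submodule.smul_mem _ c ha, fun z hz => ?_⟩
  change c * g _ = _
  rw [haz z hz]
  exact (map_smul (evalHom z hz) c a).symm

theorem GermSupp.of_eval {a : AbsSeries n} (ha : a ∈ supp S) : GermSupp S (fun z => eval z a) := by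
  refine ⟨1, one_pos, fun t ht ht' => ?_⟩
  have ht1 : ‖(t : ℂ)‖ ≤ 1 := by
    rwa [Complex.norm_real, Real.norm_of_nonneg ht.le]
  refine ⟨wscale (fun _ => 1) t ht1 a, wscale_mem_supp ht1 ha, fun z hz => ?_⟩
  rw [eval_wscale]
  simp only [pow_one]
  rfl

theorem GermSupp.of_hasFPowerSeriesAt {p : FormalMultilinearSeries ℂ (Fin n → ℂ) ℂ}
    (hp : HasFPowerSeriesAt f p 0) {d : ℕ} (hd : ∀ k < d, ∀ z, (p k fun _ => z) = 0) :
    GermSupp {m | d ≤ Finsupp.weight (fun _ => 1) m} f :=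
  exists_eval_eq hp hd

theorem _root_.AnalyticAt.germSupp (hf : AnalyticAt ℂ f 0) : GermSupp Set.univ f := by
  obtain ⟨p, hp⟩ := hf
  exact (GermSupp.of_hasFPowerSeriesAt hp (d := 0) fun k hk => absurd hk k.not_lt_zero).mono
    (Set.subset_univ _)

theorem GermSupp.exists_eval (hg : GermSupp S g) :
    ∃ ρ : ℝ, 0 < ρ ∧ ∃ a ∈ supp S, ∀ᶠ z in 𝓝 0, g z = eval ((ρ : ℂ)⁻¹ • z) a := by
  obtain ⟨ρ, hρ, H⟩ := hg
  obtain ⟨a, ha, haz⟩ := H ρ hρ le_rfl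
  have hρ' : (ρ : ℂ) ≠ 0 := by exact_mod_cast hρ.ne'
  refine ⟨ρ, hρ, a, ha, ?_⟩
  filter_upwards [Metric.closedBall_mem_nhds 0 hρ] with z hz
  rw [mem_closedBall_zero_iff] at hz
  rw [← haz]
  · rw [smul_inv_smul₀ hρ']
  · rw [norm_smul, norm_inv, Complex.norm_real, Real.norm_of_nonneg hρ.le]
    exact (inv_mul_le_one₀ hρ).2 hz

theorem GermSupp.analyticAt (hg : GermSupp S g) : AnalyticAt ℂ g 0 := by
  obtain ⟨ρ, hρ, a, -, h⟩ := hg.exists_eval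
  refine AnalyticAt.congr ?_ (EventuallyEq.symm h)
  refine AnalyticAt.comp (g := fun z => eval z a) ?_ (by fun_prop)
  rw [smul_zero]
  exact a.analyticAt_eval

/-- The expansion of a germ in weighted rescaled coordinates. -/
theorem GermSupp.exists_wscale (hg : GermSupp S g) {w : Fin n → ℕ} (hw : ∀ i, 0 < w i) {d : ℕ}
    (hS : ∀ m ∈ S, d ≤ Finsupp.weight w m) :
    ∃ C t₀ : ℝ, 0 < t₀ ∧ ∀ t : ℝ, 0 < t → t ≤ t₀ → ∃ a ∈ supp S, ‖a‖ ≤ C * t ^ d ∧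
      ∀ z, ‖z‖ ≤ 1 → g (fun i => (t : ℂ) ^ w i * z i) = eval z a := by
  obtain ⟨ρ, hρ, H⟩ := hg
  have hr : 0 < min ρ 1 := by positivity
  generalize hr_eq : min ρ 1 = r at hr
  have hrρ : r ≤ ρ := hr_eq ▸ min_le_left _ _
  have hr1 : r ≤ 1 := hr_eq ▸ min_le_right _ _
  obtain ⟨a, ha, haz⟩ := H r hr hrρ
  have hr1' : ‖(r : ℂ)‖ ≤ 1 := by rwa [Complex.norm_real, Real.norm_of_nonneg hr.le]
  refine ⟨‖a‖ / r ^ d, r, hr, fun t ht htr => ?_⟩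
  have htr' : ‖((t / r : ℝ) : ℂ)‖ ≤ 1 := by
    rw [Complex.norm_real, Real.norm_of_nonneg (by positivity)]
    exact (div_le_one hr).2 htr
  -- Here `t ^ w i = r * (r ^ (w i - 1) * (t / r) ^ w i)`: the outer `r` is the radius at which `a`
  -- represents `g`, and the factor in `t / r` yields the power `t ^ d`. Positivity of the weights
  -- makes the subtraction exact.
  refine ⟨wscale (fun i => w i - 1) r hr1' (wscale w (t / r : ℝ) htr' a),
    wscale_mem_supp _ (wscale_mem_supp _ ha), ?_, fun z hz => ?_⟩
  · refine (norm_wscale_le (d := 0) hr1' (mem_filt_zero _ _)).trans ?_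
    rw [pow_zero, one_mul]
    refine (norm_wscale_le htr' (supp_mono hS ha)).trans_eq ?_
    rw [Complex.norm_real, Real.norm_of_nonneg (by positivity), div_pow]
    ring
  · rw [eval_wscale, eval_wscale, ← haz]
    · congr 1
      funext i
      have hr0 : (r : ℂ) ≠ 0 := by exact_mod_cast hr.ne'
      obtain ⟨k, hk⟩ := Nat.exists_eq_succ_of_ne_zero (hw i).ne'
      rw [Pi.smul_apply, hk, Nat.succ_eq_add_one, Nat.add_sub_cancel, smul_eq_mul,
        Complex.ofReal_div, div_pow, pow_succ (r : ℂ)]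
      field_simp
    · rw [pi_norm_le_iff_of_nonneg zero_le_one]
      intro i
      rw [norm_mul, norm_mul, norm_pow, norm_pow]
      refine mul_le_one₀ (pow_le_one₀ (norm_nonneg _) htr') (by positivity)
        (mul_le_one₀ (pow_le_one₀ (norm_nonneg _) hr1') (norm_nonneg _)
          ((norm_le_pi_norm z i).trans hz))

/-- The germ at the origin of `g` has only terms of weight at least `d`. -/
abbrev WeightGE (w : Fin n → ℕ) (d : ℕ) (g : (Fin n → ℂ) → ℂ) : Prop :=
  GermSupp {m | d ≤ Finsupp.weight w m} g

theorem WeightGE.mul {w : Fin n → ℕ} {d e k : ℕ} (hf : WeightGE w d f) (hg : WeightGE w e g)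
    (h : k ≤ d + e) : WeightGE w k (fun z => f z * g z) :=
  GermSupp.mul hf hg fun m hm l hl => by
    rw [Set.mem_ofPred_eq, map_add]
    exact h.trans (add_le_add hm hl)

theorem WeightGE.of_analyticAt (w : Fin n → ℕ) (hf : AnalyticAt ℂ f 0) : WeightGE w 0 f :=
  hf.germSupp.mono fun _ _ => Nat.zero_le _

theorem WeightGE.anti {w : Fin n → ℕ} {d e : ℕ} (hf : WeightGE w e f) (h : d ≤ e) :
    WeightGE w d f :=
  hf.mono fun _ hm => le_trans h hm

theorem WeightGE.coord (w : Fin n → ℕ) (i : Fin n) : WeightGE w (w i) (fun z => z i) :=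
  (GermSupp.of_eval (X_mem_filt w i)).congr (Eventually.of_forall fun z => (eval_X z i).symm)

theorem WeightGE.pow {w : Fin n → ℕ} {d : ℕ} (hf : WeightGE w d f) (k : ℕ) :
    WeightGE w (k * d) (fun z => f z ^ k) := by
  induction k with
  | zero => simpa using WeightGE.of_analyticAt w (analyticAt_const (v := (1 : ℂ)))
  | succ k ih =>
    simp only [pow_succ]
    exact ih.mul hf (by rw [Nat.succ_mul])

end GermSupp

/-! ### Polynomials in absolutely summable series -/

section Aeval

variable {n : ℕ}

/-- The chain rule, by induction on `P`. At `v = X` it computes the infinitesimal action of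
coordinate changes on `P`, so solving the linearized problem means dividing by the partial
derivatives. -/
theorem hasStrictFDerivAt_aeval (P : MvPolynomial (Fin n) ℂ) (v : Fin n → AbsSeries n) :
    ∃ L : (Fin n → AbsSeries n) →L[ℂ] AbsSeries n,
      HasStrictFDerivAt (fun v : Fin n → AbsSeries n => MvPolynomial.aeval v P) L v ∧
      ∀ u, L u = ∑ i, u i * MvPolynomial.aeval v (MvPolynomial.pderiv i P) := by
  induction P using MvPolynomial.induction_on with
  | C c =>
    refine ⟨0, ?_, fun u => by simp⟩
    simp only [MvPolynomial.aeval_C]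
    exact hasStrictFDerivAt_const _ _
  | add p q hp hq =>
    obtain ⟨L, hL, hL'⟩ := hp
    obtain ⟨M, hM, hM'⟩ := hq
    refine ⟨L + M, ?_, fun u => ?_⟩
    · simp only [map_add]
      exact hL.add hM
    · simp [hL', hM', mul_add, Finset.sum_add_distrib]
  | mul_X p j hp =>
    obtain ⟨L, hL, hL'⟩ := hp
    refine ⟨MvPolynomial.aeval v p • ContinuousLinearMap.proj j + v j • L, ?_, fun u => ?_⟩
    · simp only [map_mul, MvPolynomial.aeval_X]
      exact hL.mul ((ContinuousLinearMap.proj (R := ℂ) (φ := fun _ : Fin n => AbsSeries n)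
        j).hasStrictFDerivAt)
    · simp only [_root_.add_apply, _root_.smul_apply, hL', ContinuousLinearMap.proj_apply,
        smul_eq_mul, Derivation.leibniz, MvPolynomial.pderiv_X, map_add, map_mul,
        MvPolynomial.aeval_X, mul_add, Finset.sum_add_distrib]
      congr 1
      · rw [Finset.sum_eq_single j]
        · simp [mul_comm]
        · intro i _ hij
          simp [hij.symm]
        · simp
      · rw [Finset.mul_sum]
        exact Finset.sum_congr rfl fun i _ => by ring

theorem eval_aeval {z : Fin n → ℂ} (hz : ‖z‖ ≤ 1) (v : Fin n → AbsSeries n)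
    (P : MvPolynomial (Fin n) ℂ) :
    AbsSeries.eval z (MvPolynomial.aeval v P) =
      MvPolynomial.eval (fun i => AbsSeries.eval z (v i)) P := by
  rw [← evalHom_apply z hz, MvPolynomial.comp_aeval_apply, MvPolynomial.aeval_eq_eval]
  rfl

theorem prod_X_pow (m : Fin n →₀ ℕ) : (m.prod fun i k => X i ^ k) = mono m := by
  induction m using Finsupp.induction with
  | zero => simp [mono_zero]
  | single_add i k m him hk ih =>
    rw [Finsupp.prod_add_index' (by simp) (by simp [pow_add]), ih, mono_add,
      Finsupp.prod_single_index (h := fun i k => AbsSeries.X (n := n) i ^ k) (pow_zero _)]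
    congr 1
    clear hk
    induction k with
    | zero => simp [mono_zero]
    | succ k ih => rw [pow_succ, ih, Finsupp.single_add, mono_add, AbsSeries.X]

theorem aeval_X_monomial (m : Fin n →₀ ℕ) :
    MvPolynomial.aeval (X : Fin n → AbsSeries n) (MvPolynomial.monomial m (1 : ℂ)) = mono m := by
  rw [MvPolynomial.aeval_monomial, map_one, one_mul, prod_X_pow]

variable {w : Fin n → ℕ}

theorem mul_sub_mul_mem_filt {d e : ℕ} {a a' b b' : AbsSeries n} (ha : a ∈ filt w d)
    (hb' : b' ∈ filt w e) (haa : a - a' ∈ filt w (d + 1)) (hbb : b - b' ∈ filt w (e + 1)) :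
    a * b - a' * b' ∈ filt w (d + e + 1) := by
  have h : a * b - a' * b' = a * (b - b') + (a - a') * b' := by ring
  rw [h]
  have h1 := mul_mem_filt ha hbb
  refine add_mem h1 ?_
  have := mul_mem_filt haa hb'
  rwa [show d + 1 + e = d + e + 1 by ring] at this

theorem pow_sub_pow_mem_filt {d : ℕ} {a a' : AbsSeries n} (ha : a ∈ filt w d)
    (ha' : a' ∈ filt w d) (haa : a - a' ∈ filt w (d + 1)) (k : ℕ) :
    a ^ k - a' ^ k ∈ filt w (k * d + 1) := by
  induction k with
  | zero => simp
  | succ k ih =>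
    rw [pow_succ, pow_succ, Nat.succ_mul]
    exact mul_sub_mul_mem_filt (pow_mem_filt ha k) ha' ih haa

theorem prod_pow_sub_prod_pow_mem_filt {u v : Fin n → AbsSeries n} (hu : ∀ i, u i ∈ filt w (w i))
    (hv : ∀ i, v i ∈ filt w (w i)) (huv : ∀ i, u i - v i ∈ filt w (w i + 1)) (m : Fin n →₀ ℕ)
    (s : Finset (Fin n)) :
    ∏ i ∈ s, u i ^ m i ∈ filt w (∑ i ∈ s, m i * w i) ∧
    ∏ i ∈ s, u i ^ m i - ∏ i ∈ s, v i ^ m i ∈ filt w (∑ i ∈ s, m i * w i + 1) := by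
  induction s using Finset.induction_on with
  | empty => simpa using mem_filt_zero w (1 : AbsSeries n)
  | insert i s hi ih =>
    rw [Finset.prod_insert hi, Finset.prod_insert hi, Finset.sum_insert hi, mul_comm (u i ^ m i),
      mul_comm (v i ^ m i), add_comm (m i * w i)]
    exact ⟨mul_mem_filt ih.1 (pow_mem_filt (hu i) _), mul_sub_mul_mem_filt ih.1
      (pow_mem_filt (hv i) _) ih.2 (pow_sub_pow_mem_filt (hu i) (hv i) (huv i) _)⟩

theorem weight_eq_sum (m : Fin n →₀ ℕ) : Finsupp.weight w m = ∑ i, m i * w i := by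
  rw [Finsupp.weight_apply, Finsupp.sum_fintype _ _ (by simp)]
  simp

/-- In each monomial the factors are exchanged one at a time, and each exchange raises the weight by
at least one. So a coordinate change of positive weight preserves the principal part. -/
theorem aeval_sub_aeval_mem_filt {P : MvPolynomial (Fin n) ℂ} {d : ℕ}
    (hP : P.IsWeightedHomogeneous w d) {u v : Fin n → AbsSeries n} (hu : ∀ i, u i ∈ filt w (w i))
    (hv : ∀ i, v i ∈ filt w (w i)) (huv : ∀ i, u i - v i ∈ filt w (w i + 1)) :
    MvPolynomial.aeval u P - MvPolynomial.aeval v P ∈ filt w (d + 1) := by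
  rw [MvPolynomial.aeval_def, MvPolynomial.aeval_def, MvPolynomial.eval₂_eq', MvPolynomial.eval₂_eq',
    ← Finset.sum_sub_distrib]
  refine Submodule.sum_mem _ fun m hm => ?_
  rw [← mul_sub, ← Algebra.smul_def]
  refine Submodule.smul_mem _ _ ?_
  rw [← hP (MvPolynomial.mem_support_iff.1 hm), weight_eq_sum]
  exact (prod_pow_sub_prod_pow_mem_filt hu hv huv m Finset.univ).2

theorem aeval_monomial_mem_filt {u : Fin n → AbsSeries n} (hu : ∀ i, u i ∈ filt w (w i))
    (m : Fin n →₀ ℕ) :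
    MvPolynomial.aeval u (MvPolynomial.monomial m (1 : ℂ)) ∈ filt w (Finsupp.weight w m) := by
  rw [MvPolynomial.aeval_monomial, map_one, one_mul, Finsupp.prod_fintype _ _ (by simp),
    weight_eq_sum]
  exact (prod_pow_sub_prod_pow_mem_filt hu hu (fun i => by simp) m Finset.univ).1

theorem coeff_zero_eq_zero {d : ℕ} {a : AbsSeries n} (ha : a ∈ filt w (d + 1)) :
    AbsSeries.coeff 0 a = 0 :=
  ha 0 (by simp)

end Aeval

/-! ### Normal forms of semi-quasi-homogeneous germs -/

section NormalForm

variable {n : ℕ}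

theorem eval_scale_of_isWeightedHomogeneous {w : Fin n → ℕ} {d : ℕ} {P : MvPolynomial (Fin n) ℂ}
    (hP : P.IsWeightedHomogeneous w d) (t : ℂ) (z : Fin n → ℂ) :
    MvPolynomial.eval (fun i => t ^ w i * z i) P = t ^ d * MvPolynomial.eval z P := by
  rw [MvPolynomial.eval_eq', MvPolynomial.eval_eq', Finset.mul_sum]
  refine Finset.sum_congr rfl fun m hm => ?_
  rw [← hP (MvPolynomial.mem_support_iff.1 hm), weight_eq_sum]
  simp only [mul_pow, Finset.prod_mul_distrib, ← pow_mul, Finset.prod_pow_eq_pow_sum, mul_comm (w _)]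
  ring

/-- The coefficients `cf j` vanish at the base point, so to first order the moduli multiply the
unshifted monomials. -/
theorem hasStrictFDerivAt_aeval_add_sum {E : Type*} [NormedAddCommGroup E] [NormedSpace ℂ E]
    (P : MvPolynomial (Fin n) ℂ) {k : ℕ} (e : Fin k → Fin n →₀ ℕ)
    (inc : E →L[ℂ] (Fin n → AbsSeries n)) (cf : Fin k → E →L[ℂ] ℂ) :
    ∃ L : E →L[ℂ] AbsSeries n, HasStrictFDerivAt (fun u =>
      MvPolynomial.aeval (AbsSeries.X + inc u) P + ∑ j, cf j u •
        MvPolynomial.aeval (AbsSeries.X + inc u) (MvPolynomial.monomial (e j) (1 : ℂ))) L 0 ∧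
      ∀ u, L u = ∑ i, inc u i * MvPolynomial.aeval AbsSeries.X (MvPolynomial.pderiv i P) +
        ∑ j, cf j u • AbsSeries.mono (e j) := by
  have hV : HasStrictFDerivAt (fun u => AbsSeries.X + inc u) inc 0 :=
    inc.hasStrictFDerivAt.const_add _
  obtain ⟨L₀, hL₀, hL₀'⟩ := hasStrictFDerivAt_aeval P (AbsSeries.X + inc 0)
  have hmono : ∀ j, ∃ L : E →L[ℂ] AbsSeries n, HasStrictFDerivAt (fun u => cf j u •
      MvPolynomial.aeval (AbsSeries.X + inc u) (MvPolynomial.monomial (e j) (1 : ℂ))) L 0 ∧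
      ∀ u, L u = cf j u • AbsSeries.mono (e j) := by
    intro j
    obtain ⟨M, hM, -⟩ := hasStrictFDerivAt_aeval (MvPolynomial.monomial (e j) (1 : ℂ))
      (AbsSeries.X + inc 0)
    have h : HasStrictFDerivAt (fun u => MvPolynomial.aeval (AbsSeries.X + inc u)
      (MvPolynomial.monomial (e j) (1 : ℂ))) (M.comp inc) 0 := hM.comp 0 hV
    refine ⟨_, (cf j).hasStrictFDerivAt.smul h, fun u => ?_⟩
    simp [aeval_X_monomial]
  choose M hM hM' using hmono
  have h : HasStrictFDerivAt (fun u => MvPolynomial.aeval (AbsSeries.X + inc u) P)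
    (L₀.comp inc) 0 := hL₀.comp 0 hV
  refine ⟨_, h.add (HasStrictFDerivAt.fun_sum fun j (_ : j ∈ Finset.univ) => hM j),
    fun u => ?_⟩
  simp only [_root_.add_apply, ContinuousLinearMap.comp_apply, hL₀', map_zero, add_zero,
    _root_.sum_apply, hM']

/-- The unknowns in the reduction to normal form: a coordinate change of positive weight and the
coefficients of finitely many monomials. -/
abbrev ShiftSpace (w : Fin n → ℕ) (k : ℕ) : Type :=
  (∀ i : Fin n, filt w (w i + 1)) × (Fin k → ℂ)

/-- If the germ `g` has quasi-homogeneous principal part `P` and every series of higher weight is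
a combination of the partial derivatives of `P`, with coefficients of sufficient weight, and
of the monomials `e j`, then `g` is right equivalent to `P` plus a combination of the `e j`. -/
theorem exists_rightEquivalent_add_sum {w : Fin n → ℕ} (hw : ∀ i, 0 < w i) {d : ℕ}
    {P : MvPolynomial (Fin n) ℂ} (hP : P.IsWeightedHomogeneous w d) {k : ℕ}
    (e : Fin k → Fin n →₀ ℕ) (he : ∀ j, d + 1 ≤ Finsupp.weight w (e j))
    (hsurj : ∀ h ∈ filt w (d + 1), ∃ ξ : Fin n → AbsSeries n, (∀ i, ξ i ∈ filt w (w i + 1)) ∧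
      ∃ c : Fin k → ℂ, ∑ i, ξ i * MvPolynomial.aeval AbsSeries.X (MvPolynomial.pderiv i P) +
        ∑ j, c j • AbsSeries.mono (e j) = h)
    {g : (Fin n → ℂ) → ℂ} (hg : WeightGE w (d + 1) (fun z => g z - MvPolynomial.eval z P)) :
    ∃ c : Fin k → ℂ, RightEquivalent g
      (fun z => MvPolynomial.eval z P + ∑ j, c j * (e j).prod fun i m => z i ^ m) := by
  let inc : ShiftSpace w k →L[ℂ] (Fin n → AbsSeries n) :=
    ContinuousLinearMap.pi fun i =>
    (filt w (w i + 1)).subtypeL.comp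
      ((ContinuousLinearMap.proj i).comp (ContinuousLinearMap.fst ℂ _ _))
  let cf : Fin k → ShiftSpace w k →L[ℂ] ℂ := fun j =>
    (ContinuousLinearMap.proj j).comp (ContinuousLinearMap.snd ℂ _ _)
  obtain ⟨L, hL, hL'⟩ := hasStrictFDerivAt_aeval_add_sum (E := ShiftSpace w k) P e inc cf
  have hcf : ∀ u : ShiftSpace w k, ∀ j, cf j u = u.2 j := fun _ _ => rfl
  have hinc : ∀ u : ShiftSpace w k, ∀ i, inc u i = (u.1 i : AbsSeries n) := fun _ _ => rfl
  have hVw : ∀ (u : ShiftSpace w k) i, (AbsSeries.X + inc u : Fin n → AbsSeries n) i ∈ filt w (w i) := fun u i =>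
    add_mem (X_mem_filt w i) (filt_anti (Nat.le_succ _) (u.1 i).2)
  have hew : ∀ u j, MvPolynomial.aeval (AbsSeries.X + inc u)
      (MvPolynomial.monomial (e j) (1 : ℂ)) ∈ filt w (d + 1) := fun u j =>
    filt_anti (he j) (aeval_monomial_mem_filt (hVw u) _)
  -- The map sends a shift and moduli to `P` plus the monomials, all taken at the shifted
  -- coordinates. Its increments have weight above `d`, and `hsurj` is the surjectivity of its
  -- derivative at zero.
  obtain ⟨δ, hδ, H⟩ := exists_eq_add_of_hasStrictFDerivAt (isClosed_supp _) hL
    (H := filt w (d + 1)) (fun u => by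
      rw [add_sub_add_comm]
      refine add_mem (aeval_sub_aeval_mem_filt hP (hVw u) (hVw 0) fun i => ?_)
        (sub_mem (Submodule.sum_mem _ fun j _ => Submodule.smul_mem _ _ (hew u j))
          (Submodule.sum_mem _ fun j _ => Submodule.smul_mem _ _ (hew 0 j)))
      simp [hinc]) (fun h hh => by
      obtain ⟨ξ, hξ, c, hc⟩ := hsurj h hh
      exact ⟨(fun i => ⟨ξ i, hξ i⟩, c), (hL' _).trans hc⟩) (ε := 1 / 2) (by norm_num)
  obtain ⟨C, t₀, ht₀, hC⟩ := hg.exists_wscale hw (d := d + 1) fun m hm => hm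
  -- After rescaling, the remainder has norm at most `C * t ^ (d + 1)`; dividing by `t ^ d` leaves
  -- `C * t`, which must be below `δ`.
  obtain ⟨t, ht, htt₀, hCt⟩ : ∃ t : ℝ, 0 < t ∧ t ≤ t₀ ∧ C * t < δ := by
    refine ⟨min t₀ (δ / (|C| + 1) / 2), by positivity, min_le_left _ _, ?_⟩
    have h1 : min t₀ (δ / (|C| + 1) / 2) ≤ δ / (|C| + 1) / 2 := min_le_right _ _
    have h2 : (|C| + 1) * min t₀ (δ / (|C| + 1) / 2) ≤ δ / 2 := by
      calc _ ≤ (|C| + 1) * (δ / (|C| + 1) / 2) := by gcongr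
        _ = δ / 2 := by field_simp
    have h3 : 0 < min t₀ (δ / (|C| + 1) / 2) := by positivity
    nlinarith [le_abs_self C]
  obtain ⟨a, ha, han, haz⟩ := hC t ht htt₀
  have ht0 : (t : ℂ) ≠ 0 := by exact_mod_cast ht.ne'
  obtain ⟨u, hu, hΦu⟩ := H (((t : ℂ) ^ d)⁻¹ • a) (Submodule.smul_mem _ _ ha) (by
    rw [norm_smul, norm_inv, norm_pow, Complex.norm_real, Real.norm_of_nonneg ht.le]
    refine lt_of_le_of_lt ?_ hCt
    rw [inv_mul_le_iff₀ (by positivity)]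
    refine han.trans_eq (by ring))
  -- The moduli found for the rescaled germ, scaled back.
  let c : Fin k → ℂ := fun j => u.2 j * (t : ℂ) ^ d / (t : ℂ) ^ Finsupp.weight w (e j)
  refine ⟨c, ?_⟩
  let G : (Fin n → ℂ) → ℂ := fun z =>
    MvPolynomial.eval z P + ∑ j, c j * (e j).prod fun i m => z i ^ m
  change RightEquivalent g G
  have hts : ∀ i, (t : ℂ) ^ w i ≠ 0 := fun i => pow_ne_zero _ ht0
  have h1 : RightEquivalent g (fun z => g fun i => (t : ℂ) ^ w i * z i) :=
    .of_scale _ hts (Eventually.of_forall fun _ => rfl)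
  have h2 : RightEquivalent G (fun z => G fun i => (t : ℂ) ^ w i * z i) :=
    .of_scale _ hts (Eventually.of_forall fun _ => rfl)
  -- Both germs are compared after the same weighted rescaling, where the coordinate change is the
  -- small shift `u.1`.
  refine h1.trans (RightEquivalent.symm (h2.trans ?_))
  have hnorm : ∀ i, ‖(u.1 i : AbsSeries n)‖ ≤ 1 / 2 := fun i =>
    ((norm_le_pi_norm u.1 i).trans (norm_fst_le u)).trans hu.le
  refine .of_series (fun i => (u.1 i : AbsSeries n)) (fun i => coeff_zero_eq_zero (u.1 i).2) hnorm ?_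
  filter_upwards [Metric.closedBall_mem_nhds (0 : Fin n → ℂ) one_pos] with z hz
  have hz : ‖z‖ ≤ 1 := by simpa using hz
  have hVz : ∀ u : ShiftSpace w k, (fun i => AbsSeries.eval z ((AbsSeries.X + inc u : Fin n → AbsSeries n) i)) =
      fun i => z i + AbsSeries.eval z (u.1 i : AbsSeries n) := by
    intro u
    funext i
    change AbsSeries.eval z (AbsSeries.X i + (u.1 i : AbsSeries n)) = _
    rw [← evalHom_apply z hz, map_add, evalHom_apply, evalHom_apply, eval_X]
  have h0z : (fun i => z i + AbsSeries.eval z (((0 : ShiftSpace w k).1 i : AbsSeries n))) = z := by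
    funext i
    change z i + AbsSeries.eval z 0 = _
    rw [← evalHom_apply z hz, map_zero, add_zero]
  have hgz := haz z hz
  have key := congrArg (evalHom z hz) hΦu
  simp only [map_add, map_sum, map_smul, evalHom_apply, hcf,
    eval_aeval hz, hVz, h0z, smul_eq_mul, MvPolynomial.eval_monomial, one_mul] at key
  rw [eval_scale_of_isWeightedHomogeneous hP] at hgz
  have h0 : ∀ j, (0 : ShiftSpace w k).2 j = 0 := fun _ => rfl
  simp only [h0, zero_mul, Finset.sum_const_zero, add_zero] at key
  simp only [G]
  rw [eval_scale_of_isWeightedHomogeneous hP]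
  have hsum : ∀ y : Fin n → ℂ, ∑ j, c j * (e j).prod (fun i m => ((t : ℂ) ^ w i * y i) ^ m) =
      (t : ℂ) ^ d * ∑ j, u.2 j * (e j).prod fun i m => y i ^ m := by
    intro y
    rw [Finset.mul_sum]
    refine Finset.sum_congr rfl fun j _ => ?_
    have := eval_scale_of_isWeightedHomogeneous
      (MvPolynomial.isWeightedHomogeneous_monomial w (e j) (1 : ℂ) rfl) t y
    simp only [MvPolynomial.eval_monomial, one_mul] at this
    rw [this]
    have := pow_ne_zero (Finsupp.weight w (e j)) ht0
    simp only [c]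
    field_simp
  rw [hsum, ← mul_add, key, mul_add, mul_inv_cancel_left₀ (pow_ne_zero _ ht0), ← hgz]
  ring

end NormalForm

/-! ### Series in two variables -/

section TwoVariables

variable {w : Fin 2 → ℕ}

theorem weight_two (m : Fin 2 →₀ ℕ) : Finsupp.weight w m = m 0 * w 0 + m 1 * w 1 := by
  rw [weight_eq_sum, Fin.sum_univ_two]

/-- The series in the second variable whose monomials have weight at least `d`. -/
abbrev filtY (w : Fin 2 → ℕ) (d : ℕ) : Submodule ℂ (AbsSeries 2) :=
  supp ({m | m 0 = 0} ∩ {m | d ≤ Finsupp.weight w m})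

theorem filtY_le (w : Fin 2 → ℕ) (d : ℕ) : filtY w d ≤ filt w d := supp_mono Set.inter_subset_right

theorem filtY_anti {d e : ℕ} (h : d ≤ e) : filtY w e ≤ filtY w d :=
  supp_mono (Set.inter_subset_inter_right _ fun _ hm => le_trans h hm)

theorem mono_single_one (i : Fin 2) (k : ℕ) :
    AbsSeries.mono (Finsupp.single i k) = AbsSeries.X i ^ k := by
  rw [← prod_X_pow, Finsupp.prod_single_index (h := fun i k => AbsSeries.X (n := 2) i ^ k)
    (pow_zero _)]

theorem mul_mem_filtY {d e : ℕ} {a b : AbsSeries 2} (ha : a ∈ filtY w d) (hb : b ∈ filtY w e) :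
    a * b ∈ filtY w (d + e) := by
  refine mul_mem_supp ?_ ha hb
  intro m hm k hk
  refine ⟨?_, ?_⟩
  · have h1 : m 0 = 0 := hm.1
    have h2 : k 0 = 0 := hk.1
    simp [h1, h2]
  · rw [Set.mem_ofPred_eq, map_add]
    exact add_le_add hm.2 hk.2

theorem pow_mem_filtY (w : Fin 2 → ℕ) (k : ℕ) : AbsSeries.X 1 ^ k ∈ filtY w (k * w 1) := by
  rw [← mono_single_one]
  refine mono_mem_supp ⟨by simp, ?_⟩
  simp [weight_two]

/-- Division by the first variable. -/
theorem exists_eq_add_X_mul {d : ℕ} {h : AbsSeries 2} (hh : h ∈ filt w d) :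
    ∃ h₀ ∈ filtY w d, ∃ q ∈ filt w (d - w 0), h = h₀ + AbsSeries.X 0 * q := by
  obtain ⟨h₀, hh₀, h₁, hh₁, rfl⟩ := exists_add_eq {m | m 0 = 0} hh
  obtain ⟨q, hq, rfl⟩ := exists_eq_mono_mul (m := Finsupp.single 0 1) hh₁ fun k hk => by
    have : k 0 ≠ 0 := hk.1
    rw [Finsupp.single_le_iff]
    omega
  refine ⟨h₀, hh₀, q, supp_mono ?_ hq, rfl⟩
  rintro k ⟨-, hk⟩
  simp only [Set.mem_ofPred_eq, map_add, Finsupp.weight_single, one_smul] at hk ⊢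
  omega

/-- Division by a power of the second variable. -/
theorem exists_eq_pow_mul {d : ℕ} {h : AbsSeries 2} (hh : h ∈ filtY w d) {N : ℕ}
    (hN : ∀ k, d ≤ k * w 1 → N ≤ k) :
    ∃ b ∈ filtY w (d - N * w 1), h = AbsSeries.X 1 ^ N * b := by
  obtain ⟨q, hq, rfl⟩ := exists_eq_mono_mul (m := Finsupp.single 1 N) hh fun k hk => by
    have h0 : k 0 = 0 := hk.1
    have h1 : d ≤ Finsupp.weight w k := hk.2
    rw [weight_two, h0, zero_mul, zero_add] at h1
    rw [Finsupp.single_le_iff]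
    exact hN _ h1
  refine ⟨q, supp_mono ?_ hq, by rw [mono_single_one]⟩
  rintro k ⟨hk0, hk⟩
  refine ⟨by simpa using hk0, ?_⟩
  simp only [Set.mem_ofPred_eq, map_add, Finsupp.weight_single, smul_eq_mul] at hk ⊢
  omega

/-- Division with remainder by a power of the second variable. -/
theorem exists_eq_sum_add_pow_mul {d : ℕ} {h : AbsSeries 2} (hh : h ∈ filtY w d) (k : ℕ) :
    ∃ c : Fin k → ℂ, ∃ b ∈ filtY w (d - k * w 1),
      h = ∑ j : Fin k, c j • AbsSeries.X 1 ^ (j : ℕ) + AbsSeries.X 1 ^ k * b := by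
  induction k with
  | zero => exact ⟨Fin.elim0, h, by simpa using hh, by simp⟩
  | succ k ih =>
    obtain ⟨c, b, hb, rfl⟩ := ih
    obtain ⟨b₀, hb₀, b₁, hb₁, rfl⟩ := exists_add_eq {0} hb
    obtain ⟨q, hq, rfl⟩ := exists_eq_mono_mul (m := Finsupp.single 1 1) hb₁ fun k hk => by
      have h0 : k 0 = 0 := hk.2.1
      have h1 : k ≠ 0 := hk.1
      rw [Finsupp.single_le_iff]
      by_contra h2
      refine h1 (Finsupp.ext fun i => ?_)
      fin_cases i
      · exact h0
      · simpa using h2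
    have hb0 : b₀ = coeff 0 b₀ • 1 := by
      ext m
      by_cases hm : m = 0
      · simp [hm, coeff_one]
      · rw [hb₀ m fun h => hm h.1]
        simp [coeff_one, hm]
    refine ⟨Fin.snoc c (coeff 0 b₀), q, supp_mono ?_ hq, ?_⟩
    · rintro l ⟨-, hl0, hl⟩
      refine ⟨by simpa using hl0, ?_⟩
      simp only [Set.mem_ofPred_eq, map_add, Finsupp.weight_single, one_smul] at hl ⊢
      rw [Nat.succ_mul]
      omega
    · rw [Fin.sum_univ_castSucc]
      simp only [Fin.snoc_castSucc, Fin.snoc_last, Fin.val_castSucc, Fin.val_last]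
      have h1 : AbsSeries.X 1 ^ k * b₀ = coeff 0 b₀ • AbsSeries.X 1 ^ k := by
        conv_lhs => rw [hb0]
        rw [mul_smul_comm, mul_one]
      rw [mono_single_one, mul_add, h1]
      ring

theorem exists_polynomial_eval_eq {k : ℕ} (c : Fin k → ℂ) :
    ∃ a ∈ Polynomial.degreeLT ℂ k, (∀ j : Fin k, a.coeff j = c j) ∧
      ∀ y, a.eval y = ∑ j, c j * y ^ (j : ℕ) := by
  refine ⟨((Polynomial.degreeLTEquiv ℂ k).symm c : Polynomial.degreeLT ℂ k), Subtype.property _,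
    fun j => ?_, fun y => ?_⟩
  · exact congrFun ((Polynomial.degreeLTEquiv ℂ k).apply_symm_apply c) j
  · rw [Polynomial.eval_eq_sum_degreeLTEquiv (Subtype.property _)]
    simp

/-- The form of a quasi-homogeneous normal form theorem used in two variables: the moduli are the
coefficients of `x ^ i * y ^ j₀ * a(y)`. -/
theorem exists_rightEquivalent_two {w : Fin 2 → ℕ} (hw : ∀ i, 0 < w i) {d : ℕ}
    {P : MvPolynomial (Fin 2) ℂ} (hP : P.IsWeightedHomogeneous w d) (i j₀ k : ℕ)
    (he : d + 1 ≤ i * w 0 + j₀ * w 1)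
    (hsurj : ∀ h ∈ filt w (d + 1), ∃ ξ ∈ filt w (w 0 + 1), ∃ η ∈ filt w (w 1 + 1),
      ∃ c : Fin k → ℂ, ξ * MvPolynomial.aeval AbsSeries.X (MvPolynomial.pderiv 0 P) +
        η * MvPolynomial.aeval AbsSeries.X (MvPolynomial.pderiv 1 P) +
        ∑ j, c j • (AbsSeries.X 0 ^ i * AbsSeries.X 1 ^ (j₀ + j)) = h)
    {g : (Fin 2 → ℂ) → ℂ} (hg : WeightGE w (d + 1) (fun z => g z - MvPolynomial.eval z P)) :
    ∃ a ∈ Polynomial.degreeLT ℂ k, RightEquivalent g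
      (fun z => MvPolynomial.eval z P + z 0 ^ i * z 1 ^ j₀ * a.eval (z 1)) := by
  let e : Fin k → Fin 2 →₀ ℕ := fun j => Finsupp.single 0 i + Finsupp.single 1 (j₀ + j)
  have hm : ∀ j, AbsSeries.mono (e j) = AbsSeries.X 0 ^ i * AbsSeries.X 1 ^ (j₀ + (j : ℕ)) := by
    intro j
    rw [mono_add, mono_single_one, mono_single_one]
  obtain ⟨c, hc⟩ := exists_rightEquivalent_add_sum hw hP e (fun j => by
      simp only [e, map_add, Finsupp.weight_single, smul_eq_mul, add_mul]
      omega)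
    (fun h hh => by
      obtain ⟨ξ, hξ, η, hη, c, hc⟩ := hsurj h hh
      refine ⟨![ξ, η], ?_, c, ?_⟩
      · intro i
        fin_cases i
        · exact hξ
        · exact hη
      · simp only [hm, Fin.sum_univ_two]
        exact hc) hg
  obtain ⟨a, ha, -, ha'⟩ := exists_polynomial_eval_eq c
  refine ⟨a, ha, hc.trans (.of_eventuallyEq (Eventually.of_forall fun z => ?_))⟩
  simp only [ha', Finset.mul_sum]
  congr 1
  refine Finset.sum_congr rfl fun j _ => ?_
  rw [Finsupp.prod_add_index' (by simp) (by simp [pow_add]), Finsupp.prod_single_index (by simp),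
    Finsupp.prod_single_index (by simp), pow_add]
  ring

end TwoVariables

/-! ### Normal forms of types `E_{6r}`, `E_{6r+1}` and `E_{6r+2}` -/

section NormalForms

theorem algebraMap_mul_mem_filt {n : ℕ} {w : Fin n → ℕ} {d : ℕ} (c : ℂ) {a : AbsSeries n}
    (ha : a ∈ filt w d) : algebraMap ℂ (AbsSeries n) c * a ∈ filt w d := by
  rw [← Algebra.smul_def]
  exact Submodule.smul_mem _ c ha

theorem algebraMap_mul_mem_filtY {w : Fin 2 → ℕ} {d : ℕ} (c : ℂ) {a : AbsSeries 2}
    (ha : a ∈ filtY w d) : algebraMap ℂ (AbsSeries 2) c * a ∈ filtY w d := by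
  rw [← Algebra.smul_def]
  exact Submodule.smul_mem _ c ha

theorem algebraMap_inv_natCast_mul {n N : ℕ} (hN : N ≠ 0) :
    algebraMap ℂ (AbsSeries n) (N : ℂ)⁻¹ * (N : AbsSeries n) = 1 := by
  have : (N : ℂ) ≠ 0 := by exact_mod_cast hN
  rw [← map_natCast (algebraMap ℂ (AbsSeries n)) N, ← map_mul, inv_mul_cancel₀ this, map_one]

theorem algebraMap_inv_ofNat_mul {n N : ℕ} [N.AtLeastTwo] :
    algebraMap ℂ (AbsSeries n) (OfNat.ofNat N : ℂ)⁻¹ * (OfNat.ofNat N : AbsSeries n) = 1 := by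
  rw [← map_ofNat (algebraMap ℂ (AbsSeries n)) N, ← map_mul, inv_mul_cancel₀ (by simp), map_one]

theorem sum_smul_mul_pow {k : ℕ} (c : Fin k → ℂ) (i j₀ : ℕ) :
    ∑ j : Fin k, c j • (AbsSeries.X 0 ^ i * AbsSeries.X 1 ^ (j₀ + (j : ℕ)) : AbsSeries 2) =
      AbsSeries.X 0 ^ i * AbsSeries.X 1 ^ j₀ * ∑ j : Fin k, c j • AbsSeries.X 1 ^ (j : ℕ) := by
  simp only [Finset.mul_sum, pow_add, mul_smul_comm, mul_assoc]

/-- `N = 3r + 1` gives `E_{6r}` and `N = 3r + 2` gives `E_{6r+2}`. Modulo `x²` and `y^(N-1)`, the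
monomials of weight above `3N` are the `x y^j` with `3j > 2N` and `j ≤ N - 2`. By `h1` and `h2` the
first such exponent is `j₀`, and there are `k` of them. -/
theorem exists_rightEquivalent_cube_add_pow {N j₀ k : ℕ} (hN : N = j₀ + k + 1)
    (h1 : 2 * N + 1 ≤ 3 * j₀) (h2 : 3 * j₀ ≤ 2 * N + 3) (hN4 : 4 ≤ N) {g : (Fin 2 → ℂ) → ℂ}
    (hg : WeightGE ![N, 3] (3 * N + 1) (fun z => g z - (z 0 ^ 3 + z 1 ^ N))) :
    ∃ a ∈ Polynomial.degreeLT ℂ k, RightEquivalent g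
      (fun z => z 0 ^ 3 + z 1 ^ N + a.eval (z 1) * z 0 * z 1 ^ j₀) := by
  generalize hw : ![N, 3] = w at hg
  have hw0 : w 0 = N := by rw [← hw]; rfl
  have hw1 : w 1 = 3 := by rw [← hw]; rfl
  let P : MvPolynomial (Fin 2) ℂ := MvPolynomial.X 0 ^ 3 + MvPolynomial.X 1 ^ N
  have hP : P.IsWeightedHomogeneous w (3 * N) := by
    refine .add ?_ ?_
    · simpa [hw0] using (MvPolynomial.isWeightedHomogeneous_X ℂ w 0).pow 3
    · simpa [hw1, mul_comm] using (MvPolynomial.isWeightedHomogeneous_X ℂ w 1).pow N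
  have hs : ∀ h ∈ filt w (3 * N + 1), ∃ ξ ∈ filt w (w 0 + 1), ∃ η ∈ filt w (w 1 + 1),
      ∃ c : Fin k → ℂ, ξ * MvPolynomial.aeval AbsSeries.X (MvPolynomial.pderiv 0 P) +
        η * MvPolynomial.aeval AbsSeries.X (MvPolynomial.pderiv 1 P) +
        ∑ j, c j • (AbsSeries.X 0 ^ 1 * AbsSeries.X 1 ^ (j₀ + j)) = h := by
    intro h hh
    obtain ⟨h₀, hh₀, h', hh', rfl⟩ := exists_eq_add_X_mul hh
    obtain ⟨h₁, hh₁, q, hq, rfl⟩ := exists_eq_add_X_mul hh'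
    obtain ⟨b, hb, rfl⟩ := exists_eq_pow_mul hh₀ (N := N - 1) (by rw [hw1]; omega)
    obtain ⟨b', hb', rfl⟩ := exists_eq_pow_mul hh₁ (N := j₀) (by rw [hw1, hw0]; omega)
    obtain ⟨c, b'', hb'', rfl⟩ := exists_eq_sum_add_pow_mul hb' k
    rw [hw0] at hq
    rw [hw1] at hb
    refine ⟨algebraMap ℂ _ (3 : ℂ)⁻¹ * q, algebraMap_mul_mem_filt _ (filt_anti ?_ hq),
      algebraMap ℂ _ (N : ℂ)⁻¹ * (b + AbsSeries.X 0 * b''), algebraMap_mul_mem_filt _ (add_mem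
        (filt_anti ?_ (filtY_le _ _ hb)) (filt_anti ?_ (mul_mem_filt (X_mem_filt w 0)
          (mem_filt_zero w b'')))), c, ?_⟩
    · rw [hw0]; omega
    · rw [hw1]; omega
    · rw [hw1, hw0]; omega
    · have e0 : MvPolynomial.aeval AbsSeries.X (MvPolynomial.pderiv 0 P) =
          3 * (AbsSeries.X 0 : AbsSeries 2) ^ 2 := by
        simp [P, MvPolynomial.pderiv_X, mul_comm]
      have e1 : MvPolynomial.aeval AbsSeries.X (MvPolynomial.pderiv 1 P) =
          (N : AbsSeries 2) * AbsSeries.X 1 ^ (N - 1) := by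
        simp [P, MvPolynomial.pderiv_X]
      have e3 : N - 1 = j₀ + k := by omega
      rw [e0, e1, sum_smul_mul_pow, e3, pow_add]
      linear_combination (AbsSeries.X 0 ^ 2 * q) * algebraMap_inv_ofNat_mul (n := 2) (N := 3) +
        ((b + AbsSeries.X 0 * b'') * AbsSeries.X 1 ^ j₀ * AbsSeries.X 1 ^ k) *
          algebraMap_inv_natCast_mul (n := 2) (N := N) (by omega)
  obtain ⟨a, ha, hga⟩ := exists_rightEquivalent_two (w := w) (by
      intro i
      fin_cases i
      · change 0 < w 0
        omega
      · change 0 < w 1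
        omega) hP 1 j₀ k (by rw [hw0, hw1]; omega) hs (g := g) (by simpa [P] using hg)
  refine ⟨a, ha, hga.trans (.of_eventuallyEq (Eventually.of_forall fun z => ?_))⟩
  simp [P]
  ring

/-- This is `E_{6r+1}`. The partial derivatives are, up to units, `3x² + y^(2r+1)` and `x y^(2r)`;
the ideal contains `y^(4r+1)`, so above the principal weight only `y^(3r+2), …, y^(4r)` remain. -/
theorem exists_rightEquivalent_cube_add_mul_pow {r : ℕ} (hr : 1 ≤ r) {g : (Fin 2 → ℂ) → ℂ}
    (hg : WeightGE ![2 * r + 1, 2] (6 * r + 3 + 1)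
      (fun z => g z - (z 0 ^ 3 + z 0 * z 1 ^ (2 * r + 1)))) :
    ∃ a ∈ Polynomial.degreeLT ℂ (r - 1), RightEquivalent g
      (fun z => z 0 ^ 3 + z 0 * z 1 ^ (2 * r + 1) + a.eval (z 1) * z 1 ^ (3 * r + 2)) := by
  generalize hw : ![2 * r + 1, 2] = w at hg
  have hw0 : w 0 = 2 * r + 1 := by rw [← hw]; rfl
  have hw1 : w 1 = 2 := by rw [← hw]; rfl
  let P : MvPolynomial (Fin 2) ℂ :=
    MvPolynomial.X 0 ^ 3 + MvPolynomial.X 0 * MvPolynomial.X 1 ^ (2 * r + 1)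
  have hP : P.IsWeightedHomogeneous w (6 * r + 3) := by
    refine .add ?_ ?_
    · convert (MvPolynomial.isWeightedHomogeneous_X ℂ w 0).pow 3 using 1
      simp [hw0]
      ring
    · convert (MvPolynomial.isWeightedHomogeneous_X ℂ w 0).mul
        ((MvPolynomial.isWeightedHomogeneous_X ℂ w 1).pow (2 * r + 1)) using 1
      simp [hw0, hw1]
      ring
  have hs : ∀ h ∈ filt w (6 * r + 3 + 1), ∃ ξ ∈ filt w (w 0 + 1), ∃ η ∈ filt w (w 1 + 1),
      ∃ c : Fin (r - 1) → ℂ, ξ * MvPolynomial.aeval AbsSeries.X (MvPolynomial.pderiv 0 P) +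
        η * MvPolynomial.aeval AbsSeries.X (MvPolynomial.pderiv 1 P) +
        ∑ j, c j • (AbsSeries.X 0 ^ 0 * AbsSeries.X 1 ^ (3 * r + 2 + j)) = h := by
    intro h hh
    obtain ⟨h₀, hh₀, h', hh', rfl⟩ := exists_eq_add_X_mul hh
    obtain ⟨h₁, hh₁, q, hq, rfl⟩ := exists_eq_add_X_mul hh'
    obtain ⟨q₀, hq₀, q₁, hq₁, rfl⟩ := exists_eq_add_X_mul hq
    obtain ⟨b₁, hb₁, rfl⟩ := exists_eq_pow_mul hh₁ (N := 2 * r) (by rw [hw1, hw0]; omega)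
    -- Replacing `x²` by `-y^(2r+1)/3` moves the part `q₀` of the coefficient of `x²` into the pure
    -- powers of `y`; the part `x q₁` is absorbed by the second derivative.
    have hH₀ : h₀ - algebraMap ℂ _ (3 : ℂ)⁻¹ * (AbsSeries.X 1 ^ (2 * r + 1) * q₀) ∈
        filtY w (6 * r + 3 + 1) :=
      sub_mem hh₀ (algebraMap_mul_mem_filtY _ (filtY_anti (by rw [hw0, hw1]; omega)
        (mul_mem_filtY (pow_mem_filtY w _) hq₀)))
    obtain ⟨b, hb, hb_eq⟩ := exists_eq_pow_mul hH₀ (N := 3 * r + 2) (by rw [hw1]; omega)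
    obtain ⟨c, b', hb', rfl⟩ := exists_eq_sum_add_pow_mul hb (r - 1)
    refine ⟨algebraMap ℂ _ (3 : ℂ)⁻¹ * (q₀ + AbsSeries.X 0 * q₁) + AbsSeries.X 1 ^ (2 * r) * b',
      add_mem (algebraMap_mul_mem_filt _ (filt_anti ?_ hq))
        (filt_anti ?_ (mul_mem_filt (pow_mem_filt (X_mem_filt w 1) _) (mem_filt_zero w b'))),
      algebraMap ℂ _ ((2 * r + 1 : ℕ) : ℂ)⁻¹ * (b₁ - algebraMap ℂ _ (3 : ℂ)⁻¹ *
        (AbsSeries.X 1 * q₁) - 3 * (AbsSeries.X 0 * b')),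
      algebraMap_mul_mem_filt _ (sub_mem (sub_mem (filt_anti ?_ (filtY_le _ _ hb₁))
        (algebraMap_mul_mem_filt _ (filt_anti ?_ (mul_mem_filt (X_mem_filt w 1) hq₁)))) ?_), c, ?_⟩
    · rw [hw0]; omega
    · rw [hw1, hw0]; omega
    · rw [hw1, hw0]; omega
    · rw [hw1, hw0]; omega
    · have : (3 : AbsSeries 2) * (AbsSeries.X 0 * b') ∈ filt w (0 + (w 0 + 0)) :=
        mul_mem_filt (mem_filt_zero w _) (mul_mem_filt (X_mem_filt w 0) (mem_filt_zero w b'))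
      exact filt_anti (by rw [hw0, hw1]; omega) this
    · have e0 : MvPolynomial.aeval AbsSeries.X (MvPolynomial.pderiv 0 P) =
          3 * (AbsSeries.X 0 : AbsSeries 2) ^ 2 + AbsSeries.X 1 ^ (2 * r + 1) := by
        simp [P, MvPolynomial.pderiv_X, mul_comm]
      have e1 : MvPolynomial.aeval AbsSeries.X (MvPolynomial.pderiv 1 P) =
          ((2 * r + 1 : ℕ) : AbsSeries 2) * (AbsSeries.X 0 * AbsSeries.X 1 ^ (2 * r)) := by
        simp [P, MvPolynomial.pderiv_X]
        ring
      -- This power is `y^(4r+1)`, obtained as `y^(2r)` times the first derivative minus `3x` times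
      -- `x y^(2r)`.
      have e3 : AbsSeries.X 1 ^ (3 * r + 2) * AbsSeries.X 1 ^ (r - 1) =
          (AbsSeries.X 1 ^ (2 * r + 1) * AbsSeries.X 1 ^ (2 * r) : AbsSeries 2) := by
        rw [← pow_add, ← pow_add]
        congr 1
        omega
      rw [e0, e1, sum_smul_mul_pow]
      have h3 := algebraMap_inv_ofNat_mul (n := 2) (N := 3)
      have hr := algebraMap_inv_natCast_mul (n := 2) (N := 2 * r + 1) (by omega)
      linear_combination (AbsSeries.X 0 ^ 2 * (q₀ + AbsSeries.X 0 * q₁)) * h3 - hb_eq - b' * e3 +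
        (b₁ - algebraMap ℂ _ (3 : ℂ)⁻¹ * (AbsSeries.X 1 * q₁) - 3 * (AbsSeries.X 0 * b')) *
          (AbsSeries.X 0 * AbsSeries.X 1 ^ (2 * r)) * hr
  obtain ⟨a, ha, hga⟩ := exists_rightEquivalent_two (w := w) (by
      intro i
      fin_cases i
      · change 0 < w 0
        omega
      · change 0 < w 1
        omega) hP 0 (3 * r + 2) (r - 1) (by rw [hw0, hw1]; omega) hs (g := g)
      (by simpa [P] using hg)
  refine ⟨a, ha, hga.trans (.of_eventuallyEq (Eventually.of_forall fun z => ?_))⟩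
  simp [P]
  ring

end NormalForms

/-! ### Normal forms of types `J_{r,0}` and `D_k` -/

section NormalForms

/-- The derivatives are `x(3x + 2βy^r)` and `r y^(r-1)(βx² + 3y^(2r))`. On the branch `3x = -2βy^r`
the last factor is `(4β³ + 27)y^(2r)/9`, whence the condition on `β`. Above the principal weight,
only `x y^(2r+1), …, x y^(3r-2)` remain modulo the derivatives. -/
theorem exists_rightEquivalent_J_zero {r : ℕ} (hr : 2 ≤ r) {β : ℂ} (hβ : 4 * β ^ 3 + 27 ≠ 0)
    {g : (Fin 2 → ℂ) → ℂ}
    (hg : WeightGE ![r, 1] (3 * r + 1)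
      (fun z => g z - (z 0 ^ 3 + β * z 0 ^ 2 * z 1 ^ r + z 1 ^ (3 * r)))) :
    ∃ c ∈ Polynomial.degreeLT ℂ (r - 2), RightEquivalent g
      (fun z => z 0 ^ 3 + β * z 0 ^ 2 * z 1 ^ r + z 1 ^ (3 * r) +
        c.eval (z 1) * z 0 * z 1 ^ (2 * r + 1)) := by
  generalize hw : ![r, 1] = w at hg
  have hw0 : w 0 = r := by rw [← hw]; rfl
  have hw1 : w 1 = 1 := by rw [← hw]; rfl
  let P : MvPolynomial (Fin 2) ℂ := MvPolynomial.X 0 ^ 3 +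
    MvPolynomial.C β * MvPolynomial.X 0 ^ 2 * MvPolynomial.X 1 ^ r + MvPolynomial.X 1 ^ (3 * r)
  have hP : P.IsWeightedHomogeneous w (3 * r) := by
    refine .add (.add ?_ ?_) ?_
    · simpa [hw0] using (MvPolynomial.isWeightedHomogeneous_X ℂ w 0).pow 3
    · convert ((MvPolynomial.isWeightedHomogeneous_C w β).mul
        ((MvPolynomial.isWeightedHomogeneous_X ℂ w 0).pow 2)).mul
        ((MvPolynomial.isWeightedHomogeneous_X ℂ w 1).pow r) using 1
      simp [hw0, hw1]
      ring
    · simpa [hw1] using (MvPolynomial.isWeightedHomogeneous_X ℂ w 1).pow (3 * r)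
  have hs : ∀ h ∈ filt w (3 * r + 1), ∃ ξ ∈ filt w (w 0 + 1), ∃ η ∈ filt w (w 1 + 1),
      ∃ c : Fin (r - 2) → ℂ, ξ * MvPolynomial.aeval AbsSeries.X (MvPolynomial.pderiv 0 P) +
        η * MvPolynomial.aeval AbsSeries.X (MvPolynomial.pderiv 1 P) +
        ∑ j, c j • (AbsSeries.X 0 ^ 1 * AbsSeries.X 1 ^ (2 * r + 1 + j)) = h := by
    intro h hh
    -- Solving for `M • h` instead of `h` keeps the witnesses free of denominators, so that the
    -- verification is a polynomial identity.
    let M : ℂ := 27 * r * (4 * β ^ 3 + 27)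
    have hM : M ≠ 0 := by
      have : (r : ℂ) ≠ 0 := by
        have : r ≠ 0 := by omega
        exact_mod_cast this
      exact mul_ne_zero (mul_ne_zero (by norm_num) this) hβ
    obtain ⟨h, rfl⟩ : ∃ h', h = M • h' := ⟨M⁻¹ • h, (smul_inv_smul₀ hM h).symm⟩
    rw [Submodule.smul_mem_iff _ hM] at hh
    let B : AbsSeries 2 := algebraMap ℂ _ β
    obtain ⟨h₀, hh₀, h', hh', rfl⟩ := exists_eq_add_X_mul hh
    obtain ⟨h₁, hh₁, q, hq, rfl⟩ := exists_eq_add_X_mul hh'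
    obtain ⟨q₀, hq₀, q₁, hq₁, hq_eq⟩ := exists_eq_add_X_mul hq
    obtain ⟨q₁₀, hq₁₀, q₁₁, hq₁₁, hq₁_eq⟩ := exists_eq_add_X_mul hq₁
    obtain ⟨b, hb, rfl⟩ := exists_eq_pow_mul hh₀ (N := 3 * r - 1) (by rw [hw1]; omega)
    -- Nine times the coefficient of `x` after the substitutions `x² = -(2β/3) x y^r` and `y^(3r-1)
    -- = -(β/3) x² y^(r-1)`, which hold modulo the derivatives. The term in `x⁴ q₁₁` is left for
    -- later.
    have hH : algebraMap ℂ _ (9 : ℂ) * h₁ - algebraMap ℂ _ (6 * β) * (AbsSeries.X 1 ^ r * q₀) +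
        algebraMap ℂ _ (4 * β ^ 2) * (AbsSeries.X 1 ^ (2 * r) * q₁₀) +
        algebraMap ℂ _ (2 * β ^ 2) * (AbsSeries.X 1 ^ (2 * r - 1) * b) ∈ filtY w (2 * r + 1) := by
      refine add_mem (add_mem (sub_mem ?_ ?_) ?_) ?_ <;> refine algebraMap_mul_mem_filtY _ ?_
      · exact filtY_anti (by rw [hw0]; omega) hh₁
      · exact filtY_anti (by rw [hw0, hw1]; omega) (mul_mem_filtY (pow_mem_filtY w _) hq₀)
      · exact filtY_anti (by rw [hw0, hw1]; omega) (mul_mem_filtY (pow_mem_filtY w _) hq₁₀)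
      · exact filtY_anti (by rw [hw1]; omega) (mul_mem_filtY (pow_mem_filtY w _) hb)
    obtain ⟨b₁, hb₁, hb₁_eq⟩ := exists_eq_pow_mul hH (N := 2 * r + 1) (by rw [hw1]; omega)
    obtain ⟨c, b', hb', rfl⟩ := exists_eq_sum_add_pow_mul hb₁ (r - 2)
    -- `W` collects what multiplies `x y^(3r-1)`, including the contribution of `x⁴ q₁₁`; since `4β³
    -- + 27 ≠ 0`, this monomial lies in the ideal of the derivatives.
    let W : AbsSeries 2 := 3 * b' - algebraMap ℂ _ (8 * β ^ 3) * (AbsSeries.X 1 * q₁₁)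
    refine ⟨algebraMap ℂ _ (r * (4 * β ^ 3 + 27)) * (algebraMap ℂ _ (9 : ℂ) * q -
        algebraMap ℂ _ (6 * β) * (AbsSeries.X 1 ^ r * q₁) +
        algebraMap ℂ _ (4 * β ^ 2) * (AbsSeries.X 1 ^ (2 * r) * q₁₁) -
        algebraMap ℂ _ (3 * β) * (AbsSeries.X 1 ^ (r - 1) * b)) -
        algebraMap ℂ _ (β * r) * ((algebraMap ℂ _ (3 : ℂ) * (AbsSeries.X 0 * AbsSeries.X 1 ^ (r - 1)) -
          algebraMap ℂ _ (2 * β) * AbsSeries.X 1 ^ (2 * r - 1)) * W), ?_,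
      algebraMap ℂ _ (9 * (4 * β ^ 3 + 27)) * b + algebraMap ℂ _ (9 : ℂ) * (AbsSeries.X 0 * W), ?_,
      (3 * r * (4 * β ^ 3 + 27)) • c, ?_⟩
    · refine sub_mem (algebraMap_mul_mem_filt _ (sub_mem (add_mem (sub_mem ?_ ?_) ?_) ?_))
        (algebraMap_mul_mem_filt _ ?_)
      · exact algebraMap_mul_mem_filt _ (filt_anti (by rw [hw0]; omega) hq)
      · exact algebraMap_mul_mem_filt _ (filt_anti (by rw [hw0, hw1]; omega)
          (mul_mem_filt (pow_mem_filt (X_mem_filt w 1) _) hq₁))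
      · exact algebraMap_mul_mem_filt _ (filt_anti (by rw [hw0, hw1]; omega)
          (mul_mem_filt (pow_mem_filt (X_mem_filt w 1) _) (mem_filt_zero w q₁₁)))
      · exact algebraMap_mul_mem_filt _ (filt_anti (by rw [hw0, hw1]; omega)
          (mul_mem_filt (pow_mem_filt (X_mem_filt w 1) _) (filtY_le _ _ hb)))
      · refine filt_anti (le_add_right le_rfl) (mul_mem_filt (sub_mem ?_ ?_) (mem_filt_zero w W))
        · exact algebraMap_mul_mem_filt _ (filt_anti (by rw [hw0, hw1]; omega)
            (mul_mem_filt (X_mem_filt w 0) (pow_mem_filt (X_mem_filt w 1) _)))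
        · exact algebraMap_mul_mem_filt _ (filt_anti (by rw [hw0, hw1]; omega)
            (pow_mem_filt (X_mem_filt w 1) _))
    · refine add_mem (algebraMap_mul_mem_filt _ ?_) (algebraMap_mul_mem_filt _ ?_)
      · exact filt_anti (by rw [hw1]; omega) (filtY_le _ _ hb)
      · exact filt_anti (by rw [hw0, hw1]; omega)
          (mul_mem_filt (X_mem_filt w 0) (mem_filt_zero w W))
    · have e0 : MvPolynomial.aeval AbsSeries.X (MvPolynomial.pderiv 0 P) =
          3 * (AbsSeries.X 0 : AbsSeries 2) ^ 2 + 2 * B * AbsSeries.X 0 * AbsSeries.X 1 ^ r := by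
        simp [P, B, MvPolynomial.pderiv_X]
        ring
      have e1 : MvPolynomial.aeval AbsSeries.X (MvPolynomial.pderiv 1 P) =
          (r : AbsSeries 2) * B * AbsSeries.X 0 ^ 2 * AbsSeries.X 1 ^ (r - 1) +
            3 * (r : AbsSeries 2) * AbsSeries.X 1 ^ (3 * r - 1) := by
        simp [P, B, MvPolynomial.pderiv_X]
        ring
      rw [e0, e1, sum_smul_mul_pow]
      simp only [Pi.smul_apply, smul_assoc, ← Finset.smul_sum]
      rw [Algebra.smul_def, Algebra.smul_def]
      simp only [M, W, map_mul, map_add, map_pow, map_ofNat, map_natCast] at hb₁_eq ⊢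
      subst hq₁_eq hq_eq
      change 9 * h₁ - 6 * B * (AbsSeries.X 1 ^ r * q₀) + 4 * B ^ 2 * (AbsSeries.X 1 ^ (2 * r) * q₁₀) +
        2 * B ^ 2 * (AbsSeries.X 1 ^ (2 * r - 1) * b) = _ at hb₁_eq
      have hB : algebraMap ℂ (AbsSeries 2) β = B := rfl
      simp only [hB]
      obtain ⟨s, rfl⟩ : ∃ s, r = s + 2 := ⟨r - 2, by omega⟩
      have e3 : (AbsSeries.X 1 : AbsSeries 2) ^ (s + 2 - 2) = AbsSeries.X 1 ^ s := by
        rw [Nat.add_sub_cancel]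
      rw [e3, show 2 * (s + 2) - 1 = 2 * s + 3 by omega] at hb₁_eq
      rw [show 2 * (s + 2) - 1 = 2 * s + 3 by omega]
      rw [show s + 2 - 1 = s + 1 by omega, show 3 * (s + 2) - 1 = 3 * s + 5 by omega]
      push_cast
      linear_combination (-3 * ((s : AbsSeries 2) + 2) * (4 * B ^ 3 + 27) * AbsSeries.X 0) * hb₁_eq
  obtain ⟨a, ha, hga⟩ := exists_rightEquivalent_two (w := w) (by
      intro i
      fin_cases i
      · change 0 < w 0
        omega
      · change 0 < w 1
        omega) hP 1 (2 * r + 1) (r - 2) (by rw [hw0, hw1]; omega) hs (g := g)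
      (by simpa [P] using hg)
  refine ⟨a, ha, hga.trans (.of_eventuallyEq (Eventually.of_forall fun z => ?_))⟩
  simp [P]
  ring

/-- Modulo `xy` and `x² + K y^(K-1)` nothing survives above weight `2K`, so there are no moduli and
the family of monomials is indexed by `Fin 0`. -/
theorem exists_rightEquivalent_D {K : ℕ} (hK : 3 ≤ K) {g : (Fin 2 → ℂ) → ℂ}
    (hg : WeightGE ![K - 1, 2] (2 * K + 1) (fun z => g z - (z 0 ^ 2 * z 1 + z 1 ^ K))) :
    RightEquivalent g (fun z => z 0 ^ 2 * z 1 + z 1 ^ K) := by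
  generalize hw : ![K - 1, 2] = w at hg
  have hw0 : w 0 = K - 1 := by rw [← hw]; rfl
  have hw1 : w 1 = 2 := by rw [← hw]; rfl
  let P : MvPolynomial (Fin 2) ℂ :=
    MvPolynomial.X 0 ^ 2 * MvPolynomial.X 1 + MvPolynomial.X 1 ^ K
  have hP : P.IsWeightedHomogeneous w (2 * K) := by
    refine .add ?_ ?_
    · convert ((MvPolynomial.isWeightedHomogeneous_X ℂ w 0).pow 2).mul
        (MvPolynomial.isWeightedHomogeneous_X ℂ w 1) using 1
      rw [hw0, hw1, smul_eq_mul]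
      omega
    · simpa [hw1, mul_comm] using (MvPolynomial.isWeightedHomogeneous_X ℂ w 1).pow K
  have hs : ∀ h ∈ filt w (2 * K + 1), ∃ ξ ∈ filt w (w 0 + 1), ∃ η ∈ filt w (w 1 + 1),
      ∃ c : Fin 0 → ℂ, ξ * MvPolynomial.aeval AbsSeries.X (MvPolynomial.pderiv 0 P) +
        η * MvPolynomial.aeval AbsSeries.X (MvPolynomial.pderiv 1 P) +
        ∑ j, c j • (AbsSeries.X 0 ^ 0 * AbsSeries.X 1 ^ (K + 1 + j)) = h := by
    intro h hh
    let M : ℂ := 2 * K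
    have hM : M ≠ 0 := by
      have : (K : ℂ) ≠ 0 := by
        have : K ≠ 0 := by omega
        exact_mod_cast this
      exact mul_ne_zero (by norm_num) this
    obtain ⟨h, rfl⟩ : ∃ h', h = M • h' := ⟨M⁻¹ • h, (smul_inv_smul₀ hM h).symm⟩
    rw [Submodule.smul_mem_iff _ hM] at hh
    obtain ⟨h₀, hh₀, h', hh', rfl⟩ := exists_eq_add_X_mul hh
    obtain ⟨h₁, hh₁, q, hq, rfl⟩ := exists_eq_add_X_mul hh'
    obtain ⟨q₀, hq₀, q₁, hq₁, rfl⟩ := exists_eq_add_X_mul hq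
    obtain ⟨b₀, hb₀, rfl⟩ := exists_eq_pow_mul hh₀ (N := K) (by rw [hw1]; omega)
    obtain ⟨b₁, hb₁, rfl⟩ := exists_eq_pow_mul hh₁ (N := 1) (by rw [hw1, hw0]; omega)
    obtain ⟨p₀, hp₀, rfl⟩ := exists_eq_pow_mul hq₀ (N := 1) (by rw [hw1, hw0]; omega)
    rw [hw0] at hb₁ hp₀ hq₁
    rw [hw1] at hb₀ hb₁ hp₀
    have hn : ∀ {d : ℕ} {a : AbsSeries 2}, a ∈ filt w d → (K : AbsSeries 2) * a ∈ filt w d := by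
      intro d a ha
      rw [← map_natCast (algebraMap ℂ (AbsSeries 2))]
      exact algebraMap_mul_mem_filt _ ha
    refine ⟨(K : AbsSeries 2) * (b₁ + AbsSeries.X 0 * p₀ -
        (K : AbsSeries 2) * (AbsSeries.X 1 ^ (K - 2) * q₁)) -
        AbsSeries.X 0 * b₀, ?_, 2 * (AbsSeries.X 1 * b₀) +
        2 * ((K : AbsSeries 2) * (AbsSeries.X 0 * q₁)), ?_, 0, ?_⟩
    · refine sub_mem (hn (sub_mem (add_mem ?_ ?_) (hn ?_))) ?_
      · exact filt_anti (by rw [hw0]; omega) (filtY_le _ _ hb₁)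
      · exact filt_anti (by rw [hw0]; omega) (mul_mem_filt (X_mem_filt w 0) (filtY_le _ _ hp₀))
      · exact filt_anti (by rw [hw0, hw1]; omega)
          (mul_mem_filt (pow_mem_filt (X_mem_filt w 1) _) hq₁)
      · exact filt_anti (by rw [hw0]; omega) (mul_mem_filt (X_mem_filt w 0) (filtY_le _ _ hb₀))
    · rw [two_mul, two_mul]
      have h1 : AbsSeries.X 1 * b₀ ∈ filt w (w 1 + 1) :=
        filt_anti (by rw [hw1]; omega) (mul_mem_filt (X_mem_filt w 1) (filtY_le _ _ hb₀))
      have h2 : (K : AbsSeries 2) * (AbsSeries.X 0 * q₁) ∈ filt w (w 1 + 1) :=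
        hn (filt_anti (by rw [hw0, hw1]; omega) (mul_mem_filt (X_mem_filt w 0) hq₁))
      exact add_mem (add_mem h1 h1) (add_mem h2 h2)
    · have e0 : MvPolynomial.aeval AbsSeries.X (MvPolynomial.pderiv 0 P) =
          2 * (AbsSeries.X 0 : AbsSeries 2) * AbsSeries.X 1 := by
        simp [P, MvPolynomial.pderiv_X]
        ring
      have e1 : MvPolynomial.aeval AbsSeries.X (MvPolynomial.pderiv 1 P) =
          (AbsSeries.X 0 ^ 2 : AbsSeries 2) + (K : AbsSeries 2) * AbsSeries.X 1 ^ (K - 1) := by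
        simp [P, MvPolynomial.pderiv_X]
      rw [e0, e1, Algebra.smul_def]
      simp only [M, map_mul, map_ofNat, map_natCast, Finset.univ_eq_empty, Finset.sum_empty]
      obtain ⟨s, rfl⟩ : ∃ s, K = s + 2 := ⟨K - 2, by omega⟩
      rw [Nat.add_sub_cancel, show s + 2 - 1 = s + 1 by omega]
      ring
  obtain ⟨a, ha, hga⟩ := exists_rightEquivalent_two (w := w) (by
      intro i
      fin_cases i
      · change 0 < w 0
        omega
      · change 0 < w 1
        omega) hP 0 (K + 1) 0 (by rw [hw1]; omega) hs (g := g)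
      (by simpa [P] using hg)
  have ha0 : a = 0 := by
    rwa [Polynomial.mem_degreeLT, Nat.cast_zero, Nat.WithBot.lt_zero_iff,
      Polynomial.degree_eq_bot] at ha
  refine hga.trans (.of_eventuallyEq (Eventually.of_forall fun z => ?_))
  simp [P, ha0]

end NormalForms

/-! ### The series `J_{r,i}` with `i ≥ 1` -/

/-- A form of the surjectivity theorem in which the derivative is computed along lines. -/
theorem exists_eq_add_of_contDiffAt {E F : Type*} [NormedAddCommGroup E] [NormedSpace ℂ E]
    [CompleteSpace E] [NormedAddCommGroup F] [NormedSpace ℂ F] [CompleteSpace F]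
    {H : Submodule ℂ F} (hH : IsClosed (H : Set F)) {Φ : E → F}
    (hΦ : ContDiffAt ℂ 1 Φ 0) (hmem : ∀ u, Φ u - Φ 0 ∈ H)
    (hsurj : ∀ h ∈ H, ∃ u, HasDerivAt (fun t : ℂ => Φ (t • u)) h 0) {ε : ℝ} (hε : 0 < ε) :
    ∃ δ > 0, ∀ h ∈ H, ‖h‖ < δ → ∃ u, ‖u‖ < ε ∧ Φ u = Φ 0 + h := by
  have hs : HasStrictFDerivAt Φ (fderiv ℂ Φ 0) 0 := hΦ.hasStrictFDerivAt one_ne_zero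
  refine exists_eq_add_of_hasStrictFDerivAt hH hs hmem (fun h hh => ?_) hε
  obtain ⟨u, hu⟩ := hsurj h hh
  refine ⟨u, ?_⟩
  have h1 : HasDerivAt (fun t : ℂ => t • u) u 0 := by
    simpa using (hasDerivAt_id (0 : ℂ)).smul_const u
  have h2 : HasFDerivAt Φ (fderiv ℂ Φ 0) ((0 : ℂ) • u) := by
    rw [zero_smul]
    exact hs.hasFDerivAt
  exact (h2.comp_hasDerivAt 0 h1).unique hu

section TypeJ

/-- The series whose monomials have weight at least `d` for `w` and at least `e` for `v`. -/
abbrev filtTwo {n : ℕ} (w v : Fin n → ℕ) (d e : ℕ) : Submodule ℂ (AbsSeries n) :=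
  supp ({m | d ≤ Finsupp.weight w m} ∩ {m | e ≤ Finsupp.weight v m})

variable {n : ℕ} {w v : Fin n → ℕ}

theorem mem_filtTwo {d e : ℕ} {a : AbsSeries n} :
    a ∈ filtTwo w v d e ↔ a ∈ filt w d ∧ a ∈ filt v e := by
  rw [filtTwo, supp_inter, Submodule.mem_inf]

theorem mul_mem_filtTwo {d e d' e' : ℕ} {a b : AbsSeries n} (ha : a ∈ filtTwo w v d e)
    (hb : b ∈ filtTwo w v d' e') : a * b ∈ filtTwo w v (d + d') (e + e') := by
  rw [mem_filtTwo] at *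
  exact ⟨mul_mem_filt ha.1 hb.1, mul_mem_filt ha.2 hb.2⟩

theorem pow_mem_filtTwo {d e : ℕ} {a : AbsSeries n} (ha : a ∈ filtTwo w v d e) (k : ℕ) :
    a ^ k ∈ filtTwo w v (k * d) (k * e) := by
  rw [mem_filtTwo] at *
  exact ⟨pow_mem_filt ha.1 k, pow_mem_filt ha.2 k⟩

theorem filtTwo_anti {d e d' e' : ℕ} (hd : d ≤ d') (he : e ≤ e') :
    filtTwo w v d' e' ≤ filtTwo w v d e := fun _ ha =>
  mem_filtTwo.2 ⟨filt_anti hd (mem_filtTwo.1 ha).1, filt_anti he (mem_filtTwo.1 ha).2⟩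

theorem mem_filtTwo_zero (a : AbsSeries n) : a ∈ filtTwo w v 0 0 :=
  mem_filtTwo.2 ⟨mem_filt_zero w a, mem_filt_zero v a⟩

theorem X_mem_filtTwo (i : Fin n) : AbsSeries.X i ∈ filtTwo w v (w i) (v i) :=
  mem_filtTwo.2 ⟨X_mem_filt w i, X_mem_filt v i⟩

theorem mul_mem_filtTwo_right {d e : ℕ} {a : AbsSeries n} (ha : a ∈ filtTwo w v d e)
    (b : AbsSeries n) : a * b ∈ filtTwo w v d e :=
  mul_mem_filtTwo ha (mem_filtTwo_zero b)

theorem mul_mem_filtTwo_left {d e : ℕ} {a : AbsSeries n} (b : AbsSeries n)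
    (ha : a ∈ filtTwo w v d e) : b * a ∈ filtTwo w v d e := by
  rw [mul_comm]
  exact mul_mem_filtTwo_right ha b

end TypeJ

/-- The quotient by `s` of the increment of `X³ + X² Y ^ r` from `(X, Y)` to `(X + s ξ, Y + s η)`,
plus `(Y + s η) ^ N (b + ∑ c j (Y + s η) ^ j)`. -/
def jFamily {A : Type*} [CommRing A] [Algebra ℂ A] (r N : ℕ) (b s : ℂ) (X Y ξ η : A) {k : ℕ}
    (c : Fin k → ℂ) : A :=
  3 * X ^ 2 * ξ + s • (3 * X * ξ ^ 2) + s ^ 2 • ξ ^ 3 + (2 * X * ξ + s • ξ ^ 2) * (Y + s • η) ^ r +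
    X ^ 2 * η * ∑ j ∈ Finset.range r, (Y + s • η) ^ j * Y ^ (r - 1 - j) +
    (Y + s • η) ^ N * (algebraMap ℂ A b + ∑ j, c j • (Y + s • η) ^ (j : ℕ))

/-- The factor `s` is taken out by means of a geometric sum, without dividing; so `jFamily` still
makes sense and is differentiable at `s = 0`, where the equation is solved. -/
theorem smul_jFamily {A : Type*} [CommRing A] [Algebra ℂ A] (r N : ℕ) (b s : ℂ) (X Y ξ η : A)
    {k : ℕ} (c : Fin k → ℂ) :
    (X + s • ξ) ^ 3 + (X + s • ξ) ^ 2 * (Y + s • η) ^ r +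
      s • ((Y + s • η) ^ N * (algebraMap ℂ A b + ∑ j, c j • (Y + s • η) ^ (j : ℕ))) =
    X ^ 3 + X ^ 2 * Y ^ r + s • jFamily r N b s X Y ξ η c := by
  have h := (Commute.all (Y + s • η) Y).geom_sum₂_mul r
  rw [add_sub_cancel_left] at h
  simp only [jFamily, Algebra.smul_def] at h ⊢
  rw [map_pow]
  linear_combination (-X ^ 2) * h

/-- `(y + xσ)^r - y^r` is `xσ` times the geometric sum, so the two equations say that the
coefficients of `x² y^r` and `x³` are unchanged. The solutions are symmetries of `x³ + x² y^r`; they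
exist in abundance because this germ is not isolated. -/
theorem geom_family {A : Type*} [CommRing A] (r : ℕ) (x y σ l τ : A)
    (h1 : (1 + l) ^ 2 * (1 + τ) ^ r = 1)
    (h2 : (1 + l) ^ 3 + σ * ∑ j ∈ Finset.range r, (y + x * σ) ^ j * y ^ (r - 1 - j) = 1) :
    ((1 + l) * x) ^ 3 + ((1 + l) * x) ^ 2 * ((1 + τ) * (y + x * σ)) ^ r = x ^ 3 + x ^ 2 * y ^ r := by
  have h := (Commute.all (y + x * σ) y).geom_sum₂_mul r
  rw [add_sub_cancel_left] at h
  rw [mul_pow, mul_pow, mul_pow]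
  linear_combination (x ^ 2 * (y + x * σ) ^ r) * h1 + x ^ 3 * h2 - x ^ 2 * h

/-- At `t = 0` only `b * y ^ N` is left. To first order `ξ` and `η` act on `x³ + x² y^r`, while `σ`
and `τ` act through `b * y ^ N`; `l` drops out, since `X` occurs only multiplied by `ξ` or `η`. -/
theorem hasDerivAt_jFamily {A : Type*} [NormedCommRing A] [NormedAlgebra ℂ A] {r N : ℕ} (b s : ℂ)
    (x y σ l τ ξ η : A) {k : ℕ} (c : Fin k → ℂ) :
    HasDerivAt (fun t : ℂ => jFamily r N b (t * s) ((1 + t • l) * x)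
      ((1 + t • τ) * (y + x * (t • σ))) (t • ξ) (t • η) (t • c))
      (3 * x ^ 2 * ξ + 2 * x * y ^ r * ξ + (r : A) * x ^ 2 * y ^ (r - 1) * η +
        (N : A) * algebraMap ℂ A b * y ^ (N - 1) * (τ * y + x * σ) +
        y ^ N * ∑ j, c j • y ^ (j : ℕ)) 0 := by
  have hid : ∀ a : A, HasDerivAt (fun t : ℂ => t • a) a 0 := fun a => by
    simpa using (hasDerivAt_id (0 : ℂ)).smul_const a
  have hs : HasDerivAt (fun t : ℂ => t * s) s 0 := by
    simpa using (hasDerivAt_id (0 : ℂ)).mul_const s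
  have hX : HasDerivAt (fun t : ℂ => (1 + t • l) * x) (l * x) 0 := ((hid l).const_add 1).mul_const x
  have hY : HasDerivAt (fun t : ℂ => (1 + t • τ) * (y + x * (t • σ))) (τ * y + x * σ) 0 := by
    have := ((hid τ).const_add 1).mul (((hid σ).const_mul x).const_add y)
    exact this.congr_deriv (by simp)
  have hY' : HasDerivAt (fun t : ℂ => (1 + t • τ) * (y + x * (t • σ)) + (t * s) • t • η)
      (τ * y + x * σ) 0 := by
    have := hY.add (hs.smul (hid η))
    exact this.congr_deriv (by simp)
  unfold jFamily
  have hsum : HasDerivAt (fun t : ℂ => ∑ j ∈ Finset.range r,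
      ((1 + t • τ) * (y + x * (t • σ)) + (t * s) • t • η) ^ j *
        ((1 + t • τ) * (y + x * (t • σ))) ^ (r - 1 - j)) _ 0 :=
    HasDerivAt.fun_sum fun j _ => (hY'.pow j).mul (hY.pow (r - 1 - j))
  have hcsum : HasDerivAt (fun t : ℂ => ∑ j, (t • c) j •
      ((1 + t • τ) * (y + x * (t • σ)) + (t * s) • t • η) ^ (j : ℕ)) (∑ j, c j • y ^ (j : ℕ)) 0 := by
    refine HasDerivAt.fun_sum fun j _ => ?_
    have hc : HasDerivAt (fun t : ℂ => (t • c) j) (c j) 0 := by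
      simpa using (hasDerivAt_id (0 : ℂ)).mul_const (c j)
    have := hc.smul (hY'.pow (j : ℕ))
    exact this.congr_deriv (by simp)
  have hgeom : ∑ j ∈ Finset.range r, y ^ j * y ^ (r - 1 - j) = (r : A) * y ^ (r - 1) := by
    rw [Finset.sum_congr rfl fun j hj => ?_, Finset.sum_const, Finset.card_range, nsmul_eq_mul]
    rw [← pow_add]
    congr 1
    have := Finset.mem_range.1 hj
    omega
  have key := ((((((hX.pow 2).const_mul 3).mul (hid ξ)).add
    (hs.smul ((hX.const_mul 3).mul ((hid ξ).pow 2)))).add ((hs.pow 2).smul ((hid ξ).pow 3))).add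
    ((((hX.const_mul 2).mul (hid ξ)).add (hs.smul ((hid ξ).pow 2))).mul (hY'.pow r))).add
    (((hX.pow 2).mul (hid η)).mul hsum) |>.add
    ((hY'.pow N).mul (hcsum.const_add (algebraMap ℂ A b)))
  refine key.congr_deriv ?_
  simp [hgeom]
  ring

section TypeJ

variable {w v : Fin 2 → ℕ} {r i : ℕ}

/-- Division by the first variable, keeping track of supports. -/
theorem exists_eq_add_X_mul_of_supp {T : Set (Fin 2 →₀ ℕ)} {h : AbsSeries 2} (hh : h ∈ supp T) :
    ∃ h₀ ∈ supp ({m | m 0 = 0} ∩ T), ∃ q ∈ supp {k | Finsupp.single 0 1 + k ∈ T},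
      h = h₀ + AbsSeries.X 0 * q := by
  obtain ⟨h₀, hh₀, h₁, hh₁, rfl⟩ := exists_add_eq {m | m 0 = 0} hh
  obtain ⟨q, hq, rfl⟩ := exists_eq_mono_mul (m := Finsupp.single 0 1) hh₁ fun k hk => by
    have : k 0 ≠ 0 := hk.1
    rw [Finsupp.single_le_iff]
    omega
  exact ⟨h₀, hh₀, q, supp_mono (fun k hk => hk.2) hq, rfl⟩

/-- Division by a power of the second variable, keeping track of supports. -/
theorem exists_eq_pow_mul_of_supp {T : Set (Fin 2 →₀ ℕ)} {h : AbsSeries 2}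
    (hh : h ∈ supp ({m | m 0 = 0} ∩ T)) {N : ℕ} (hN : ∀ k ∈ T, k 0 = 0 → N ≤ k 1) :
    ∃ b ∈ supp ({m | m 0 = 0} ∩ {k | Finsupp.single 1 N + k ∈ T}), h = AbsSeries.X 1 ^ N * b := by
  obtain ⟨q, hq, rfl⟩ := exists_eq_mono_mul (m := Finsupp.single 1 N) hh fun k hk => by
    rw [Finsupp.single_le_iff]
    exact hN _ hk.2 hk.1
  refine ⟨q, supp_mono ?_ hq, by rw [mono_single_one]⟩
  rintro k ⟨hk0, hk⟩
  exact ⟨by simpa using hk0, hk⟩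

/-- Surjectivity of the derivative of the family `jFamily` onto the series whose monomials lie on
or above the Newton polygon of `x³ + x² y ^ r + y ^ (3 r + i)`. -/
theorem exists_jFamily_deriv_eq (hr : 2 ≤ r) (hw0 : w 0 = r) (hw1 : w 1 = 1)
    (hv0 : v 0 = 2 * r + i) (hv1 : v 1 = 2) {b : ℂ} (hb : b ≠ 0) (e₁ e₂ : AbsSeries 2)
    {h : AbsSeries 2} (hh : h ∈ filtTwo w v (3 * r) (6 * r + 2 * i)) :
    ∃ σ l τ : AbsSeries 2, ∃ ξ ∈ filtTwo w v r (2 * r + i), ∃ η ∈ filtTwo w v 1 2,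
      ∃ c : Fin (r - 1) → ℂ, 2 * l + (r : AbsSeries 2) * τ = e₁ ∧
        3 * l + (r : AbsSeries 2) * AbsSeries.X 1 ^ (r - 1) * σ = e₂ ∧
        3 * (AbsSeries.X 0 ^ 2 : AbsSeries 2) * ξ + 2 * AbsSeries.X 0 * AbsSeries.X 1 ^ r * ξ +
          (r : AbsSeries 2) * AbsSeries.X 0 ^ 2 * AbsSeries.X 1 ^ (r - 1) * η +
          ((3 * r + i : ℕ) : AbsSeries 2) * algebraMap ℂ _ b * AbsSeries.X 1 ^ (3 * r + i - 1) *
            (τ * AbsSeries.X 1 + AbsSeries.X 0 * σ) +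
          AbsSeries.X 1 ^ (3 * r + i) * ∑ j, c j • AbsSeries.X 1 ^ (j : ℕ) = h := by
  let N := 3 * r + i
  -- `M` and the factors `3 * r` taken out of `e₁`, `e₂` clear all denominators in the solution.
  let M : ℂ := 12 * r * N * b
  have hr0 : (r : ℂ) ≠ 0 := by
    have : r ≠ 0 := by omega
    exact_mod_cast this
  have hN0 : (N : ℂ) ≠ 0 := by
    have : N ≠ 0 := by omega
    exact_mod_cast this
  have hM : M ≠ 0 := mul_ne_zero (mul_ne_zero (mul_ne_zero (by norm_num) hr0) hN0) hb
  obtain ⟨e₁, rfl⟩ : ∃ e, e₁ = (3 * r : ℂ) • e :=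
    ⟨(3 * r : ℂ)⁻¹ • e₁, (smul_inv_smul₀ (mul_ne_zero (by norm_num) hr0) _).symm⟩
  obtain ⟨e₂, rfl⟩ : ∃ e, e₂ = (3 * r : ℂ) • e :=
    ⟨(3 * r : ℂ)⁻¹ • e₂, (smul_inv_smul₀ (mul_ne_zero (by norm_num) hr0) _).symm⟩
  have hX : AbsSeries.X 0 ∈ filtTwo w v r (2 * r + i) := by
    simpa only [hw0, hv0] using X_mem_filtTwo (w := w) (v := v) 0
  have hY : AbsSeries.X 1 ∈ filtTwo w v 1 2 := by
    simpa only [hw1, hv1] using X_mem_filtTwo (w := w) (v := v) 1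
  have hn : ∀ (c : ℕ) {d e : ℕ} {a : AbsSeries 2}, a ∈ filtTwo w v d e →
      (c : AbsSeries 2) * a ∈ filtTwo w v d e := fun c _ _ _ => mul_mem_filtTwo_left _
  have hH : h - (N : AbsSeries 2) * algebraMap ℂ _ b * (3 * e₁ - 2 * e₂) * AbsSeries.X 1 ^ N ∈
      filtTwo w v (3 * r) (6 * r + 2 * i) := by
    refine sub_mem hh (mul_mem_filtTwo_left _ (filtTwo_anti ?_ ?_ (pow_mem_filtTwo hY N))) <;>
      omega
  obtain ⟨h', hh', hh'_eq⟩ : ∃ h' ∈ filtTwo w v (3 * r) (6 * r + 2 * i), h -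
      (N : AbsSeries 2) * algebraMap ℂ _ b * (3 * e₁ - 2 * e₂) * AbsSeries.X 1 ^ N = M • h' :=
    ⟨M⁻¹ • _, Submodule.smul_mem _ _ hH, (smul_inv_smul₀ hM _).symm⟩
  -- Series on or above the Newton polygon lie in the ideal of `x³`, `x² y^r`, `x y^(2r)`, `y^N`.
  -- The finer support of `p` is kept, because `ξ` must have it.
  obtain ⟨h₀, ⟨q, hq, rfl⟩, p, ⟨p₁, rfl⟩, hp, q', ⟨k₀, p', rfl⟩, rfl⟩ :
      ∃ h₀, (∃ q ∈ filtY w 0, h₀ = AbsSeries.X 1 ^ N * q) ∧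
      ∃ p, (∃ p₁, p = AbsSeries.X 1 ^ r * p₁) ∧ p ∈ filtTwo w v r (2 * r + i) ∧
      ∃ q', (∃ k₀ p', q' = AbsSeries.X 1 ^ r * k₀ + AbsSeries.X 0 * p') ∧
      h' = h₀ + AbsSeries.X 0 * (AbsSeries.X 1 ^ r * p + AbsSeries.X 0 * q') := by
    obtain ⟨h₀, hh₀, h₁, hh₁, rfl⟩ := exists_eq_add_X_mul_of_supp hh'
    obtain ⟨h₂, hh₂, q', hq', rfl⟩ := exists_eq_add_X_mul_of_supp hh₁
    obtain ⟨h₃, hh₃, p', -, rfl⟩ := exists_eq_add_X_mul_of_supp hq'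
    obtain ⟨q, hq, rfl⟩ := exists_eq_pow_mul_of_supp hh₀ (N := N) fun k hk hk0 => by
      have := hk.2
      rw [Set.mem_ofPred_eq, weight_two, hk0, hv1] at this
      omega
    obtain ⟨p, hp, rfl⟩ := exists_eq_pow_mul_of_supp hh₂ (N := r) fun k hk hk0 => by
      have := hk.1
      simp [weight_two, hk0, hw0, hw1] at this
      omega
    obtain ⟨k₀, -, rfl⟩ := exists_eq_pow_mul_of_supp hh₃ (N := r) fun k hk hk0 => by
      have := hk.1
      simp [weight_two, hk0, hw0, hw1] at this
      omega
    refine ⟨_, ⟨q, supp_mono (Set.inter_subset_inter_right _ fun k _ => Nat.zero_le _) hq, rfl⟩, p, ?_,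
      supp_mono ?_ hp, _, ⟨k₀, p', rfl⟩, rfl⟩
    · obtain ⟨p₁, -, h⟩ := exists_eq_pow_mul_of_supp hp (N := r) fun k hk hk0 => by
        have := hk.1
        simp [weight_two, hk0, hw0, hw1] at this
        omega
      exact ⟨p₁, h⟩
    rintro k ⟨hk0, hk1, hk2⟩
    have hk0 : k 0 = 0 := hk0
    refine ⟨?_, ?_⟩
    · simp [weight_two, hk0, hw0, hw1] at hk1 ⊢
      omega
    · simp [weight_two, hk0, hv0, hv1] at hk2 ⊢
      omega
  obtain ⟨c, q₁, -, rfl⟩ := exists_eq_sum_add_pow_mul hq (r - 1)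
  let B : AbsSeries 2 := algebraMap ℂ _ b
  let R : AbsSeries 2 := (r : AbsSeries 2)
  let N' : AbsSeries 2 := (N : AbsSeries 2)
  -- The tail `y^(r-1) q₁` beyond the `r - 1` moduli is absorbed by `τ`, and the two constraints
  -- then determine matching `l` and `σ`. `ξ` and `η` cancel the resulting term in `x y^(N-1) q₁`
  -- and represent the remaining multiples of `x`.
  refine ⟨18 * R * q₁, R * e₂ - 6 * R ^ 2 * AbsSeries.X 1 ^ (r - 1) * q₁,
    3 * e₁ - 2 * e₂ + 12 * R * AbsSeries.X 1 ^ (r - 1) * q₁,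
    (3 * R * N' * B) * (2 * (AbsSeries.X 1 ^ r * p₁) - 3 * (AbsSeries.X 1 ^ (2 * r + i - 1) * q₁)) +
      (4 * R * N' * B) * (AbsSeries.X 0 * p'), ?_,
    (3 * N' * B) * (AbsSeries.X 1 * (4 * k₀ - 6 * p₁ + 9 * AbsSeries.X 1 ^ (r + i - 1) * q₁)) -
      (8 * N' * B) * (AbsSeries.X 1 * p'), ?_, M • c, ?_, ?_, ?_⟩
  · refine add_mem (mul_mem_filtTwo_left _ (sub_mem (mul_mem_filtTwo_left _ hp)
      (mul_mem_filtTwo_left _ (mul_mem_filtTwo_right ?_ _))))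
      (mul_mem_filtTwo_left _ (mul_mem_filtTwo_right hX _))
    exact filtTwo_anti (by omega) (by omega) (pow_mem_filtTwo hY _)
  · exact sub_mem (mul_mem_filtTwo_left _ (mul_mem_filtTwo_right hY _))
      (mul_mem_filtTwo_left _ (mul_mem_filtTwo_right hY _))
  · simp only [Algebra.smul_def, map_mul, map_ofNat, map_natCast, R]
    ring
  · simp only [Algebra.smul_def, map_mul, map_ofNat, map_natCast, R]
    ring
  · rw [sub_eq_iff_eq_add] at hh'_eq
    rw [hh'_eq]
    simp only [Pi.smul_apply, smul_assoc, ← Finset.smul_sum]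
    rw [Algebra.smul_def, Algebra.smul_def]
    simp only [M, map_mul, map_ofNat, map_natCast]
    change _ = 12 * R * N' * B * _ + N' * B * _ * _
    change _ + N' * B * _ * _ + _ * (12 * R * N' * B * _) = _
    generalize ∑ j, c j • (AbsSeries.X 1 : AbsSeries 2) ^ (j : ℕ) = S
    obtain ⟨s, rfl⟩ : ∃ s, r = s + 1 := ⟨r - 1, by omega⟩
    simp only [N]
    rw [Nat.add_sub_cancel, show 2 * (s + 1) + i - 1 = 2 * s + i + 1 by omega,
      show s + 1 + i - 1 = s + i by omega, show 3 * (s + 1) + i - 1 = 3 * s + i + 2 by omega]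
    change _ + R * _ * _ * _ + _ + _ = _
    ring

/-- For both weights, `X` and `ξ` have at least the weight of `x`, and `Y` and `η` at least that of
`y`. The first weight has `x³` and `x² y^r` on its edge, the second `x² y^r` and `y^(3r+i)`. -/
theorem jFamily_mem (hr : 2 ≤ r) (hw0 : w 0 = r) (hw1 : w 1 = 1) (hv0 : v 0 = 2 * r + i) (hv1 : v 1 = 2)
    (b s : ℂ) (σ l τ : AbsSeries 2) {ξ η : AbsSeries 2} (hξ : ξ ∈ filtTwo w v r (2 * r + i))
    (hη : η ∈ filtTwo w v 1 2) {k : ℕ} (c : Fin k → ℂ) :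
    jFamily r (3 * r + i) b s ((1 + l) * AbsSeries.X 0)
      ((1 + τ) * (AbsSeries.X 1 + AbsSeries.X 0 * σ)) ξ η c ∈
      filtTwo w v (3 * r) (6 * r + 2 * i) := by
  have hX : (1 + l) * AbsSeries.X 0 ∈ filtTwo w v r (2 * r + i) :=
    mul_mem_filtTwo_left _ (by simpa only [hw0, hv0] using X_mem_filtTwo (w := w) (v := v) 0)
  have hY : (1 + τ) * (AbsSeries.X 1 + AbsSeries.X 0 * σ) ∈ filtTwo w v 1 2 := by
    refine mul_mem_filtTwo_left _ (add_mem ?_ (mul_mem_filtTwo_right ?_ _))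
    · simpa only [hw1, hv1] using X_mem_filtTwo (w := w) (v := v) 1
    · exact filtTwo_anti (by rw [hw0]; omega) (by rw [hv0]; omega) (X_mem_filtTwo (w := w) (v := v) 0)
  have hY' : (1 + τ) * (AbsSeries.X 1 + AbsSeries.X 0 * σ) + s • η ∈ filtTwo w v 1 2 :=
    add_mem hY (Submodule.smul_mem _ _ hη)
  generalize (1 + l) * AbsSeries.X 0 = X at *
  generalize (1 + τ) * (AbsSeries.X 1 + AbsSeries.X 0 * σ) = Y at *
  have hX2 := pow_mem_filtTwo hX 2
  have hξ2 := pow_mem_filtTwo hξ 2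
  refine add_mem (add_mem (add_mem (add_mem (add_mem ?_ (Submodule.smul_mem _ _ ?_))
    (Submodule.smul_mem _ _ ?_)) ?_) ?_) ?_
  · exact filtTwo_anti (by omega) (by omega) (mul_mem_filtTwo (mul_mem_filtTwo_left 3 hX2) hξ)
  · exact filtTwo_anti (by omega) (by omega) (mul_mem_filtTwo (mul_mem_filtTwo_left 3 hX) hξ2)
  · exact filtTwo_anti (by omega) (by omega) (pow_mem_filtTwo hξ 3)
  · refine filtTwo_anti (d' := r + r + r * 1) (e' := 2 * r + i + (2 * r + i) + r * 2) (by omega)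
      (by omega) (mul_mem_filtTwo (add_mem (mul_mem_filtTwo (mul_mem_filtTwo_left 2 hX) hξ)
      (Submodule.smul_mem _ s (filtTwo_anti (by omega) (by omega) hξ2))) (pow_mem_filtTwo hY' r))
  · rw [mul_assoc, Finset.mul_sum]
    refine filtTwo_anti (d' := 2 * r + r) (e' := 2 * (2 * r + i) + 2 * r) (by omega) (by omega)
      (mul_mem_filtTwo hX2 (Submodule.sum_mem _ fun j hj => ?_))
    have := Finset.mem_range.1 hj
    exact filtTwo_anti (d' := 1 + (j * 1 + (r - 1 - j) * 1)) (e' := 2 + (j * 2 + (r - 1 - j) * 2))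
      (by omega) (by omega) (mul_mem_filtTwo hη
      (mul_mem_filtTwo (pow_mem_filtTwo hY' j) (pow_mem_filtTwo hY (r - 1 - j))))
  · exact filtTwo_anti (by omega) (by omega) (mul_mem_filtTwo_right (pow_mem_filtTwo hY' _) _)

theorem contDiffAt_jFamily {E A : Type*} [NormedAddCommGroup E] [NormedSpace ℂ E]
    [NormedCommRing A] [NormedAlgebra ℂ A] (r N : ℕ) (b : ℂ) (x y : A) (s : E →L[ℂ] ℂ)
    (σ l τ ξ η : E →L[ℂ] A) {k : ℕ} (c : E →L[ℂ] (Fin k → ℂ)) :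
    ContDiffAt ℂ 1 (fun u => jFamily r N b (s u) ((1 + l u) * x) ((1 + τ u) * (y + x * σ u))
      (ξ u) (η u) (c u)) 0 := by
  unfold jFamily
  fun_prop

theorem contDiffAt_jEquations {E A : Type*} [NormedAddCommGroup E] [NormedSpace ℂ E]
    [NormedCommRing A] [NormedAlgebra ℂ A] (r : ℕ) (x y : A)
    (σ l τ : E →L[ℂ] A) :
    ContDiffAt ℂ 1 (fun u => ((1 + l u) ^ 2 * (1 + τ u) ^ r,
      (1 + l u) ^ 3 + σ u * ∑ j ∈ Finset.range r, (y + x * σ u) ^ j * y ^ (r - 1 - j))) 0 := by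
  fun_prop

theorem hasDerivAt_jEquations {A : Type*} [NormedCommRing A] [NormedAlgebra ℂ A] (r : ℕ)
    (x y σ l τ : A) :
    HasDerivAt (fun t : ℂ => ((1 + t • l) ^ 2 * (1 + t • τ) ^ r,
      (1 + t • l) ^ 3 + (t • σ) * ∑ j ∈ Finset.range r, (y + x * (t • σ)) ^ j * y ^ (r - 1 - j)))
      (2 * l + r * τ, 3 * l + r * y ^ (r - 1) * σ) 0 := by
  have hid : ∀ a : A, HasDerivAt (fun t : ℂ => t • a) a 0 := fun a => by
    simpa using (hasDerivAt_id (0 : ℂ)).smul_const a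
  have hgeom : ∑ j ∈ Finset.range r, y ^ j * y ^ (r - 1 - j) = (r : A) * y ^ (r - 1) := by
    rw [Finset.sum_congr rfl fun j hj => ?_, Finset.sum_const, Finset.card_range, nsmul_eq_mul]
    rw [← pow_add]
    congr 1
    have := Finset.mem_range.1 hj
    omega
  have hsum : HasDerivAt (fun t : ℂ => ∑ j ∈ Finset.range r,
      (y + x * (t • σ)) ^ j * y ^ (r - 1 - j)) _ 0 :=
    HasDerivAt.fun_sum fun j _ => ((((hid σ).const_mul x).const_add y).pow j).mul_const _
  refine HasDerivAt.prodMk (((((hid l).const_add 1).pow 2).mul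
    (((hid τ).const_add 1).pow r)).congr_deriv ?_)
    (((((hid l).const_add 1).pow 3).add ((hid σ).mul hsum)).congr_deriv ?_)
  · simp
  · simp [hgeom]
    ring

/-- The system of equations defining the coordinate change is solvable near the origin. -/
theorem exists_jFamily_eq (hr : 2 ≤ r) (hw0 : w 0 = r) (hw1 : w 1 = 1)
    (hv0 : v 0 = 2 * r + i) (hv1 : v 1 = 2) {b : ℂ} (hb : b ≠ 0) {ε : ℝ} (hε : 0 < ε) :
    ∃ δ > 0, ∀ s : ℂ, ‖s‖ < δ → ∀ h ∈ filtTwo w v (3 * r) (6 * r + 2 * i), ‖h‖ < δ →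
      ∃ σ l τ : AbsSeries 2, ∃ ξ ∈ filtTwo w v r (2 * r + i), ∃ η ∈ filtTwo w v 1 2,
        ∃ c : Fin (r - 1) → ℂ, ‖σ‖ < ε ∧ ‖l‖ < ε ∧ ‖τ‖ < ε ∧ ‖ξ‖ < ε ∧ ‖η‖ < ε ∧ ‖c‖ < ε ∧
        (1 + l) ^ 2 * (1 + τ) ^ r = 1 ∧
        (1 + l) ^ 3 + σ * ∑ j ∈ Finset.range r, (AbsSeries.X 1 + AbsSeries.X 0 * σ) ^ j *
          AbsSeries.X 1 ^ (r - 1 - j) = 1 ∧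
        jFamily r (3 * r + i) b s ((1 + l) * AbsSeries.X 0)
          ((1 + τ) * (AbsSeries.X 1 + AbsSeries.X 0 * σ)) ξ η c =
          algebraMap ℂ _ b * AbsSeries.X 1 ^ (3 * r + i) + h := by
  let A := AbsSeries 2
  let Ξ := filtTwo w v r (2 * r + i)
  let Η := filtTwo w v 1 2
  let E := (ℂ × (Fin (r - 1) → ℂ)) × ((A × A × A) × (Ξ × Η))
  let s : E →L[ℂ] ℂ := (ContinuousLinearMap.fst ℂ _ _).comp (ContinuousLinearMap.fst ℂ _ _)
  let c : E →L[ℂ] (Fin (r - 1) → ℂ) :=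
    (ContinuousLinearMap.snd ℂ _ _).comp (ContinuousLinearMap.fst ℂ _ _)
  let T : E →L[ℂ] A × A × A :=
    (ContinuousLinearMap.fst ℂ _ _).comp (ContinuousLinearMap.snd ℂ _ _)
  let V : E →L[ℂ] Ξ × Η :=
    (ContinuousLinearMap.snd ℂ _ _).comp (ContinuousLinearMap.snd ℂ _ _)
  let σ : E →L[ℂ] A := (ContinuousLinearMap.fst ℂ _ _).comp T
  let l : E →L[ℂ] A :=
    (ContinuousLinearMap.fst ℂ _ _).comp ((ContinuousLinearMap.snd ℂ _ _).comp T)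
  let τ : E →L[ℂ] A :=
    (ContinuousLinearMap.snd ℂ _ _).comp ((ContinuousLinearMap.snd ℂ _ _).comp T)
  let ξ : E →L[ℂ] A := Ξ.subtypeL.comp ((ContinuousLinearMap.fst ℂ _ _).comp V)
  let η : E →L[ℂ] A := Η.subtypeL.comp ((ContinuousLinearMap.snd ℂ _ _).comp V)
  -- `s` is an unknown and also a component of the target, so a single application of local
  -- surjectivity covers all small `s` with one `δ`. The other components are the two symmetry
  -- equations and the family.
  let F : E → ℂ × ((A × A) × A) := fun u => (s u, ((1 + l u) ^ 2 * (1 + τ u) ^ r,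
    (1 + l u) ^ 3 + σ u * ∑ j ∈ Finset.range r, (AbsSeries.X 1 + AbsSeries.X 0 * σ u) ^ j *
      AbsSeries.X 1 ^ (r - 1 - j)), jFamily r (3 * r + i) b (s u) ((1 + l u) * AbsSeries.X 0)
      ((1 + τ u) * (AbsSeries.X 1 + AbsSeries.X 0 * σ u)) (ξ u) (η u) (c u))
  have hF : ContDiffAt ℂ 1 F 0 := s.contDiff.contDiffAt.prodMk
    ((contDiffAt_jEquations (E := E) r (AbsSeries.X 0 : A) (AbsSeries.X 1) σ l τ).prodMk
      (contDiffAt_jFamily (E := E) r (3 * r + i) b (AbsSeries.X 0 : A) (AbsSeries.X 1) s σ l τ ξ η c))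
  let pr : (ℂ × ((A × A) × A)) →L[ℂ] A :=
    (ContinuousLinearMap.snd ℂ _ _).comp (ContinuousLinearMap.snd ℂ _ _)
  let H := (filtTwo w v (3 * r) (6 * r + 2 * i)).comap (pr : (ℂ × ((A × A) × A)) →ₗ[ℂ] A)
  have hH : IsClosed (H : Set (ℂ × ((A × A) × A))) := (isClosed_supp _).preimage pr.continuous
  have hmem : ∀ u, F u - F 0 ∈ H := fun u =>
    sub_mem (jFamily_mem hr hw0 hw1 hv0 hv1 b _ _ _ _ u.2.2.1.2 u.2.2.2.2 _)
      (jFamily_mem hr hw0 hw1 hv0 hv1 b _ _ _ _ (0 : E).2.2.1.2 (0 : E).2.2.2.2 _)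
  obtain ⟨δ, hδ, key⟩ := exists_eq_add_of_contDiffAt hH hF hmem (fun h hh => by
    obtain ⟨s', ⟨e₁, e₂⟩, h⟩ := h
    obtain ⟨σ', l', τ', ξ', hξ', η', hη', c', h1, h2, h3⟩ :=
      exists_jFamily_deriv_eq hr hw0 hw1 hv0 hv1 hb e₁ e₂ (h := h) hh
    let u : E := ((s', c'), (σ', l', τ'), ⟨ξ', hξ'⟩, ⟨η', hη'⟩)
    refine ⟨u, ?_⟩
    have hs' : HasDerivAt (fun t : ℂ => t * s') s' 0 := by
      simpa using (hasDerivAt_id (0 : ℂ)).mul_const s'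
    have := hs'.prodMk ((hasDerivAt_jEquations r (AbsSeries.X 0 : A) (AbsSeries.X 1) σ' l' τ').prodMk
      (hasDerivAt_jFamily (r := r) (N := 3 * r + i) b s' (AbsSeries.X 0 : A) (AbsSeries.X 1)
        σ' l' τ' ξ' η' c'))
    rw [h1, h2, h3] at this
    exact this) hε
  have hF0 : F 0 = (0, (1, 1), algebraMap ℂ _ b * AbsSeries.X 1 ^ (3 * r + i)) := by
    simp only [F, map_zero, jFamily]
    simp only [zero_smul, add_zero, mul_zero, one_mul, one_pow, zero_mul, zero_add, Pi.zero_apply,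
      Finset.sum_const_zero, zero_pow (two_ne_zero), zero_pow (three_ne_zero), smul_zero]
    rw [mul_comm]
  refine ⟨δ, hδ, fun s₀ hs₀ h hh hn => ?_⟩
  obtain ⟨u, hu, hFu⟩ := key (s₀, (0, 0), h) hh (by
    simp only [Prod.norm_def, norm_zero, max_lt_iff]
    exact ⟨hs₀, ⟨hδ, hδ⟩, hn⟩)
  rw [hF0] at hFu
  have h1 : s u = s₀ := (congrArg Prod.fst hFu).trans (zero_add _)
  have h2 := (congrArg (fun p => p.2.1.1) hFu).trans (add_zero _)
  have h3 := (congrArg (fun p => p.2.1.2) hFu).trans (add_zero _)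
  have h4 : jFamily r (3 * r + i) b (s u) ((1 + l u) * AbsSeries.X 0)
      ((1 + τ u) * (AbsSeries.X 1 + AbsSeries.X 0 * σ u)) (ξ u) (η u) (c u) = _ :=
    congrArg (fun p => p.2.2) hFu
  rw [h1] at h4
  have hu1 := (norm_fst_le u).trans_lt hu
  have hu2 := (norm_snd_le u).trans_lt hu
  have hu3 := (norm_fst_le u.2).trans_lt hu2
  have hu4 := (norm_snd_le u.2).trans_lt hu2
  have hu5 := (norm_snd_le u.2.1).trans_lt hu3
  exact ⟨u.2.1.1, u.2.1.2.1, u.2.1.2.2, u.2.2.1, u.2.2.1.2, u.2.2.2, u.2.2.2.2, u.1.2,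
    (norm_fst_le u.2.1).trans_lt hu3, (norm_fst_le u.2.1.2).trans_lt hu5,
    (norm_snd_le u.2.1.2).trans_lt hu5, (norm_fst_le u.2.2).trans_lt hu4,
    (norm_snd_le u.2.2).trans_lt hu4, (norm_snd_le u.1).trans_lt hu1, h2, h3, h4⟩

end TypeJ

theorem WeightGE.of_apply_zero {n : ℕ} {w : Fin n → ℕ} (hw : ∀ i, 0 < w i) {f : (Fin n → ℂ) → ℂ}
    (hf : AnalyticAt ℂ f 0) (h0 : f 0 = 0) : WeightGE w 1 f := by
  obtain ⟨p, hp⟩ := hf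
  refine (GermSupp.of_hasFPowerSeriesAt hp (d := 1) fun k hk z => ?_).mono fun m hm => ?_
  · obtain rfl : k = 0 := by omega
    rw [hp.coeff_zero, h0]
  · rw [Set.mem_ofPred_eq, weight_eq_sum] at hm ⊢
    exact hm.trans (Finset.sum_le_sum fun i _ => Nat.mul_le_mul_left _ (hw i))

theorem exists_small_pos (C : ℝ) {t₀ δ : ℝ} (ht₀ : 0 < t₀) (hδ : 0 < δ) :
    ∃ t : ℝ, 0 < t ∧ t ≤ t₀ ∧ t ≤ 1 ∧ t < δ ∧ C * t < δ := by
  have h1 : ∀ᶠ t : ℝ in 𝓝[>] 0, t ≤ t₀ := nhdsWithin_le_nhds (eventually_le_nhds ht₀)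
  have h2 : ∀ᶠ t : ℝ in 𝓝[>] 0, t ≤ 1 := nhdsWithin_le_nhds (eventually_le_nhds one_pos)
  have h3 : ∀ᶠ t : ℝ in 𝓝[>] 0, t < δ := nhdsWithin_le_nhds (eventually_lt_nhds hδ)
  have h4 : ∀ᶠ t : ℝ in 𝓝[>] 0, C * t < δ := by
    refine nhdsWithin_le_nhds ((continuous_const.mul continuous_id).continuousAt.eventually_lt
      continuousAt_const ?_)
    simpa using hδ
  have h5 : ∀ᶠ t : ℝ in 𝓝[>] 0, 0 < t := self_mem_nhdsWithin
  obtain ⟨t, ht⟩ := (h1.and (h2.and (h3.and (h4.and h5)))).exists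
  exact ⟨t, ht.2.2.2.2, ht.1, ht.2.1, ht.2.2.1, ht.2.2.2.1⟩

theorem norm_X {n : ℕ} (i : Fin n) : ‖(AbsSeries.X i : AbsSeries n)‖ = 1 := norm_mono _

/-- The moduli of the series `J_{r,i}`. -/
theorem exists_rightEquivalent_J {r i : ℕ} (hr : 2 ≤ r) (hi : 1 ≤ i) {b : ℂ → ℂ}
    (hb : AnalyticAt ℂ b 0) (hb0 : b 0 ≠ 0) {g : (Fin 2 → ℂ) → ℂ}
    (hg : ∀ᶠ z in 𝓝 0, g z = z 0 ^ 3 + z 0 ^ 2 * z 1 ^ r + b (z 1) * z 1 ^ (3 * r + i)) :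
    ∃ a ∈ Polynomial.degreeLT ℂ (r - 1), a.coeff 0 ≠ 0 ∧ RightEquivalent g
      (fun z => z 0 ^ 3 + z 0 ^ 2 * z 1 ^ r + a.eval (z 1) * z 1 ^ (3 * r + i)) := by
  generalize hw : ![r, 1] = w
  generalize hv : ![2 * r + i, 2] = v
  have hw0 : w 0 = r := by rw [← hw]; rfl
  have hw1 : w 1 = 1 := by rw [← hw]; rfl
  have hv0 : v 0 = 2 * r + i := by rw [← hv]; rfl
  have hv1 : v 1 = 2 := by rw [← hv]; rfl
  have hwp : ∀ i, 0 < w i := by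
    intro i
    fin_cases i
    · change 0 < w 0
      omega
    · change 0 < w 1
      omega
  have hB : WeightGE w 1 (fun z : Fin 2 → ℂ => b (z 1) - b 0) := by
    refine .of_apply_zero hwp ?_ (by simp)
    refine (AnalyticAt.comp (g := b) (f := fun z : Fin 2 → ℂ => z 1) ?_ ?_).sub analyticAt_const
    · exact hb
    · exact (ContinuousLinearMap.proj (R := ℂ) (φ := fun _ : Fin 2 => ℂ) 1).analyticAt 0
  obtain ⟨C, t₀, ht₀, hC⟩ := hB.exists_wscale hwp (d := 1) fun m hm => hm
  -- The bound `1 / 16` keeps the total shift below `1 / 2` in norm, and the bound `‖b 0‖` keeps the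
  -- constant coefficient `b 0 + c 0` of the modulus nonzero.
  let ε : ℝ := min (1 / 16) ‖b 0‖
  have hε : 0 < ε := by
    have := norm_pos_iff.2 hb0
    positivity
  obtain ⟨δ, hδ, key⟩ := exists_jFamily_eq hr hw0 hw1 hv0 hv1 hb0 hε
  obtain ⟨t, ht, htt₀, ht1, htδ, hCt⟩ := exists_small_pos C ht₀ hδ
  obtain ⟨a, ha, han, haz⟩ := hC t ht htt₀
  have ht0 : (t : ℂ) ≠ 0 := by exact_mod_cast ht.ne'
  have hnt : ‖(t : ℂ)‖ = t := by rw [Complex.norm_real, Real.norm_of_nonneg ht.le]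
  have hY : AbsSeries.X 1 ∈ filtTwo w v 1 2 := by
    simpa only [hw1, hv1] using X_mem_filtTwo (w := w) (v := v) 1
  have hs1 : ‖(t : ℂ) ^ i‖ ≤ t := by
    rw [norm_pow, hnt]
    exact pow_le_of_le_one ht.le ht1 (by omega)
  -- The parameter is `s = t ^ i`: for `w` the monomial `y^(3r+i)` has weight `i` more than the
  -- principal part, so rescaling gives it the factor `t ^ i`.
  obtain ⟨σ, l, τ, ξ, hξ, η, hη, c, hσε, hlε, hτε, hξε, hηε, hcε, h1, h2, h3⟩ :=
    key ((t : ℂ) ^ i) (hs1.trans_lt htδ) (AbsSeries.X 1 ^ (3 * r + i) * a)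
      (filtTwo_anti (by omega) (by omega) (mul_mem_filtTwo_right (pow_mem_filtTwo hY _) a)) (by
        refine lt_of_le_of_lt (norm_mul_le _ _) ?_
        rw [← mono_single_one, norm_mono, one_mul]
        exact han.trans_lt (by simpa using hCt))
  have hε' : ε ≤ 1 / 16 := min_le_left _ _
  have h4 := smul_jFamily r (3 * r + i) (b 0) ((t : ℂ) ^ i) ((1 + l) * AbsSeries.X 0)
    ((1 + τ) * (AbsSeries.X 1 + AbsSeries.X 0 * σ)) ξ η c
  rw [h3, geom_family r _ _ σ l τ h1 h2] at h4
  let U : Fin 2 → AbsSeries 2 := ![l * AbsSeries.X 0 + (t : ℂ) ^ i • ξ,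
    τ * AbsSeries.X 1 + AbsSeries.X 0 * σ + τ * AbsSeries.X 0 * σ + (t : ℂ) ^ i • η]
  have hU0 : (1 + l) * AbsSeries.X 0 + (t : ℂ) ^ i • ξ = AbsSeries.X 0 + U 0 := by
    simp only [U, Matrix.cons_val_zero]
    ring
  have hU1 : (1 + τ) * (AbsSeries.X 1 + AbsSeries.X 0 * σ) + (t : ℂ) ^ i • η =
      AbsSeries.X 1 + U 1 := by
    simp only [U, Matrix.cons_val_one, Matrix.cons_val_fin_one]
    ring
  rw [hU0, hU1] at h4
  -- The modulus `b 0 + ∑ c j * y ^ j` of the rescaled germ, written in the original variable `t *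
  -- y`.
  obtain ⟨p, hp, hpc, hpe⟩ := exists_polynomial_eval_eq
    (fun j : Fin (r - 1) => ((if (j : ℕ) = 0 then b 0 else 0) + c j) / (t : ℂ) ^ (j : ℕ))
  have hpt : ∀ y, p.eval ((t : ℂ) * y) = b 0 + ∑ j, c j * y ^ (j : ℕ) := by
    intro y
    rw [hpe]
    have : ∀ j : Fin (r - 1), ((if (j : ℕ) = 0 then b 0 else 0) + c j) / (t : ℂ) ^ (j : ℕ) *
        ((t : ℂ) * y) ^ (j : ℕ) = (if j = (⟨0, by omega⟩ : Fin (r - 1)) then b 0 else 0) +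
          c j * y ^ (j : ℕ) := by
      intro j
      have := pow_ne_zero (j : ℕ) ht0
      rw [mul_pow]
      by_cases hj : (j : ℕ) = 0
      · have : j = (⟨0, by omega⟩ : Fin (r - 1)) := Fin.ext hj
        simp [this]
      · have : j ≠ (⟨0, by omega⟩ : Fin (r - 1)) := fun h => hj (congrArg Fin.val h)
        simp only [hj, this, if_false, zero_add]
        field_simp
    rw [Finset.sum_congr rfl fun j _ => this j, Finset.sum_add_distrib]
    simp
  refine ⟨p, hp, ?_, ?_⟩
  · have := hpc ⟨0, by omega⟩
    simp only [if_true, pow_zero, div_one] at this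
    rw [this]
    intro h
    have h5 : ‖b 0‖ = ‖c ⟨0, by omega⟩‖ := by
      rw [eq_neg_of_add_eq_zero_left h, norm_neg]
    have h6 : ‖c ⟨0, by omega⟩‖ < ‖b 0‖ :=
      (norm_le_pi_norm c _).trans_lt (hcε.trans_le (min_le_right _ _))
    linarith
  · let G : (Fin 2 → ℂ) → ℂ :=
      fun z => z 0 ^ 3 + z 0 ^ 2 * z 1 ^ r + p.eval (z 1) * z 1 ^ (3 * r + i)
    change RightEquivalent g G
    have hts : ∀ i, (t : ℂ) ^ w i ≠ 0 := fun i => pow_ne_zero _ ht0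
    have e1 : RightEquivalent g (fun z => g fun i => (t : ℂ) ^ w i * z i) :=
      .of_scale _ hts (Eventually.of_forall fun _ => rfl)
    have e2 : RightEquivalent G (fun z => G fun i => (t : ℂ) ^ w i * z i) :=
      .of_scale _ hts (Eventually.of_forall fun _ => rfl)
    refine e1.trans (RightEquivalent.symm (e2.trans ?_))
    refine .of_series U ?_ ?_ ?_
    · intro j
      refine coeff_zero_eq_zero (w := w) (d := 0) ?_
      have hx : AbsSeries.X 0 ∈ filt w (0 + 1) := filt_anti (by rw [hw0]; omega) (X_mem_filt w 0)
      have hy : AbsSeries.X 1 ∈ filt w (0 + 1) := filt_anti (by rw [hw1]) (X_mem_filt w 1)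
      fin_cases j
      · exact add_mem (mul_mem_filt (mem_filt_zero w l) hx) (Submodule.smul_mem _ _
          (filt_anti (by omega) (mem_filtTwo.1 hξ).1))
      · have h5 : AbsSeries.X 0 * σ ∈ filt w (0 + 1) :=
          mul_mem_filt (d := 1) (e := 0) hx (mem_filt_zero w σ)
        refine add_mem (add_mem (add_mem (mul_mem_filt (mem_filt_zero w τ) hy) h5) ?_)
          (Submodule.smul_mem _ _ (mem_filtTwo.1 hη).1)
        rw [mul_assoc]
        exact mul_mem_filt (mem_filt_zero w τ) h5
    · have hm : ∀ {a b : AbsSeries 2} {x y : ℝ}, ‖a‖ ≤ x → ‖b‖ ≤ y → 0 ≤ x → ‖a * b‖ ≤ x * y :=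
        fun ha hb hx => (norm_mul_le _ _).trans (mul_le_mul ha hb (norm_nonneg _) hx)
      have hs : ∀ {a : AbsSeries 2}, ‖a‖ < ε → ‖(t : ℂ) ^ i • a‖ ≤ 1 / 16 := fun {a} ha => by
        rw [norm_smul]
        exact (mul_le_mul (hs1.trans ht1) (ha.le.trans hε') (norm_nonneg _) zero_le_one).trans
          (by norm_num)
      have h6 := hm (hlε.le.trans hε') (norm_X (n := 2) 0).le (by norm_num)
      have h7 := hm (hτε.le.trans hε') (norm_X (n := 2) 1).le (by norm_num)
      have h8 := hm (norm_X (n := 2) 0).le (hσε.le.trans hε') (by norm_num)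
      have h9 := hm (hm (hτε.le.trans hε') (norm_X (n := 2) 0).le (by norm_num)) (hσε.le.trans hε')
        (by norm_num)
      intro j
      fin_cases j
      · refine (norm_add_le_of_le h6 (hs hξε)).trans (by norm_num)
      · refine (norm_add_le_of_le (norm_add_le_of_le (norm_add_le_of_le h7 h8) h9) (hs hηε)).trans
          (by norm_num)
    · have hcont : Tendsto (fun z : Fin 2 → ℂ => fun i => (t : ℂ) ^ w i * z i) (𝓝 0) (𝓝 0) := by
        have : Continuous (fun z : Fin 2 → ℂ => fun i => (t : ℂ) ^ w i * z i) := by fun_prop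
        simpa [Pi.zero_def] using this.tendsto 0
      filter_upwards [Metric.closedBall_mem_nhds (0 : Fin 2 → ℂ) one_pos, hcont.eventually hg]
        with z hz hgz
      have hz : ‖z‖ ≤ 1 := by simpa using hz
      have key := congrArg (evalHom z hz) h4
      simp only [map_add, map_mul, map_pow, map_sum, map_smul, evalHom_apply, AbsSeries.eval_X, smul_eq_mul,
        AlgHom.commutes, Algebra.algebraMap_self, RingHom.id_apply] at key
      have hb1 : b ((t : ℂ) ^ w 1 * z 1) - b 0 = AbsSeries.eval z a := haz z hz
      rw [hw1, pow_one] at hb1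
      rw [hgz]
      simp only [G, hw0, hw1, pow_one]
      rw [hpt]
      generalize z 0 + AbsSeries.eval z (U 0) = x at *
      generalize z 1 + AbsSeries.eval z (U 1) = y at *
      rw [← hb1] at key
      have e3 : (t : ℂ) ^ (3 * r + i) = (t : ℂ) ^ (3 * r) * (t : ℂ) ^ i := pow_add _ _ _
      simp only [mul_pow, e3, ← pow_mul]
      have e4 : (t : ℂ) ^ (3 * r) = (t : ℂ) ^ (r * 3) := by rw [mul_comm]
      have e5 : (t : ℂ) ^ (r * 2) * (t : ℂ) ^ r = (t : ℂ) ^ (r * 3) := by rw [← pow_add]; ring_nf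
      rw [e4]
      linear_combination (t : ℂ) ^ (r * 3) * key + (x ^ 2 * y ^ r - z 0 ^ 2 * z 1 ^ r) * e5

/-! ### The splitting lemma and the unfolding of `x³` -/

/-- After a weighted rescaling, a germ with principal part `Θ 0` is a member of the family `Θ`. -/
theorem exists_scale_eq_eval {n : ℕ} {w : Fin n → ℕ} (hw : ∀ i, 0 < w i) {d : ℕ}
    {S : Set (Fin n →₀ ℕ)} (hS : ∀ m ∈ S, d + 1 ≤ Finsupp.weight w m) {E : Type*}
    [NormedAddCommGroup E] [NormedSpace ℂ E] [CompleteSpace E] {Θ : E → AbsSeries n}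
    (hΘ : ContDiffAt ℂ 1 Θ 0) (hmem : ∀ u, Θ u - Θ 0 ∈ supp S)
    (hsurj : ∀ h ∈ supp S, ∃ u, HasDerivAt (fun t : ℂ => Θ (t • u)) h 0)
    {P g : (Fin n → ℂ) → ℂ} (hP : ∀ z, ‖z‖ ≤ 1 → eval z (Θ 0) = P z)
    (hPw : ∀ (t : ℂ) z, P (fun i => t ^ w i * z i) = t ^ d * P z)
    (hg : GermSupp S (fun z => g z - P z)) {ε : ℝ} (hε : 0 < ε) :
    ∃ t : ℂ, t ≠ 0 ∧ ∃ u, ‖u‖ < ε ∧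
      ∀ z, ‖z‖ ≤ 1 → g (fun i => t ^ w i * z i) = t ^ d * eval z (Θ u) := by
  obtain ⟨δ, hδ, H⟩ := exists_eq_add_of_contDiffAt (isClosed_supp S) hΘ hmem hsurj hε
  obtain ⟨C, t₀, ht₀, hC⟩ := hg.exists_wscale hw hS
  obtain ⟨t, ht, htt₀, -, -, hCt⟩ := exists_small_pos C ht₀ hδ
  obtain ⟨a, ha, han, haz⟩ := hC t ht htt₀
  have ht0 : (t : ℂ) ≠ 0 := by exact_mod_cast ht.ne'
  obtain ⟨u, hu, hΦu⟩ := H (((t : ℂ) ^ d)⁻¹ • a) (Submodule.smul_mem _ _ ha) (by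
    rw [norm_smul, norm_inv, norm_pow, Complex.norm_real, Real.norm_of_nonneg ht.le]
    refine lt_of_le_of_lt ?_ hCt
    rw [inv_mul_le_iff₀ (by positivity)]
    exact han.trans_eq (by ring))
  refine ⟨t, ht0, u, hu, fun z hz => ?_⟩
  have key := congrArg (evalHom z hz) hΦu
  simp only [map_add, map_smul, evalHom_apply, smul_eq_mul] at key
  rw [key, hP z hz, mul_add, mul_inv_cancel_left₀ (pow_ne_zero _ ht0), ← haz z hz, hPw]
  ring

theorem eval_eq_of_supp {n : ℕ} {Z : Finset (Fin n)} {a : AbsSeries n}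
    (ha : a ∈ supp {m | ∀ i ∉ Z, m i = 0}) {z z' : Fin n → ℂ} (h : ∀ i ∈ Z, z i = z' i) :
    AbsSeries.eval z a = AbsSeries.eval z' a := by
  refine tsum_congr fun m => ?_
  by_cases hm : ∀ i ∉ Z, m i = 0
  · congr 1
    refine Finsupp.prod_congr fun i hi => ?_
    rw [h]
    by_contra hZ
    exact (Finsupp.mem_support_iff.1 hi) (hm i hZ)
  · rw [ha m hm, zero_mul, zero_mul]

/-- Division by the coordinates outside of `Z`. -/
theorem exists_eq_add_sum_X_mul {n d : ℕ} (Z : Finset (Fin n)) {h : AbsSeries n}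
    (hh : h ∈ filt (fun _ => 1) d) :
    ∃ ψ ∈ supp ({m | ∀ i ∉ Z, m i = 0} ∩ {m | d ≤ Finsupp.weight (fun _ => 1) m}),
      ∃ q : Fin n → AbsSeries n, (∀ j, q j ∈ filt (fun _ => 1) (d - 1)) ∧
        h = ψ + ∑ j ∈ Zᶜ, AbsSeries.X j * q j := by
  suffices H : ∀ s : Finset (Fin n), ∃ ψ ∈ supp ({m | ∀ i ∈ s, m i = 0} ∩
      {m | d ≤ Finsupp.weight (fun _ => 1) m}), ∃ q : Fin n → AbsSeries n,
      (∀ j, q j ∈ filt (fun _ => 1) (d - 1)) ∧ h = ψ + ∑ j ∈ s, AbsSeries.X j * q j by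
    simpa only [Finset.mem_compl] using H Zᶜ
  intro s
  induction s using Finset.induction_on with
  | empty => exact ⟨h, by simpa using hh, 0, fun j => Submodule.zero_mem _, by simp⟩
  | insert i s hi ih =>
    obtain ⟨ψ, hψ, q, hq, rfl⟩ := ih
    obtain ⟨ψ₀, hψ₀, ψ₁, hψ₁, rfl⟩ := exists_add_eq {m | m i = 0} hψ
    obtain ⟨p, hp, rfl⟩ := exists_eq_mono_mul (m := Finsupp.single i 1) hψ₁ fun k hk => by
      have : k i ≠ 0 := hk.1
      rw [Finsupp.single_le_iff]
      omega
    refine ⟨ψ₀, supp_mono ?_ hψ₀, Function.update q i p, fun j => ?_, ?_⟩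
    · rintro m ⟨hm0, hm, hmd⟩
      exact ⟨Finset.forall_mem_insert _ _ _ |>.2 ⟨hm0, hm⟩, hmd⟩
    · by_cases hj : j = i
      · subst hj
        rw [Function.update_self]
        refine supp_mono ?_ hp
        rintro m ⟨-, -, hm⟩
        simp only [Set.mem_ofPred_eq, map_add, Finsupp.weight_single, smul_eq_mul] at hm ⊢
        omega
      · rw [Function.update_of_ne hj]
        exact hq j
    · rw [Finset.sum_insert hi, Function.update_self, add_assoc, AbsSeries.X]
      congr 2
      refine Finset.sum_congr rfl fun j hj => ?_
      rw [Function.update_of_ne (ne_of_mem_of_not_mem hj hi)]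

theorem GermSupp.of_eval_smul {n : ℕ} {S : Set (Fin n →₀ ℕ)} {a : AbsSeries n} (ha : a ∈ supp S)
    (c : ℂ) : GermSupp S (fun z => eval (c • z) a) := by
  refine ⟨(‖c‖ + 1)⁻¹, by positivity, fun t ht ht' => ?_⟩
  have ht1 : ‖(t : ℂ) * c‖ ≤ 1 := by
    rw [norm_mul, Complex.norm_real, Real.norm_of_nonneg ht.le]
    rw [le_inv_comm₀ ht (by positivity)] at ht'
    calc t * ‖c‖ ≤ t * t⁻¹ := by gcongr; linarith
      _ = 1 := mul_inv_cancel₀ ht.ne'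
  refine ⟨wscale (fun _ => 1) _ ht1 a, wscale_mem_supp ht1 ha, fun z hz => ?_⟩
  rw [eval_wscale]
  simp only [pow_one]
  congr 1
  funext i
  simp only [Pi.smul_apply, smul_eq_mul]
  ring

theorem eval_ite {n : ℕ} (Z : Finset (Fin n)) (a : AbsSeries n) (z : Fin n → ℂ) :
    eval (fun i => if i ∈ Z then z i else 0) a = eval z (restrict {m | ∀ i ∉ Z, m i = 0} a) := by
  refine tsum_congr fun m => ?_
  by_cases hm : ∀ i ∉ Z, m i = 0
  · rw [coeff_restrict_of_mem (S := {m | ∀ i ∉ Z, m i = 0}) hm]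
    congr 1
    refine Finsupp.prod_congr fun i hi => ?_
    change (if i ∈ Z then z i else 0) ^ m i = _
    rw [if_pos]
    by_contra hZ
    exact (Finsupp.mem_support_iff.1 hi) (hm i hZ)
  · rw [coeff_restrict_of_notMem (S := {m | ∀ i ∉ Z, m i = 0}) hm, zero_mul]
    push Not at hm
    obtain ⟨i, hi, hmi⟩ := hm
    have : (m.prod fun i k => (if i ∈ Z then z i else 0) ^ k) = 0 := by
      refine Finset.prod_eq_zero (Finsupp.mem_support_iff.2 hmi) ?_
      simp [hi, hmi]
    rw [this, mul_zero]

theorem contDiffAt_splitting {E A : Type*} [NormedAddCommGroup E] [NormedSpace ℂ E]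
    [NormedCommRing A] [NormedAlgebra ℂ A] {ι : Type*} (s : Finset ι) (x : ι → A)
    (ξ : ι → E →L[ℂ] A) (ψ : E →L[ℂ] A) :
    ContDiffAt ℂ 1 (fun u => ∑ j ∈ s, (x j + ξ j u) ^ 2 + ψ u) 0 := by
  fun_prop

theorem hasDerivAt_splitting {A : Type*} [NormedCommRing A] [NormedAlgebra ℂ A] {ι : Type*}
    (s : Finset ι) (x ξ : ι → A) (ψ : A) :
    HasDerivAt (fun t : ℂ => ∑ j ∈ s, (x j + t • ξ j) ^ 2 + t • ψ)
      (∑ j ∈ s, 2 * x j * ξ j + ψ) 0 := by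
  have hid : ∀ a : A, HasDerivAt (fun t : ℂ => t • a) a 0 := fun a => by
    simpa using (hasDerivAt_id (0 : ℂ)).smul_const a
  refine ((HasDerivAt.fun_sum fun j _ => ((hid (ξ j)).const_add (x j)).pow 2).add
    (hid ψ)).congr_deriv ?_
  simp

/-- The splitting lemma: a germ with quadratic part `∑ j ∉ Z, z j ^ 2` is, in suitable
coordinates, the sum of its quadratic part and of a germ in the variables `z j`, `j ∈ Z`. -/
theorem exists_rightEquivalent_splitting {n : ℕ} (Z : Finset (Fin n)) {f : (Fin n → ℂ) → ℂ}
    (hf : WeightGE (fun _ => 1) 3 (fun z => f z - ∑ j ∈ Zᶜ, z j ^ 2)) :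
    ∃ ψ : (Fin n → ℂ) → ℂ, AnalyticAt ℂ ψ 0 ∧ WeightGE (fun _ => 1) 3 ψ ∧
      (∀ z z', (∀ i ∈ Z, z i = z' i) → ψ z = ψ z') ∧
      WeightGE (fun _ => 1) 4 (fun z => f (fun i => if i ∈ Z then z i else 0) - ψ z) ∧
      RightEquivalent f (fun z => ψ z + ∑ j ∈ Zᶜ, z j ^ 2) := by
  let Ψ := supp ({m : Fin n →₀ ℕ | ∀ i ∉ Z, m i = 0} ∩ {m | 3 ≤ Finsupp.weight (fun _ => 1) m})
  -- The unknowns are shifts of order at least two and the residual germ; the family is `∑ (x_j +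
  -- ξ_j)² + ψ`.
  let E := (Fin n → filt (fun _ : Fin n => 1) 2) × Ψ
  let ξ : Fin n → E →L[ℂ] AbsSeries n := fun j => (filt (fun _ : Fin n => 1) 2).subtypeL.comp
    ((ContinuousLinearMap.proj j).comp (ContinuousLinearMap.fst ℂ _ _))
  let ψ : E →L[ℂ] AbsSeries n := Ψ.subtypeL.comp (ContinuousLinearMap.snd ℂ _ _)
  have hΘ := contDiffAt_splitting (E := E) Zᶜ (AbsSeries.X : Fin n → AbsSeries n) ξ ψ
  have h3 : ∀ u : E, (∑ j ∈ Zᶜ, (AbsSeries.X j + ξ j u) ^ 2 + ψ u) -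
      (∑ j ∈ Zᶜ, (AbsSeries.X j + ξ j 0) ^ 2 + ψ 0) ∈
        supp {m : Fin n →₀ ℕ | 3 ≤ Finsupp.weight (fun _ => 1) m} := by
    intro u
    rw [map_zero, add_zero, add_sub_right_comm, ← Finset.sum_sub_distrib]
    refine add_mem (Submodule.sum_mem _ fun j _ => ?_) (supp_mono Set.inter_subset_right u.2.2)
    rw [map_zero, add_zero, show (AbsSeries.X j + ξ j u) ^ 2 - AbsSeries.X j ^ 2 =
      AbsSeries.X j * ξ j u + AbsSeries.X j * ξ j u + ξ j u * ξ j u by ring]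
    have h1 : AbsSeries.X j * ξ j u ∈ filt (fun _ : Fin n => 1) (1 + 2) :=
      mul_mem_filt (X_mem_filt _ j) (u.1 j).2
    exact add_mem (add_mem h1 h1) (filt_anti (by omega) (mul_mem_filt (u.1 j).2 (u.1 j).2))
  obtain ⟨t, ht, u, hu, huz⟩ := exists_scale_eq_eval (w := fun _ : Fin n => 1) (fun _ => one_pos)
    (d := 2) (fun m hm => hm) hΘ h3 (fun h hh => by
      -- The linearized equation `∑ 2 x_j ξ_j + ψ = h` is division by the coordinates outside `Z`,
      -- with remainder `ψ`.
      obtain ⟨ψ₀, hψ₀, q, hq, rfl⟩ := exists_eq_add_sum_X_mul Z hh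
      refine ⟨(fun j => (2 : ℂ)⁻¹ • ⟨q j, hq j⟩, ⟨ψ₀, hψ₀⟩), ?_⟩
      refine (hasDerivAt_splitting Zᶜ (AbsSeries.X : Fin n → AbsSeries n)
        (fun j => (2 : ℂ)⁻¹ • q j) ψ₀).congr_deriv ?_
      rw [add_comm]
      congr 1
      refine Finset.sum_congr rfl fun j _ => ?_
      rw [Algebra.smul_def]
      linear_combination (AbsSeries.X j * q j) * algebraMap_inv_ofNat_mul (n := n) (N := 2))
    (P := fun z => ∑ j ∈ Zᶜ, z j ^ 2) (g := f) (fun z hz => by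
      rw [← evalHom_apply z hz]
      simp only [map_zero, add_zero, map_sum, map_pow, evalHom_apply, AbsSeries.eval_X])
    (fun t z => by
      simp only [pow_one, mul_pow, Finset.mul_sum]) hf (ε := 1 / 2) (by norm_num)
  simp only [pow_one] at huz
  let ψ₀ : AbsSeries n := u.2
  have hψ₀ : ψ₀ ∈ Ψ := u.2.2
  let φ : (Fin n → ℂ) → ℂ := fun z => t ^ 2 * eval (t⁻¹ • z) ψ₀
  have hφ : GermSupp ({m : Fin n →₀ ℕ | ∀ i ∉ Z, m i = 0} ∩
      {m | 3 ≤ Finsupp.weight (fun _ => 1) m}) φ := (GermSupp.of_eval_smul hψ₀ _).const_mul _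
  have hdep : ∀ z z' : Fin n → ℂ, (∀ i ∈ Z, z i = z' i) → eval z ψ₀ = eval z' ψ₀ := fun z z' h =>
    eval_eq_of_supp (supp_mono Set.inter_subset_left hψ₀) h
  refine ⟨φ, hφ.analyticAt, hφ.mono Set.inter_subset_right, fun z z' h => ?_, ?_, ?_⟩
  · simp only [φ]
    rw [hdep (t⁻¹ • z) (t⁻¹ • z') fun i hi => by simp [h i hi]]
  -- Where the coordinates outside `Z` vanish, the rescaled germ is `ψ₀ + ∑ ξ_j²` up to a factor,
  -- and the squares have order at least four. So the residual germ keeps the cubic part of `f` on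
  -- this subspace.
  · let a : AbsSeries n := ∑ j ∈ Zᶜ, (u.1 j : AbsSeries n) ^ 2
    have ha : a ∈ filt (fun _ : Fin n => 1) 4 :=
      Submodule.sum_mem _ fun j _ => pow_mem_filt (u.1 j).2 2
    have h4 : WeightGE (fun _ => 1) 4 (fun z => t ^ 2 * eval (t⁻¹ • z)
        (restrict {m | ∀ i ∉ Z, m i = 0} a)) :=
      (GermSupp.of_eval_smul (supp_mono Set.inter_subset_right (restrict_mem ha)) _).const_mul _
    refine h4.congr ?_
    have hcont : Tendsto (fun z : Fin n → ℂ => t⁻¹ • z) (𝓝 0) (𝓝 0) := by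
      simpa using (continuous_const_smul t⁻¹).tendsto (0 : Fin n → ℂ)
    filter_upwards [hcont (Metric.closedBall_mem_nhds (0 : Fin n → ℂ) one_pos)] with z hz'
    have hz : ‖t⁻¹ • z‖ ≤ 1 := mem_closedBall_zero_iff.1 hz'
    generalize hy : t⁻¹ • z = y at hz
    have hzy : z = t • y := by rw [← hy, smul_inv_smul₀ ht]
    subst hzy
    let y' : Fin n → ℂ := fun i => if i ∈ Z then y i else 0
    have hy' : ‖y'‖ ≤ 1 := by
      refine (pi_norm_le_iff_of_nonneg zero_le_one).2 fun i => ?_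
      simp only [y']
      split_ifs
      · exact (norm_le_pi_norm y i).trans hz
      · simp
    have h5 : (fun i => if i ∈ Z then (t • y) i else 0) = fun i => t * y' i := by
      funext i
      simp [y']
    rw [h5, huz y' hy', ← eval_ite]
    change _ - t ^ 2 * eval (t⁻¹ • t • y) ψ₀ = t ^ 2 * eval y' a
    rw [hy, ← mul_sub, hdep y y' fun i hi => by simp [y', hi]]
    congr 1
    rw [sub_eq_iff_eq_add]
    simp only [a, ← evalHom_apply y' hy', map_add, map_sum, map_pow]
    congr 1
    refine Finset.sum_congr rfl fun j hj => ?_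
    rw [evalHom_apply, AbsSeries.eval_X]
    simp only [y', if_neg (Finset.mem_compl.1 hj), zero_add]
    rfl
  · let G : (Fin n → ℂ) → ℂ := fun z => φ z + ∑ j ∈ Zᶜ, z j ^ 2
    change RightEquivalent f G
    have e1 : RightEquivalent f (fun z => f fun i => t * z i) :=
      .of_scale _ (fun _ => ht) (Eventually.of_forall fun _ => rfl)
    have e2 : RightEquivalent G (fun z => G fun i => t * z i) :=
      .of_scale _ (fun _ => ht) (Eventually.of_forall fun _ => rfl)
    refine e1.trans (RightEquivalent.symm (e2.trans ?_))
    refine .of_series (fun j => if j ∈ Z then 0 else (u.1 j : AbsSeries n)) (fun j => ?_)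
      (fun j => ?_) ?_
    · split_ifs
      · exact map_zero _
      · exact coeff_zero_eq_zero (u.1 j).2
    · split_ifs
      · simp
      · exact ((norm_le_pi_norm u.1 j).trans (norm_fst_le u)).trans hu.le
    · filter_upwards [Metric.closedBall_mem_nhds (0 : Fin n → ℂ) one_pos] with z hz
      have hz : ‖z‖ ≤ 1 := by simpa using hz
      rw [huz z hz]
      let y : Fin n → ℂ := fun i => z i + eval z (if i ∈ Z then 0 else (u.1 i : AbsSeries n))
      change t ^ 2 * eval (t⁻¹ • fun i => t * y i) ψ₀ + ∑ j ∈ Zᶜ, (t * y j) ^ 2 = _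
      have h6 : (t⁻¹ • fun i => t * y i) = y := by
        funext i
        simp [ht]
      rw [h6, hdep y z fun i hi => by
        simp only [y, if_pos hi]
        rw [← evalHom_apply z hz, map_zero, add_zero]]
      simp only [mul_pow, ← Finset.mul_sum, ← mul_add]
      congr 1
      rw [add_comm]
      simp only [← evalHom_apply z hz, map_add, map_sum, map_pow]
      congr 1
      refine Finset.sum_congr rfl fun j hj => ?_
      simp only [y, if_neg (Finset.mem_compl.1 hj), evalHom_apply, AbsSeries.eval_X]
      rfl

theorem contDiffAt_unfolding {E A : Type*} [NormedAddCommGroup E] [NormedSpace ℂ E]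
    [NormedCommRing A] [NormedAlgebra ℂ A] (x : A) (ξ α β : E →L[ℂ] A) :
    ContDiffAt ℂ 1 (fun u => (x + ξ u) ^ 3 + α u * (x + ξ u) + β u) 0 := by
  fun_prop

theorem hasDerivAt_unfolding {A : Type*} [NormedCommRing A] [NormedAlgebra ℂ A] (x ξ α β : A) :
    HasDerivAt (fun t : ℂ => (x + t • ξ) ^ 3 + t • α * (x + t • ξ) + t • β)
      (3 * x ^ 2 * ξ + α * x + β) 0 := by
  have hid : ∀ a : A, HasDerivAt (fun t : ℂ => t • a) a 0 := fun a => by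
    simpa using (hasDerivAt_id (0 : ℂ)).smul_const a
  refine (((((hid ξ).const_add x).pow 3).add ((hid α).mul ((hid ξ).const_add x))).add
    (hid β)).congr_deriv ?_
  simp

/-- The unfolding of the singularity `x³` in two variables. -/
theorem exists_rightEquivalent_unfolding {g : (Fin 2 → ℂ) → ℂ}
    (hg : GermSupp ({m | 4 ≤ Finsupp.weight ![1, 2] m} ∩ {m | 3 ≤ Finsupp.weight (fun _ => 1) m})
      (fun z => g z - z 0 ^ 3)) :
    ∃ α β : ℂ → ℂ, AnalyticAt ℂ α 0 ∧ AnalyticAt ℂ β 0 ∧ RightEquivalent g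
      (fun z => z 0 ^ 3 + z 1 ^ 2 * α (z 1) * z 0 + z 1 ^ 3 * β (z 1)) := by
  generalize hw : ![1, 2] = w at hg
  have hw0 : w 0 = 1 := by rw [← hw]; rfl
  have hw1 : w 1 = 2 := by rw [← hw]; rfl
  have hwp : ∀ i, 0 < w i := by
    intro i
    fin_cases i
    · change 0 < w 0
      omega
    · change 0 < w 1
      omega
  -- `w` gives weight two to `y`, so that among the monomials of order at least three only `x³` has
  -- `w`-weight three; `v` keeps track of the order.
  let v : Fin 2 → ℕ := fun _ => 1
  let Ξ := filtTwo w v 2 1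
  let A := supp ({m : Fin 2 →₀ ℕ | m 0 = 0} ∩ {m | 2 ≤ Finsupp.weight v m})
  let B := supp ({m : Fin 2 →₀ ℕ | m 0 = 0} ∩ {m | 3 ≤ Finsupp.weight v m})
  have hA : A ≤ filtTwo w v 4 2 := supp_mono fun m ⟨hm0, hm⟩ => by
    have hm0 : m 0 = 0 := hm0
    refine ⟨?_, hm⟩
    simp only [Set.mem_ofPred_eq, weight_two, v, hm0, hw1] at hm ⊢
    omega
  have hB : B ≤ filtTwo w v 4 3 := supp_mono fun m ⟨hm0, hm⟩ => by
    have hm0 : m 0 = 0 := hm0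
    refine ⟨?_, hm⟩
    simp only [Set.mem_ofPred_eq, weight_two, v, hm0, hw1] at hm ⊢
    omega
  let E := Ξ × (A × B)
  let ξ : E →L[ℂ] AbsSeries 2 := Ξ.subtypeL.comp (ContinuousLinearMap.fst ℂ _ _)
  let α : E →L[ℂ] AbsSeries 2 := A.subtypeL.comp ((ContinuousLinearMap.fst ℂ _ _).comp
    (ContinuousLinearMap.snd ℂ _ _))
  let β : E →L[ℂ] AbsSeries 2 := B.subtypeL.comp ((ContinuousLinearMap.snd ℂ _ _).comp
    (ContinuousLinearMap.snd ℂ _ _))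
  have hX : AbsSeries.X 0 ∈ filtTwo w v 1 1 := by
    simpa only [hw0] using X_mem_filtTwo (w := w) (v := v) 0
  have hΘ := contDiffAt_unfolding (E := E) (AbsSeries.X 0 : AbsSeries 2) ξ α β
  have h3 : ∀ u : E, ((AbsSeries.X 0 + ξ u) ^ 3 + α u * (AbsSeries.X 0 + ξ u) + β u) -
      ((AbsSeries.X 0 + ξ 0) ^ 3 + α 0 * (AbsSeries.X 0 + ξ 0) + β 0) ∈ filtTwo w v 4 3 := by
    intro u
    have hξ : ξ u ∈ filtTwo w v 1 1 := filtTwo_anti (by omega) le_rfl u.1.2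
    rw [map_zero, map_zero, map_zero, show (AbsSeries.X 0 + ξ u) ^ 3 +
      α u * (AbsSeries.X 0 + ξ u) + β u - ((AbsSeries.X 0 + 0) ^ 3 + 0 * (AbsSeries.X 0 + 0) + 0) =
      (3 * AbsSeries.X 0 ^ 2 + 3 * AbsSeries.X 0 * ξ u + ξ u ^ 2) * ξ u +
        α u * (AbsSeries.X 0 + ξ u) + β u by ring]
    refine add_mem (add_mem ?_ ?_) (hB u.2.2.2)
    · refine filtTwo_anti (d' := 2 * 1 + 2) (e' := 2 * 1 + 1) (by omega) (by omega)
        (mul_mem_filtTwo (add_mem (add_mem (mul_mem_filtTwo_left _ (pow_mem_filtTwo hX 2)) ?_)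
          (pow_mem_filtTwo hξ 2)) u.1.2)
      rw [mul_assoc]
      exact mul_mem_filtTwo_left _ (mul_mem_filtTwo (d := 1) (e := 1) hX hξ)
    · exact filtTwo_anti (by omega) (by omega) (mul_mem_filtTwo (hA u.2.1.2) (add_mem hX hξ))
  obtain ⟨t, ht, u, hu, huz⟩ := exists_scale_eq_eval hwp (d := 3) (fun m hm => hm.1) hΘ h3
    (fun h hh => by
      -- The linearized equation `3x²ξ + αx + β = h` is division by `x²`, with remainder of degree
      -- at most one in `x`.
      obtain ⟨h₀, hh₀, h', hh', rfl⟩ := exists_eq_add_X_mul_of_supp hh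
      obtain ⟨h₁, hh₁, q, hq, rfl⟩ := exists_eq_add_X_mul_of_supp hh'
      have hq' : q ∈ Ξ := by
        refine supp_mono ?_ hq
        rintro m ⟨hm1, hm2⟩
        simp [weight_two, hw0, hw1, v] at hm1 hm2 ⊢
        omega
      have hh₁' : h₁ ∈ A := by
        refine supp_mono ?_ hh₁
        rintro m ⟨hm0, hm1, hm2⟩
        refine ⟨hm0, ?_⟩
        simp [weight_two, v] at hm2 ⊢
        omega
      have hh₀' : h₀ ∈ B := by
        refine supp_mono ?_ hh₀
        rintro m ⟨hm0, hm1, hm2⟩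
        exact ⟨hm0, hm2⟩
      refine ⟨((3 : ℂ)⁻¹ • ⟨q, hq'⟩, ⟨h₁, hh₁'⟩, ⟨h₀, hh₀'⟩), ?_⟩
      refine (hasDerivAt_unfolding (AbsSeries.X 0 : AbsSeries 2) ((3 : ℂ)⁻¹ • q) h₁
        h₀).congr_deriv ?_
      rw [Algebra.smul_def]
      linear_combination (AbsSeries.X 0 ^ 2 * q) * algebraMap_inv_ofNat_mul (n := 2) (N := 3))
    (P := fun z => z 0 ^ 3) (g := g) (fun z hz => by
      rw [← evalHom_apply z hz]
      simp only [map_zero, add_zero, zero_mul, map_pow, evalHom_apply, AbsSeries.eval_X])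
    (fun t z => by
      change (t ^ w 0 * z 0) ^ 3 = _
      rw [hw0, pow_one, mul_pow]) hg (ε := 1 / 2) (by norm_num)
  obtain ⟨α₁, hα₁, hα_eq⟩ := exists_eq_pow_mul_of_supp (N := 2) u.2.1.2 fun k hk hk0 => by
    simpa [weight_two, v, hk0] using hk
  obtain ⟨β₁, hβ₁, hβ_eq⟩ := exists_eq_pow_mul_of_supp (N := 3) u.2.2.2 fun k hk hk0 => by
    simpa [weight_two, v, hk0] using hk
  have hdep : ∀ {a : AbsSeries 2}, a ∈ supp {m | m 0 = 0} → ∀ z : Fin 2 → ℂ,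
      eval z a = eval (fun _ => z 1) a := fun {a} ha z => by
    refine eval_eq_of_supp (Z := {1}) (supp_mono (fun m hm i hi => ?_) ha) (by simp)
    fin_cases i
    · exact hm
    · simp at hi
  have hα₁' := hdep (supp_mono Set.inter_subset_left hα₁)
  have hβ₁' := hdep (supp_mono Set.inter_subset_left hβ₁)
  have han : ∀ (a : AbsSeries 2) (c e : ℂ),
      AnalyticAt ℂ (fun y : ℂ => c * eval (fun _ => e * y) a) 0 := fun a c e => by
    refine analyticAt_const.mul
      (AnalyticAt.comp (g := fun z => eval z a) (f := fun y : ℂ => fun _ : Fin 2 => e * y) ?_ ?_)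
    · simpa [Pi.zero_def] using a.analyticAt_eval
    · exact AnalyticAt.pi fun _ => by fun_prop
  refine ⟨fun y => (t ^ 2)⁻¹ * eval (fun _ => (t ^ 2)⁻¹ * y) α₁,
    fun y => (t ^ 3)⁻¹ * eval (fun _ => (t ^ 2)⁻¹ * y) β₁, han _ _ _, han _ _ _, ?_⟩
  let G : (Fin 2 → ℂ) → ℂ := fun z => z 0 ^ 3 +
    z 1 ^ 2 * ((t ^ 2)⁻¹ * eval (fun _ => (t ^ 2)⁻¹ * z 1) α₁) * z 0 +
    z 1 ^ 3 * ((t ^ 3)⁻¹ * eval (fun _ => (t ^ 2)⁻¹ * z 1) β₁)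
  change RightEquivalent g G
  have e1 : RightEquivalent g (fun z => g fun i => t ^ w i * z i) :=
    .of_scale _ (fun _ => pow_ne_zero _ ht) (Eventually.of_forall fun _ => rfl)
  have e2 : RightEquivalent G (fun z => G fun i => t ^ w i * z i) :=
    .of_scale _ (fun _ => pow_ne_zero _ ht) (Eventually.of_forall fun _ => rfl)
  refine e1.trans (RightEquivalent.symm (e2.trans ?_))
  refine .of_series ![(u.1 : AbsSeries 2), 0] (fun j => ?_) (fun j => ?_) ?_
  · fin_cases j
    · exact coeff_zero_eq_zero (mem_filtTwo.1 u.1.2).1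
    · exact map_zero _
  · fin_cases j
    · exact (norm_fst_le u).trans hu.le
    · change ‖(0 : AbsSeries 2)‖ ≤ _
      simp
  · filter_upwards [Metric.closedBall_mem_nhds (0 : Fin 2 → ℂ) one_pos] with z hz
    have hz : ‖z‖ ≤ 1 := by simpa using hz
    rw [huz z hz]
    have hz0 : eval z (0 : AbsSeries 2) = 0 := by rw [← evalHom_apply z hz, map_zero]
    have hα : eval z (α u) = z 1 ^ 2 * eval (fun _ => z 1) α₁ := by
      rw [← hα₁', ← evalHom_apply z hz, ← evalHom_apply z hz, ← AbsSeries.eval_X z 1,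
        ← evalHom_apply z hz, ← map_pow, ← map_mul]
      exact congrArg _ hα_eq
    have hβ : eval z (β u) = z 1 ^ 3 * eval (fun _ => z 1) β₁ := by
      rw [← hβ₁', ← evalHom_apply z hz, ← evalHom_apply z hz, ← AbsSeries.eval_X z 1,
        ← evalHom_apply z hz, ← map_pow, ← map_mul]
      exact congrArg _ hβ_eq
    have hsum : AbsSeries.eval z ((AbsSeries.X 0 + ξ u) ^ 3 + α u * (AbsSeries.X 0 + ξ u) + β u) =
        (z 0 + eval z (ξ u)) ^ 3 + z 1 ^ 2 * eval (fun _ => z 1) α₁ * (z 0 + eval z (ξ u)) +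
          z 1 ^ 3 * eval (fun _ => z 1) β₁ := by
      rw [← hα, ← hβ]
      rw [← evalHom_apply z hz]
      simp only [map_add, map_mul, map_pow, evalHom_apply, AbsSeries.eval_X]
    rw [hsum]
    simp only [G, hw0, hw1, Matrix.cons_val_zero, Matrix.cons_val_one, Matrix.cons_val_fin_one,
      hz0, add_zero, pow_one, inv_mul_cancel_left₀ (pow_ne_zero 2 ht)]
    change _ = t ^ 3 * ((z 0 + eval z (u.1 : AbsSeries 2)) ^ 3 +
      z 1 ^ 2 * eval (fun _ => z 1) α₁ * (z 0 + eval z (u.1 : AbsSeries 2)) + _)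
    field_simp

/-! ### Germs in one variable -/

/-- The root is `s * exp (log (γ / γ 0) / m)`, where the quotient takes the value one at the origin
and stays off the cut of the logarithm nearby. -/
theorem exists_analyticAt_pow_eq {γ : ℂ → ℂ} (hγ : AnalyticAt ℂ γ 0) (h0 : γ 0 ≠ 0) {m : ℕ}
    (hm : m ≠ 0) {s : ℂ} (hs : s ^ m = γ 0) :
    ∃ σ : ℂ → ℂ, AnalyticAt ℂ σ 0 ∧ σ 0 = s ∧ ∀ᶠ y in 𝓝 0, σ y ^ m = γ y := by
  have hq : AnalyticAt ℂ (fun y => γ y / γ 0) 0 := hγ.div analyticAt_const h0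
  have hlog : AnalyticAt ℂ (fun y => Complex.log (γ y / γ 0)) 0 := hq.clog (by simp [h0])
  refine ⟨fun y => s * Complex.exp (Complex.log (γ y / γ 0) / m), ?_, by simp [h0], ?_⟩
  · exact analyticAt_const.mul (hlog.div analyticAt_const (by exact_mod_cast hm)).cexp'
  · filter_upwards [hγ.continuousAt.eventually_ne h0] with y hy
    rw [mul_pow, hs, ← Complex.exp_nat_mul, mul_div_cancel₀ _ (by exact_mod_cast hm),
      Complex.exp_log (div_ne_zero hy h0), mul_div_cancel₀ _ h0]

theorem exists_eq_mul_of_apply_zero {f : ℂ → ℂ} (hf : AnalyticAt ℂ f 0) (h0 : f 0 = 0) :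
    ∃ g : ℂ → ℂ, AnalyticAt ℂ g 0 ∧ ∀ᶠ y in 𝓝 0, f y = y * g y := by
  have h : ((1 : ℕ) : ℕ∞) ≤ analyticOrderAt f 0 := by
    rw [Nat.cast_one, Order.one_le_iff_ne_zero]
    exact analyticOrderAt_ne_zero.2 ⟨hf, h0⟩
  simpa using (natCast_le_analyticOrderAt hf).1 h

theorem exists_eq_pow_mul_ne_zero {f : ℂ → ℂ} (hf : AnalyticAt ℂ f 0)
    (h0 : ¬ ∀ᶠ y in 𝓝 0, f y = 0) :
    ∃ (n : ℕ) (g : ℂ → ℂ), AnalyticAt ℂ g 0 ∧ g 0 ≠ 0 ∧ ∀ᶠ y in 𝓝 0, f y = y ^ n * g y := by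
  simpa using hf.exists_eventuallyEq_pow_smul_nonzero_iff.2 h0

/-- Without a maximal `k`, both germs would be divisible by all powers of `y`, hence zero. Giving
`x` weight `k + 1` and `y` weight one matches the exponents `2k` and `3k`, after the factors `y²`
and `y³`, with `x³`. -/
theorem exists_maximal_order {α β : ℂ → ℂ} (hα : AnalyticAt ℂ α 0) (hβ : AnalyticAt ℂ β 0)
    (h0 : ¬ ((∀ᶠ y in 𝓝 0, α y = 0) ∧ ∀ᶠ y in 𝓝 0, β y = 0)) :
    ∃ (k : ℕ) (α' β' : ℂ → ℂ), AnalyticAt ℂ α' 0 ∧ AnalyticAt ℂ β' 0 ∧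
      (∀ᶠ y in 𝓝 0, α y = y ^ (2 * k) * α' y) ∧ (∀ᶠ y in 𝓝 0, β y = y ^ (3 * k) * β' y) ∧
      ¬ ∃ α'' β'' : ℂ → ℂ, AnalyticAt ℂ α'' 0 ∧ AnalyticAt ℂ β'' 0 ∧
        (∀ᶠ y in 𝓝 0, α' y = y ^ 2 * α'' y) ∧ ∀ᶠ y in 𝓝 0, β' y = y ^ 3 * β'' y := by
  by_contra! H
  have h : ∀ k : ℕ, ∃ α' β' : ℂ → ℂ, AnalyticAt ℂ α' 0 ∧ AnalyticAt ℂ β' 0 ∧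
      (∀ᶠ y in 𝓝 0, α y = y ^ (2 * k) * α' y) ∧ ∀ᶠ y in 𝓝 0, β y = y ^ (3 * k) * β' y := by
    intro k
    induction k with
    | zero => exact ⟨α, β, hα, hβ, by simp, by simp⟩
    | succ k ih =>
      obtain ⟨α', β', hα', hβ', h1, h2⟩ := ih
      obtain ⟨α'', β'', hα'', hβ'', h3, h4⟩ := H k α' β' hα' hβ' h1 h2
      refine ⟨α'', β'', hα'', hβ'', ?_, ?_⟩
      · filter_upwards [h1, h3] with y h1 h3
        rw [h1, h3]
        ring
      · filter_upwards [h2, h4] with y h2 h4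
        rw [h2, h4]
        ring
  refine h0 ⟨analyticOrderAt_eq_top.1 (ENat.eq_top_iff_forall_ge.2 fun k => ?_),
    analyticOrderAt_eq_top.1 (ENat.eq_top_iff_forall_ge.2 fun k => ?_)⟩
  · obtain ⟨α', -, hα', -, h1, -⟩ := h k
    refine le_trans ?_ ((natCast_le_analyticOrderAt hα (n := 2 * k)).2 ⟨α', hα', by simpa using h1⟩)
    exact_mod_cast (by omega : k ≤ 2 * k)
  · obtain ⟨-, β', -, hβ', -, h1⟩ := h k
    refine le_trans ?_ ((natCast_le_analyticOrderAt hβ (n := 3 * k)).2 ⟨β', hβ', by simpa using h1⟩)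
    exact_mod_cast (by omega : k ≤ 3 * k)

theorem exists_left_inverse {u : ℂ → ℂ} (hu : AnalyticAt ℂ u 0) (h0 : u 0 = 0)
    (hu' : deriv u 0 ≠ 0) :
    ∃ v : ℂ → ℂ, AnalyticAt ℂ v 0 ∧ v 0 = 0 ∧ (∀ᶠ y in 𝓝 0, v (u y) = y) ∧
      ∀ᶠ y in 𝓝 0, u (v y) = y := by
  have h1 := hu.analyticAt_localInverse hu'
  have h2 := HasStrictFDerivAt.eventually_left_inverse
    (f' := ContinuousLinearEquiv.unitsEquivAut ℂ (.mk0 _ hu')) hu.hasStrictDerivAt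
  have h3 := HasStrictFDerivAt.eventually_right_inverse
    (f' := ContinuousLinearEquiv.unitsEquivAut ℂ (.mk0 _ hu')) hu.hasStrictDerivAt
  rw [h0] at h1 h3
  refine ⟨_, h1, ?_, h2, h3⟩
  have := h2.self_of_nhds
  rwa [h0] at this

/-! ### Elementary coordinate changes in two variables -/

theorem analyticAt_comp_coord {γ : ℂ → ℂ} (hγ : AnalyticAt ℂ γ 0) {n : ℕ} (i : Fin n) :
    AnalyticAt ℂ (fun z : Fin n → ℂ => γ (z i)) 0 :=
  AnalyticAt.comp (g := γ) (f := fun z : Fin n → ℂ => z i) hγ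
    ((ContinuousLinearMap.proj (R := ℂ) (φ := fun _ : Fin n => ℂ) i).analyticAt 0)

theorem eventually_coord {n : ℕ} {p : ℂ → Prop} (h : ∀ᶠ y in 𝓝 0, p y) (i : Fin n) :
    ∀ᶠ z : Fin n → ℂ in 𝓝 0, p (z i) := by
  have : Tendsto (fun z : Fin n → ℂ => z i) (𝓝 0) (𝓝 0) :=
    (continuous_apply i).tendsto (0 : Fin n → ℂ)
  exact this.eventually h

theorem analyticAt_fin_two {f g : (Fin 2 → ℂ) → ℂ} (hf : AnalyticAt ℂ f 0)
    (hg : AnalyticAt ℂ g 0) : AnalyticAt ℂ (fun z => (![f z, g z] : Fin 2 → ℂ)) 0 := by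
  refine AnalyticAt.pi fun i => ?_
  fin_cases i
  · exact hf
  · exact hg

theorem RightEquivalent.shift {τ : ℂ → ℂ} (hτ : AnalyticAt ℂ τ 0) (h0 : τ 0 = 0)
    (g : (Fin 2 → ℂ) → ℂ) : RightEquivalent g (fun z => g ![z 0 + τ (z 1), z 1]) := by
  have hc : ∀ i : Fin 2, AnalyticAt ℂ (fun z : Fin 2 → ℂ => z i) 0 := fun i =>
    (ContinuousLinearMap.proj (R := ℂ) (φ := fun _ : Fin 2 => ℂ) i).analyticAt 0
  refine ⟨fun z => ![z 0 + τ (z 1), z 1], fun z => ![z 0 - τ (z 1), z 1],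
    analyticAt_fin_two ((hc 0).add (analyticAt_comp_coord hτ 1)) (hc 1),
    analyticAt_fin_two ((hc 0).sub (analyticAt_comp_coord hτ 1)) (hc 1), ?_, ?_, ?_, ?_,
    Eventually.of_forall fun _ => rfl⟩
  · funext i
    fin_cases i <;> simp [h0]
  · funext i
    fin_cases i <;> simp [h0]
  · refine Eventually.of_forall fun z => ?_
    funext i
    fin_cases i <;> simp
  · refine Eventually.of_forall fun z => ?_
    funext i
    fin_cases i <;> simp

theorem RightEquivalent.comp_second {u : ℂ → ℂ} (hu : AnalyticAt ℂ u 0) (h0 : u 0 = 0)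
    (hu' : deriv u 0 ≠ 0) (g : (Fin 2 → ℂ) → ℂ) :
    RightEquivalent g (fun z => g ![z 0, u (z 1)]) := by
  have hc : ∀ i : Fin 2, AnalyticAt ℂ (fun z : Fin 2 → ℂ => z i) 0 := fun i =>
    (ContinuousLinearMap.proj (R := ℂ) (φ := fun _ : Fin 2 => ℂ) i).analyticAt 0
  obtain ⟨v, hv, hv0, hvu, huv⟩ := exists_left_inverse hu h0 hu'
  refine ⟨fun z => ![z 0, u (z 1)], fun z => ![z 0, v (z 1)],
    analyticAt_fin_two (hc 0) (analyticAt_comp_coord hu 1),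
    analyticAt_fin_two (hc 0) (analyticAt_comp_coord hv 1), ?_, ?_, ?_, ?_,
    Eventually.of_forall fun _ => rfl⟩
  · funext i
    fin_cases i <;> simp [h0]
  · funext i
    fin_cases i <;> simp [hv0]
  · filter_upwards [eventually_coord hvu 1] with z hz
    funext i
    fin_cases i <;> simp [hz]
  · filter_upwards [eventually_coord huv 1] with z hz
    funext i
    fin_cases i <;> simp [hz]

theorem RightEquivalent.scale_two {c d : ℂ} (hc : c ≠ 0) (hd : d ≠ 0) (g : (Fin 2 → ℂ) → ℂ) :
    RightEquivalent g (fun z => g ![c * z 0, d * z 1]) := by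
  refine .of_scale ![c, d] (fun i => ?_) (Eventually.of_forall fun z => ?_)
  · fin_cases i
    · exact hc
    · exact hd
  · congr 1
    funext i
    fin_cases i <;> rfl

theorem WeightGE.comp_coord {w : Fin 2 → ℕ} {γ : ℂ → ℂ} (hγ : AnalyticAt ℂ γ 0) (i : Fin 2) :
    WeightGE w 0 (fun z => γ (z i)) :=
  .of_analyticAt w (analyticAt_comp_coord hγ i)

theorem WeightGE.comp_coord_sub {w : Fin 2 → ℕ} (hw : ∀ i, 0 < w i) {γ : ℂ → ℂ}
    (hγ : AnalyticAt ℂ γ 0) (i : Fin 2) : WeightGE w 1 (fun z => γ (z i) - γ 0) :=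
  .of_apply_zero hw ((analyticAt_comp_coord hγ i).sub analyticAt_const) (by simp)

theorem exists_pow_mul_eq_one {c : ℂ} (hc : c ≠ 0) {m : ℕ} (hm : 0 < m) :
    ∃ l : ℂ, l ≠ 0 ∧ l ^ m * c = 1 := by
  obtain ⟨l, hl⟩ := IsAlgClosed.exists_pow_nat_eq c⁻¹ hm
  refine ⟨l, fun h => ?_, by rw [hl, inv_mul_cancel₀ hc]⟩
  rw [h, zero_pow hm.ne'] at hl
  exact inv_ne_zero hc hl.symm

theorem eventually_scale_two {p : (Fin 2 → ℂ) → Prop} (h : ∀ᶠ z in 𝓝 0, p z) (c d : ℂ) :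
    ∀ᶠ z : Fin 2 → ℂ in 𝓝 0, p ![c * z 0, d * z 1] := by
  have : Tendsto (fun z : Fin 2 → ℂ => (![c * z 0, d * z 1] : Fin 2 → ℂ)) (𝓝 0) (𝓝 0) := by
    have h1 : Continuous (fun z : Fin 2 → ℂ => (![c * z 0, d * z 1] : Fin 2 → ℂ)) := by
      refine continuous_pi fun i => ?_
      fin_cases i
      · exact continuous_const.mul (continuous_apply 0)
      · exact continuous_const.mul (continuous_apply 1)
    convert h1.tendsto 0 using 2
    funext i
    fin_cases i <;> simp
  exact this.eventually h

theorem analyticAt_comp_mul {γ : ℂ → ℂ} (hγ : AnalyticAt ℂ γ 0) (c d : ℂ) :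
    AnalyticAt ℂ (fun y => c * γ (d * y)) 0 := by
  refine analyticAt_const.mul (AnalyticAt.comp (g := γ) (f := fun y => d * y) ?_ (by fun_prop))
  simpa using hγ

/-! ### Classification of the germs `x³ + y² α(y) x + y³ β(y)` -/

section Classification

variable {α β : ℂ → ℂ} {g : (Fin 2 → ℂ) → ℂ} {r : ℕ}

theorem weight_pos {w : Fin 2 → ℕ} (h0 : 0 < w 0) (h1 : 0 < w 1) : ∀ i, 0 < w i := by
  intro i
  fin_cases i
  · exact h0
  · exact h1

/-- Rescaling `y` makes the coefficient of `y^N` equal to one. The rest has higher weight: `y^(j₀)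
x` because `3 * j₀ > 2 * N`, and `y^N (β - β 0)` because of its extra factor. -/
theorem exists_rightEquivalent_of_beta {N j₀ k : ℕ} (hN : N = j₀ + k + 1)
    (h1 : 2 * N + 1 ≤ 3 * j₀) (h2 : 3 * j₀ ≤ 2 * N + 3) (hN4 : 4 ≤ N) (hα : AnalyticAt ℂ α 0)
    (hβ : AnalyticAt ℂ β 0) (hβ0 : β 0 ≠ 0)
    (hg : ∀ᶠ z in 𝓝 0, g z = z 0 ^ 3 + z 1 ^ j₀ * α (z 1) * z 0 + z 1 ^ N * β (z 1)) :
    ∃ a ∈ Polynomial.degreeLT ℂ k, RightEquivalent g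
      (fun z => z 0 ^ 3 + z 1 ^ N + a.eval (z 1) * z 0 * z 1 ^ j₀) := by
  obtain ⟨l, hl0, hl⟩ := exists_pow_mul_eq_one hβ0 (m := N) (by omega)
  have hα' := analyticAt_comp_mul hα (l ^ j₀) l
  have hβ' := analyticAt_comp_mul hβ (l ^ N) l
  obtain ⟨a, ha, h⟩ := exists_rightEquivalent_cube_add_pow hN h1 h2 hN4
    (g := fun z => g ![1 * z 0, l * z 1]) (by
      have e1 : WeightGE ![N, 3] (3 * N + 1) (fun z => z 1 ^ j₀ * (l ^ j₀ * α (l * z 1)) * z 0) :=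
        (((WeightGE.coord _ 1).pow j₀).mul (WeightGE.comp_coord hα' 1) le_rfl).mul
          (WeightGE.coord _ 0) (by simp; omega)
      have e2 : WeightGE ![N, 3] (3 * N + 1) (fun z => z 1 ^ N *
          (l ^ N * β (l * z 1) - l ^ N * β (l * 0))) :=
        ((WeightGE.coord _ 1).pow N).mul (WeightGE.comp_coord_sub
          (weight_pos (by simp; omega) (by simp)) hβ' 1) (by simp; omega)
      refine (e1.add e2).congr ?_
      filter_upwards [eventually_scale_two hg 1 l] with z hz
      rw [hz]
      simp only [Matrix.cons_val_zero, Matrix.cons_val_one, Matrix.cons_val_fin_one]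
      rw [mul_zero, hl]
      ring)
  exact ⟨a, ha, (RightEquivalent.scale_two one_ne_zero hl0 g).trans h⟩

/-- Rescaling `y` normalizes the coefficient of `x y^(2r+1)`; `y^(3r+2)` has weight `6r + 4`, one
more than the principal part. -/
theorem exists_rightEquivalent_of_alpha (hr : 1 ≤ r) (hα : AnalyticAt ℂ α 0) (hα0 : α 0 ≠ 0)
    (hβ : AnalyticAt ℂ β 0)
    (hg : ∀ᶠ z in 𝓝 0, g z =
      z 0 ^ 3 + z 1 ^ (2 * r + 1) * α (z 1) * z 0 + z 1 ^ (3 * r + 2) * β (z 1)) :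
    ∃ a ∈ Polynomial.degreeLT ℂ (r - 1), RightEquivalent g
      (fun z => z 0 ^ 3 + z 0 * z 1 ^ (2 * r + 1) + a.eval (z 1) * z 1 ^ (3 * r + 2)) := by
  obtain ⟨l, hl0, hl⟩ := exists_pow_mul_eq_one hα0 (m := 2 * r + 1) (by omega)
  have hα' := analyticAt_comp_mul hα (l ^ (2 * r + 1)) l
  have hβ' := analyticAt_comp_mul hβ (l ^ (3 * r + 2)) l
  obtain ⟨a, ha, h⟩ := exists_rightEquivalent_cube_add_mul_pow hr
    (g := fun z => g ![1 * z 0, l * z 1]) (by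
      have e1 : WeightGE ![2 * r + 1, 2] (6 * r + 3 + 1) (fun z => z 1 ^ (2 * r + 1) *
          (l ^ (2 * r + 1) * α (l * z 1) - l ^ (2 * r + 1) * α (l * 0)) * z 0) :=
        (((WeightGE.coord _ 1).pow (2 * r + 1)).mul (WeightGE.comp_coord_sub
          (weight_pos (by simp) (by simp)) hα' 1) le_rfl).mul (WeightGE.coord _ 0) (by simp; omega)
      have e2 : WeightGE ![2 * r + 1, 2] (6 * r + 3 + 1) (fun z => z 1 ^ (3 * r + 2) *
          (l ^ (3 * r + 2) * β (l * z 1))) :=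
        ((WeightGE.coord _ 1).pow (3 * r + 2)).mul (WeightGE.comp_coord hβ' 1) (by simp; omega)
      refine (e1.add e2).congr ?_
      filter_upwards [eventually_scale_two hg 1 l] with z hz
      rw [hz]
      simp only [Matrix.cons_val_zero, Matrix.cons_val_one, Matrix.cons_val_fin_one]
      rw [mul_zero, hl]
      ring)
  exact ⟨a, ha, (RightEquivalent.scale_two one_ne_zero hl0 g).trans h⟩

theorem eventually_shift {τ : ℂ → ℂ} (hτ : AnalyticAt ℂ τ 0) (h0 : τ 0 = 0)
    {p : (Fin 2 → ℂ) → Prop} (h : ∀ᶠ z in 𝓝 0, p z) :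
    ∀ᶠ z : Fin 2 → ℂ in 𝓝 0, p ![z 0 + τ (z 1), z 1] := by
  have hc : ∀ i : Fin 2, AnalyticAt ℂ (fun z : Fin 2 → ℂ => z i) 0 := fun i =>
    (ContinuousLinearMap.proj (R := ℂ) (φ := fun _ : Fin 2 => ℂ) i).analyticAt 0
  have h1 := (analyticAt_fin_two ((hc 0).add (analyticAt_comp_coord hτ 1)) (hc 1)).continuousAt
  have h2 : (![(0 : Fin 2 → ℂ) 0 + τ ((0 : Fin 2 → ℂ) 1), (0 : Fin 2 → ℂ) 1] : Fin 2 → ℂ) = 0 := by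
    funext i
    fin_cases i <;> simp [h0]
  have h3 := h1.tendsto
  simp only [Pi.add_apply] at h3
  rw [h2] at h3
  exact h3.eventually h

/-- `s` is a critical point of `x³ + ax + b`. When the discriminant vanishes, the sign of `s` is
chosen so that it is the double root. -/
theorem exists_root_of_derivative {a b : ℂ} : ∃ s : ℂ, a = -3 * s ^ 2 ∧
    (4 * a ^ 3 + 27 * b ^ 2 = 0 → b = 2 * s ^ 3) := by
  obtain ⟨s, hs⟩ := IsAlgClosed.exists_pow_nat_eq (-a / 3) (n := 2) (by norm_num)
  have ha : a = -3 * s ^ 2 := by rw [hs]; ring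
  by_cases h : 4 * a ^ 3 + 27 * b ^ 2 = 0
  · have h2 : (b - 2 * s ^ 3) * (b + 2 * s ^ 3) = 0 := by
      rw [ha] at h
      linear_combination h / 27
    rcases mul_eq_zero.1 h2 with h3 | h3
    · exact ⟨s, ha, fun _ => by linear_combination h3⟩
    · exact ⟨-s, by rw [ha]; ring, fun _ => by linear_combination h3⟩
  · exact ⟨s, ha, fun h' => absurd h' h⟩

/-- Shifting `x` by `s y^r`, with `s` a critical point of the leading cubic, removes the linear term
up to higher weight and leaves the critical value `β 0 - 2s³`, which is nonzero and can be scaled to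
one. -/
theorem exists_rightEquivalent_of_disc_ne_zero (hr : 2 ≤ r) (hα : AnalyticAt ℂ α 0)
    (hβ : AnalyticAt ℂ β 0) (hd : 4 * α 0 ^ 3 + 27 * β 0 ^ 2 ≠ 0)
    (hg : ∀ᶠ z in 𝓝 0, g z = z 0 ^ 3 + z 1 ^ (2 * r) * α (z 1) * z 0 + z 1 ^ (3 * r) * β (z 1)) :
    ∃ b : ℂ, 4 * b ^ 3 + 27 ≠ 0 ∧ ∃ c ∈ Polynomial.degreeLT ℂ (r - 2), RightEquivalent g
      (fun z => z 0 ^ 3 + b * z 0 ^ 2 * z 1 ^ r + z 1 ^ (3 * r) +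
        c.eval (z 1) * z 0 * z 1 ^ (2 * r + 1)) := by
  obtain ⟨s, hs, -⟩ := exists_root_of_derivative (a := α 0) (b := β 0)
  have hd' : (β 0 - 2 * s ^ 3) * (β 0 + 2 * s ^ 3) ≠ 0 := by
    intro h
    rw [hs] at hd
    exact hd (by linear_combination 27 * h)
  obtain ⟨hd1, hd2⟩ := mul_ne_zero_iff.1 hd'
  obtain ⟨l, hl0, hl⟩ := exists_pow_mul_eq_one hd1 (m := 3 * r) (by omega)
  have hτ : AnalyticAt ℂ (fun y : ℂ => s * y ^ r) 0 := by fun_prop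
  have e1 := RightEquivalent.shift hτ (by simp; omega) g
  let α' : ℂ → ℂ := fun y => 3 * s ^ 2 + α y
  let β' : ℂ → ℂ := fun y => s ^ 3 + α y * s + β y
  have hα' : AnalyticAt ℂ α' 0 := by fun_prop
  have hβ' : AnalyticAt ℂ β' 0 := by fun_prop
  have hg' : ∀ᶠ z : Fin 2 → ℂ in 𝓝 0, g ![z 0 + s * z 1 ^ r, z 1] = z 0 ^ 3 +
      3 * s * z 0 ^ 2 * z 1 ^ r + z 1 ^ (2 * r) * α' (z 1) * z 0 + z 1 ^ (3 * r) * β' (z 1) := by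
    filter_upwards [eventually_shift hτ (by simp; omega) hg] with z hz
    rw [hz]
    simp only [Matrix.cons_val_zero, Matrix.cons_val_one, Matrix.cons_val_fin_one, α', β']
    ring
  have hα'' := analyticAt_comp_mul hα' (l ^ (2 * r)) l
  have hβ'' := analyticAt_comp_mul hβ' (l ^ (3 * r)) l
  -- Since `l^(3r) (β 0 - 2s³) = 1`, the left side is `27 l^(3r) (β 0 + 2s³)`, and `β 0 + 2s³` is
  -- the other factor of the discriminant.
  have hb : 4 * (3 * s * l ^ r) ^ 3 + 27 ≠ 0 := by
    have h3 : (l ^ r) ^ 3 * (β 0 - 2 * s ^ 3) = 1 := by rw [← pow_mul, mul_comm r, hl]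
    intro h
    refine hd2 ?_
    linear_combination (β 0 - 2 * s ^ 3) / 27 * h - 4 * s ^ 3 * h3
  refine ⟨3 * s * l ^ r, hb, ?_⟩
  · obtain ⟨c, hc, h⟩ := exists_rightEquivalent_J_zero hr hb (g := fun z => (fun z : Fin 2 → ℂ => g ![z 0 + s * z 1 ^ r, z 1]) ![1 * z 0, l * z 1]) (by
      have e1 : WeightGE ![r, 1] (3 * r + 1) (fun z => z 1 ^ (2 * r) *
          (l ^ (2 * r) * α' (l * z 1) - l ^ (2 * r) * α' (l * 0)) * z 0) :=
        (((WeightGE.coord _ 1).pow (2 * r)).mul (WeightGE.comp_coord_sub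
          (weight_pos (by simp; omega) (by simp)) hα'' 1) le_rfl).mul (WeightGE.coord _ 0) (by simp; omega)
      have e2 : WeightGE ![r, 1] (3 * r + 1) (fun z => z 1 ^ (3 * r) *
          (l ^ (3 * r) * β' (l * z 1) - l ^ (3 * r) * β' (l * 0))) :=
        ((WeightGE.coord _ 1).pow (3 * r)).mul (WeightGE.comp_coord_sub
          (weight_pos (by simp; omega) (by simp)) hβ'' 1) (by simp)
      refine (e1.add e2).congr ?_
      filter_upwards [eventually_scale_two hg' 1 l] with z hz
      rw [hz]
      simp only [Matrix.cons_val_zero, Matrix.cons_val_one, Matrix.cons_val_fin_one]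
      have e3 : α' (l * 0) = 0 := by simp [α', hs]
      have e4 : β' (l * 0) = β 0 - 2 * s ^ 3 := by simp only [β', mul_zero, hs]; ring
      rw [e3, e4, hl]
      ring)
    exact ⟨c, hc, (e1.trans (RightEquivalent.scale_two one_ne_zero hl0 _)).trans h⟩

theorem RightEquivalent.swap (g : (Fin 2 → ℂ) → ℂ) : RightEquivalent g (fun z => g ![z 1, z 0]) := by
  have hc : ∀ i : Fin 2, AnalyticAt ℂ (fun z : Fin 2 → ℂ => z i) 0 := fun i =>
    (ContinuousLinearMap.proj (R := ℂ) (φ := fun _ : Fin 2 => ℂ) i).analyticAt 0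
  refine ⟨fun z => ![z 1, z 0], fun z => ![z 1, z 0], analyticAt_fin_two (hc 1) (hc 0),
    analyticAt_fin_two (hc 1) (hc 0), ?_, ?_, ?_, ?_, Eventually.of_forall fun _ => rfl⟩
  · funext i
    fin_cases i <;> rfl
  · funext i
    fin_cases i <;> rfl
  · refine Eventually.of_forall fun z => ?_
    funext i
    fin_cases i <;> rfl
  · refine Eventually.of_forall fun z => ?_
    funext i
    fin_cases i <;> rfl

/-- A cubic form with three distinct roots gives a singularity of type `D₄`. -/
theorem rightEquivalent_D_four (hα : AnalyticAt ℂ α 0) (hβ : AnalyticAt ℂ β 0)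
    (hd : 4 * α 0 ^ 3 + 27 * β 0 ^ 2 ≠ 0)
    (hg : ∀ᶠ z in 𝓝 0, g z = z 0 ^ 3 + z 1 ^ 2 * α (z 1) * z 0 + z 1 ^ 3 * β (z 1)) :
    RightEquivalent g (fun z => z 0 ^ 2 * z 1 + z 1 ^ 3) := by
  obtain ⟨ρ, hρ⟩ : ∃ ρ : ℂ, ρ ^ 3 + α 0 * ρ + β 0 = 0 := by
    let p : ℂ[X] := Polynomial.X ^ 3 + Polynomial.C (α 0) * Polynomial.X + Polynomial.C (β 0)
    have hp : p.degree = 3 := by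
      simp only [p]
      compute_degree!
    obtain ⟨ρ, hρ⟩ := IsAlgClosed.exists_root p (by rw [hp]; norm_num)
    exact ⟨ρ, by simpa [p, Polynomial.IsRoot] using hρ⟩
  -- This is the discriminant expressed through the root `ρ`: the first factor says that `ρ` is
  -- simple, the second that the residual quadratic has distinct roots.
  have hfac : (3 * ρ ^ 2 + α 0) ^ 2 * (3 * ρ ^ 2 + 4 * α 0) ≠ 0 := by
    have hb : β 0 = -ρ ^ 3 - α 0 * ρ := by linear_combination hρ
    rw [hb] at hd
    intro h
    exact hd (by linear_combination h)
  obtain ⟨he, he'⟩ := mul_ne_zero_iff.1 hfac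
  generalize hedef : 3 * ρ ^ 2 + α 0 = e at he
  have he0 : e ≠ 0 := fun h => he (by rw [h]; ring)
  have he1 : 1 - 9 * ρ ^ 2 / (4 * e) ≠ 0 := by
    intro h
    refine he' ?_
    field_simp at h
    linear_combination h + 4 * hedef
  obtain ⟨l, hl0, hl⟩ := exists_pow_mul_eq_one he1 (m := 3) (by norm_num)
  obtain ⟨m, hm0, hm⟩ := exists_pow_mul_eq_one (mul_ne_zero he0 hl0) (m := 2) (by norm_num)
  -- After the shift by `ρ y` the cubic form is `u(u² + 3ρuy + ey²)`; completing the square gives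
  -- `u(e(y + κu)² + (1 - eκ²)u²)`. The swap makes `u` the second coordinate, and `m`, `l` normalize
  -- the coefficients.
  let κ := 3 * ρ / (2 * e)
  have hκ : κ * (2 * e) = 3 * ρ := div_mul_cancel₀ _ (by simpa using he0)
  have e1 := RightEquivalent.shift (τ := fun y => ρ * y) (by fun_prop) (by simp) g
  have e2 := e1.trans (RightEquivalent.swap _)
  have e3 := e2.trans (RightEquivalent.shift (τ := fun y => -κ * y) (by fun_prop) (by simp) _)
  have e4 := e3.trans (RightEquivalent.scale_two hm0 hl0 _)
  refine e4.trans (exists_rightEquivalent_D le_rfl ?_)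
  simp only [Matrix.cons_val_zero, Matrix.cons_val_one, Matrix.cons_val_fin_one]
  let Y : (Fin 2 → ℂ) → ℂ := fun z => m * z 0 + -κ * (l * z 1)
  let U : (Fin 2 → ℂ) → ℂ := fun z => l * z 1 + ρ * Y z
  have hw : ∀ i, 0 < (![3 - 1, 2] : Fin 2 → ℕ) i := weight_pos (by simp) (by simp)
  have hw0 : WeightGE ![3 - 1, 2] 2 (fun z : Fin 2 → ℂ => z 0) := WeightGE.coord ![3 - 1, 2] 0
  have hw1 : WeightGE ![3 - 1, 2] 2 (fun z : Fin 2 → ℂ => z 1) := WeightGE.coord ![3 - 1, 2] 1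
  have hYw : WeightGE ![3 - 1, 2] 2 Y :=
    (hw0.const_mul m).add ((hw1.const_mul l).const_mul (-κ))
  have hUw : WeightGE ![3 - 1, 2] 2 U :=
    (hw1.const_mul l).add (hYw.const_mul ρ)
  have hYa : AnalyticAt ℂ Y 0 := hYw.analyticAt
  have hY0 : Y 0 = 0 := by simp [Y]
  have hcomp : ∀ {γ : ℂ → ℂ}, AnalyticAt ℂ γ 0 →
      WeightGE ![3 - 1, 2] 1 (fun z => γ (Y z) - γ 0) := fun {γ} hγ => by
    refine .of_apply_zero hw ((AnalyticAt.comp (g := γ) (f := Y) ?_ hYa).sub analyticAt_const) ?_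
    · rwa [hY0]
    · simp [hY0]
  have h1 : WeightGE ![3 - 1, 2] (2 * 3 + 1) (fun z => Y z ^ 2 * (α (Y z) - α 0) * U z) :=
    ((hYw.pow 2).mul (hcomp hα) le_rfl).mul hUw (by norm_num)
  have h2 : WeightGE ![3 - 1, 2] (2 * 3 + 1) (fun z => Y z ^ 3 * (β (Y z) - β 0)) :=
    (hYw.pow 3).mul (hcomp hβ) (by norm_num)
  refine (h1.add h2).congr ?_
  have hUY : Tendsto (fun z => (![U z, Y z] : Fin 2 → ℂ)) (𝓝 0) (𝓝 0) := by
    have := (analyticAt_fin_two hUw.analyticAt hYa).continuousAt.tendsto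
    have h0 : (![U 0, Y 0] : Fin 2 → ℂ) = 0 := by
      funext i
      fin_cases i <;> simp [U, hY0]
    rwa [h0] at this
  filter_upwards [hUY.eventually hg] with z hz
  have hz' : g ![l * z 1 + ρ * (m * z 0 + -κ * (l * z 1)), m * z 0 + -κ * (l * z 1)] =
    U z ^ 3 + Y z ^ 2 * α (Y z) * U z + Y z ^ 3 * β (Y z) := hz
  rw [hz']
  have hκ2 : κ ^ 2 * e * 4 * e = 9 * ρ ^ 2 := by
    linear_combination (κ * (2 * e) + 3 * ρ) * hκ
  have hE : (1 - 9 * ρ ^ 2 / (4 * e)) = 1 - e * κ ^ 2 := by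
    rw [← hκ2]
    field_simp
  rw [hE] at hl
  have key : U z ^ 3 + Y z ^ 2 * α 0 * U z + Y z ^ 3 * β 0 = z 0 ^ 2 * z 1 + z 1 ^ 3 := by
    have hYz : Y z = m * z 0 - κ * (l * z 1) := by simp only [Y]; ring
    have hUz : U z = l * z 1 + ρ * Y z := rfl
    have hb : β 0 = -ρ ^ 3 - α 0 * ρ := by linear_combination hρ
    have ha : α 0 = e - 3 * ρ ^ 2 := by linear_combination hedef
    rw [hUz, hb, ha, hYz]
    linear_combination (-(l * z 1) ^ 2 * (m * z 0) + κ * (l * z 1) ^ 3) * hκ + z 1 ^ 3 * hl +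
      z 0 ^ 2 * z 1 * hm
  linear_combination key

theorem not_isolated_of_line {n : ℕ} {f : (Fin n → ℂ) → ℂ} {v : Fin n → ℂ} (hv : v ≠ 0)
    (h : ∀ᶠ t : ℂ in 𝓝 0, f (t • v) = 0 ∧ fderiv ℂ f (t • v) = 0) :
    ¬ ∀ᶠ x in 𝓝[≠] (0 : Fin n → ℂ), f x = 0 → fderiv ℂ f x ≠ 0 := by
  intro hi
  have ht : Tendsto (fun t : ℂ => t • v) (𝓝[≠] 0) (𝓝[≠] 0) := by
    refine tendsto_nhdsWithin_iff.2 ⟨?_, ?_⟩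
    · have : ContinuousAt (fun t : ℂ => t • v) 0 := by fun_prop
      have h1 := this.tendsto
      rw [zero_smul] at h1
      exact h1.mono_left nhdsWithin_le_nhds
    · filter_upwards [self_mem_nhdsWithin] with t ht
      exact smul_ne_zero ht hv
  obtain ⟨t, h1, h2⟩ := ((ht.eventually hi).and (h.filter_mono nhdsWithin_le_nhds)).exists
  exact h1 h2.1 h2.2

/-- A germ divisible by `x²` is singular along the whole line `x = 0`. -/
theorem not_isolated_of_eq_sq_mul {h : (Fin 2 → ℂ) → ℂ} (hh : AnalyticAt ℂ h 0)
    (hg : ∀ᶠ z in 𝓝 0, g z = z 0 ^ 2 * h z) :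
    ¬ ∀ᶠ x in 𝓝[≠] (0 : Fin 2 → ℂ), g x = 0 → fderiv ℂ g x ≠ 0 := by
  refine not_isolated_of_line (v := Pi.single 1 1) (by simp) ?_
  have ht : Tendsto (fun t : ℂ => t • (Pi.single 1 1 : Fin 2 → ℂ)) (𝓝 0) (𝓝 0) := by
    have : ContinuousAt (fun t : ℂ => t • (Pi.single 1 1 : Fin 2 → ℂ)) 0 := by fun_prop
    have h1 := this.tendsto
    rwa [zero_smul] at h1
  filter_upwards [ht.eventually (hg.eventually_nhds.and hh.eventually_analyticAt)] with t h2
  obtain ⟨h2, h3⟩ := h2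
  refine ⟨by rw [h2.self_of_nhds]; simp, ?_⟩
  rw [EventuallyEq.fderiv_eq (f := fun z : Fin 2 → ℂ => z 0 ^ 2 * h z) h2]
  have h4 : HasFDerivAt (fun z : Fin 2 → ℂ => z 0 ^ 2) _ (t • Pi.single 1 1) :=
    (ContinuousLinearMap.proj (R := ℂ) (φ := fun _ : Fin 2 => ℂ) 0).hasFDerivAt.pow 2
  refine (h4.mul h3.differentiableAt.hasFDerivAt).fderiv.trans ?_
  ext w
  simp

/-- Elimination of the linear term when the cubic form has a double root. -/
theorem exists_rightEquivalent_of_disc_eq_zero (hr : 1 ≤ r) (hα : AnalyticAt ℂ α 0)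
    (hβ : AnalyticAt ℂ β 0) (hd : 4 * α 0 ^ 3 + 27 * β 0 ^ 2 = 0) (h0 : ¬ (α 0 = 0 ∧ β 0 = 0))
    (hg : ∀ᶠ z in 𝓝 0, g z = z 0 ^ 3 + z 1 ^ (2 * r) * α (z 1) * z 0 + z 1 ^ (3 * r) * β (z 1))
    (hi : ∀ᶠ x in 𝓝[≠] (0 : Fin 2 → ℂ), g x = 0 → fderiv ℂ g x ≠ 0) :
    ∃ i : ℕ, 1 ≤ i ∧ ∃ b : ℂ → ℂ, AnalyticAt ℂ b 0 ∧ b 0 ≠ 0 ∧ RightEquivalent g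
      (fun z => z 0 ^ 3 + z 0 ^ 2 * z 1 ^ r + b (z 1) * z 1 ^ (3 * r + i)) := by
  obtain ⟨s, hs, hs'⟩ := exists_root_of_derivative (a := α 0) (b := β 0)
  specialize hs' hd
  have hs0 : s ≠ 0 := by
    rintro rfl
    exact h0 ⟨by simpa using hs, by simpa using hs'⟩
  -- With `σ² = -α/3`, the curve `x = σ(y) y^r` consists of critical points in `x`, so the shift
  -- along it removes the linear term for all `y` at once.
  obtain ⟨σ, hσ, hσ0, hσ2⟩ := exists_analyticAt_pow_eq (γ := fun y => -α y / 3) (by fun_prop)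
    (by rw [hs]; simpa using hs0) two_ne_zero (s := s) (by rw [hs]; ring)
  have hτ : AnalyticAt ℂ (fun y : ℂ => σ y * y ^ r) 0 := by fun_prop
  have e1 := RightEquivalent.shift hτ (by simp; omega) g
  let c : ℂ → ℂ := fun y => β y - 2 * σ y ^ 3
  have hc : AnalyticAt ℂ c 0 := by fun_prop
  have hg' : ∀ᶠ z : Fin 2 → ℂ in 𝓝 0, g ![z 0 + σ (z 1) * z 1 ^ r, z 1] = z 0 ^ 3 +
      3 * σ (z 1) * z 1 ^ r * z 0 ^ 2 + z 1 ^ (3 * r) * c (z 1) := by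
    filter_upwards [eventually_shift hτ (by simp; omega) hg, eventually_coord hσ2 1] with z hz h2
    rw [hz]
    have h3 : α (z 1) = -3 * σ (z 1) ^ 2 := by rw [h2]; ring
    simp only [Matrix.cons_val_zero, Matrix.cons_val_one, Matrix.cons_val_fin_one, c, h3]
    ring
  -- Otherwise `x²` would divide the shifted germ, against isolatedness.
  have hc0 : ¬ ∀ᶠ y in 𝓝 0, c y = 0 := by
    intro hcz
    have hga : AnalyticAt ℂ g 0 := by
      refine AnalyticAt.congr (f := fun z => z 0 ^ 3 + z 1 ^ (2 * r) * α (z 1) * z 0 +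
        z 1 ^ (3 * r) * β (z 1)) ?_ (hg.mono fun z hz => hz.symm)
      have h0 : AnalyticAt ℂ (fun z : Fin 2 → ℂ => z 0) 0 := analyticAt_comp_coord analyticAt_id 0
      have h1 : AnalyticAt ℂ (fun z : Fin 2 → ℂ => z 1) 0 := analyticAt_comp_coord analyticAt_id 1
      have h2 := analyticAt_comp_coord (i := (1 : Fin 2)) hα
      have h3 := analyticAt_comp_coord (i := (1 : Fin 2)) hβ
      exact (((h0.pow 3).add (((h1.pow _).mul h2).mul h0))).add ((h1.pow _).mul h3)
    refine not_isolated_of_eq_sq_mul (h := fun z => z 0 + 3 * σ (z 1) * z 1 ^ r) ?_ ?_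
      (e1.isolated hga hi)
    · have h0 : AnalyticAt ℂ (fun z : Fin 2 → ℂ => z 0) 0 := analyticAt_comp_coord analyticAt_id 0
      have h1 : AnalyticAt ℂ (fun z : Fin 2 → ℂ => z 1) 0 := analyticAt_comp_coord analyticAt_id 1
      exact h0.add ((analyticAt_const.mul (analyticAt_comp_coord hσ 1)).mul (h1.pow r))
    · filter_upwards [hg', eventually_coord hcz 1] with z hz hz'
      rw [hz, hz']
      ring
  obtain ⟨i, c₁, hc₁, hc₁0, hc_eq⟩ := exists_eq_pow_mul_ne_zero hc hc0
  have hi1 : 1 ≤ i := by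
    rcases Nat.eq_zero_or_pos i with rfl | h
    · have h1 := hc_eq.self_of_nhds
      simp only [pow_zero, one_mul, c, hσ0, hs', sub_self] at h1
      exact absurd h1.symm hc₁0
    · exact h
  obtain ⟨q, hq⟩ := IsAlgClosed.exists_pow_nat_eq (3 * σ 0) (n := r) (by omega)
  -- In the new coordinate `yθ(y)` the coefficient `3σ(y) y^r` becomes a pure `r`-th power.
  obtain ⟨θ, hθ, hθ0, hθr⟩ := exists_analyticAt_pow_eq (γ := fun y => 3 * σ y) (by fun_prop)
    (by simpa [hσ0] using hs0) (by omega) hq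
  have hq0 : θ 0 ≠ 0 := by
    rw [hθ0]
    rintro rfl
    rw [zero_pow (by omega), hσ0] at hq
    exact hs0 (by simpa using hq.symm)
  have hu : AnalyticAt ℂ (fun y => y * θ y) 0 := by fun_prop
  have hu' : deriv (fun y => y * θ y) 0 ≠ 0 := by
    have h1 : HasDerivAt (fun y => y * θ y) _ 0 :=
      (hasDerivAt_id (0 : ℂ)).mul hθ.differentiableAt.hasDerivAt
    rw [h1.deriv]
    simpa using hq0
  obtain ⟨v, hv, hv0, hvu, -⟩ := exists_left_inverse hu (by simp) hu'
  let b : ℂ → ℂ := fun y => c₁ (v y) / θ (v y) ^ (3 * r + i)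
  have hb : AnalyticAt ℂ b 0 := by
    refine (AnalyticAt.comp (g := c₁) (f := v) (by rwa [hv0]) hv).div
      ((AnalyticAt.comp (g := θ) (f := v) (by rwa [hv0]) hv).pow _) ?_
    simp only [hv0]
    exact pow_ne_zero _ hq0
  refine ⟨i, hi1, b, hb, ?_, ?_⟩
  · simp only [b, hv0]
    exact div_ne_zero hc₁0 (pow_ne_zero _ hq0)
  · refine e1.trans (RightEquivalent.symm ((RightEquivalent.comp_second hu (by simp) hu' _).trans
      (.of_eventuallyEq ?_)))
    filter_upwards [hg', eventually_coord hvu 1, eventually_coord hc_eq 1, eventually_coord hθr 1,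
      eventually_coord (hθ.continuousAt.eventually_ne hq0) 1] with z h1 h2 h3 h4 h5
    rw [h1, h3]
    simp only [Matrix.cons_val_zero, Matrix.cons_val_one, Matrix.cons_val_fin_one, b, h2]
    rw [mul_pow, mul_pow, h4]
    have := pow_ne_zero (3 * r + i) h5
    field_simp
    ring

/-- For `r = 1` the principal part is `x² y + y^(3+i)`; for its weights `2 + i` and `2` the monomial
`x³` lies above, since `i ≥ 1`. -/
theorem rightEquivalent_D_of_disc_eq_zero {i : ℕ} (hi : 1 ≤ i) {b : ℂ → ℂ} (hb : AnalyticAt ℂ b 0)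
    (hb0 : b 0 ≠ 0) (hg : ∀ᶠ z in 𝓝 0, g z = z 0 ^ 3 + z 0 ^ 2 * z 1 + b (z 1) * z 1 ^ (3 + i)) :
    RightEquivalent g (fun z => z 0 ^ 2 * z 1 + z 1 ^ (3 + i)) := by
  obtain ⟨l, hl0, hl⟩ := exists_pow_mul_eq_one hb0 (m := 3 + i) (by omega)
  obtain ⟨m, hm0, hm⟩ := exists_pow_mul_eq_one hl0 (m := 2) (by norm_num)
  have hb' := analyticAt_comp_mul hb (l ^ (3 + i)) l
  refine (RightEquivalent.scale_two hm0 hl0 g).trans (exists_rightEquivalent_D (by omega) ?_)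
  have e1 : WeightGE ![3 + i - 1, 2] (2 * (3 + i) + 1) (fun z => m ^ 3 * z 0 ^ 3) :=
    WeightGE.anti (GermSupp.const_mul (m ^ 3)
      ((WeightGE.coord (![3 + i - 1, 2] : Fin 2 → ℕ) 0).pow 3)) (by simp; omega)
  have e2 : WeightGE ![3 + i - 1, 2] (2 * (3 + i) + 1) (fun z => z 1 ^ (3 + i) *
      (l ^ (3 + i) * b (l * z 1) - l ^ (3 + i) * b (l * 0))) :=
    ((WeightGE.coord _ 1).pow (3 + i)).mul (WeightGE.comp_coord_sub
      (weight_pos (by simp) (by simp)) hb' 1) (by simp; omega)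
  refine (GermSupp.add e1 e2).congr ?_
  filter_upwards [eventually_scale_two hg m l] with z hz
  rw [hz]
  simp only [Matrix.cons_val_zero, Matrix.cons_val_one, Matrix.cons_val_fin_one]
  rw [mul_zero, hl]
  linear_combination (z 0 ^ 2 * z 1) * hm

end Classification

/-! ### Adding squares of further variables -/

section Stabilization

variable {n m : ℕ}

/-- The germ `g ∘ π` plus a sum of squares has an isolated singularity only if `g` has one. -/
theorem isolated_of_stabilization {g : (Fin m → ℂ) → ℂ} (hg : AnalyticAt ℂ g 0)
    (π : (Fin n → ℂ) →L[ℂ] (Fin m → ℂ)) (ι : (Fin m → ℂ) →L[ℂ] (Fin n → ℂ))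
    (hπι : ∀ x, π (ι x) = x) {s : Finset (Fin n)} (hs : ∀ x, ∀ j ∈ s, ι x j = 0)
    (hi : ∀ᶠ x in 𝓝[≠] (0 : Fin n → ℂ), g (π x) + ∑ j ∈ s, x j ^ 2 = 0 →
      fderiv ℂ (fun z => g (π z) + ∑ j ∈ s, z j ^ 2) x ≠ 0) :
    ∀ᶠ x in 𝓝[≠] (0 : Fin m → ℂ), g x = 0 → fderiv ℂ g x ≠ 0 := by
  have ht : Tendsto ι (𝓝[≠] 0) (𝓝[≠] 0) := by
    refine tendsto_nhdsWithin_iff.2 ⟨?_, ?_⟩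
    · have h1 := ι.continuous.tendsto 0
      rw [map_zero] at h1
      exact h1.mono_left nhdsWithin_le_nhds
    · filter_upwards [self_mem_nhdsWithin] with x hx h
      exact hx (by rw [Set.mem_singleton_iff, ← hπι x, h, map_zero])
  filter_upwards [ht.eventually hi, hg.eventually_analyticAt.filter_mono nhdsWithin_le_nhds]
    with x h1 h2 hx0 hx1
  refine h1 ?_ ?_
  · rw [hπι, hx0, Finset.sum_eq_zero fun j hj => by rw [hs x j hj]; ring, add_zero]
  · have h3 : HasFDerivAt g (0 : (Fin m → ℂ) →L[ℂ] ℂ) (π (ι x)) := by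
      rw [hπι, ← hx1]
      exact h2.differentiableAt.hasFDerivAt
    have h4 := h3.comp (ι x) π.hasFDerivAt
    have h5 : HasFDerivAt (fun z : Fin n → ℂ => ∑ j ∈ s, z j ^ 2) (0 : (Fin n → ℂ) →L[ℂ] ℂ) (ι x) := by
      have h6 : ∀ j ∈ s, HasFDerivAt (fun z : Fin n → ℂ => z j ^ 2) (0 : (Fin n → ℂ) →L[ℂ] ℂ)
          (ι x) := fun j hj => by
        refine ((ContinuousLinearMap.proj (R := ℂ) (φ := fun _ : Fin n => ℂ) j).hasFDerivAt.pow
          2).congr_fderiv ?_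
        ext
        simp [hs x j hj]
      simpa using HasFDerivAt.fun_sum h6
    refine ((h4.add h5).congr_fderiv ?_).fderiv
    simp

theorem RightEquivalent.stabilize {p q : Fin n} (hpq : p ≠ q) {g g' : (Fin 2 → ℂ) → ℂ}
    (h : RightEquivalent g g') :
    RightEquivalent (fun z : Fin n → ℂ => g ![z p, z q] + ∑ j ∈ {p, q}ᶜ, z j ^ 2)
      (fun z => g' ![z p, z q] + ∑ j ∈ {p, q}ᶜ, z j ^ 2) := by
  obtain ⟨φ, ψ, hφ, hψ, hφ0, hψ0, h1, h2, h3⟩ := h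
  let T : ((Fin 2 → ℂ) → (Fin 2 → ℂ)) → (Fin n → ℂ) → (Fin n → ℂ) := fun χ z i =>
    if i = p then χ ![z p, z q] 0 else if i = q then χ ![z p, z q] 1 else z i
  have hc : ∀ i : Fin n, AnalyticAt ℂ (fun z : Fin n → ℂ => z i) 0 := fun i =>
    (ContinuousLinearMap.proj (R := ℂ) (φ := fun _ : Fin n => ℂ) i).analyticAt 0
  have hpr : AnalyticAt ℂ (fun z : Fin n → ℂ => (![z p, z q] : Fin 2 → ℂ)) 0 := by
    refine AnalyticAt.pi fun i => ?_
    fin_cases i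
    · exact hc p
    · exact hc q
  have hpr0 : (![(0 : Fin n → ℂ) p, (0 : Fin n → ℂ) q] : Fin 2 → ℂ) = 0 := by
    funext i
    fin_cases i <;> rfl
  have hprt : Tendsto (fun z : Fin n → ℂ => (![z p, z q] : Fin 2 → ℂ)) (𝓝 0) (𝓝 0) := by
    have := hpr.continuousAt.tendsto
    rwa [hpr0] at this
  have hT : ∀ {χ : (Fin 2 → ℂ) → (Fin 2 → ℂ)}, AnalyticAt ℂ χ 0 → AnalyticAt ℂ (T χ) 0 := by
    intro χ hχ
    have h4 : AnalyticAt ℂ (fun z : Fin n → ℂ => χ ![z p, z q]) 0 :=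
      AnalyticAt.comp (g := χ) (by rwa [hpr0]) hpr
    refine AnalyticAt.pi fun i => ?_
    change AnalyticAt ℂ (fun z : Fin n → ℂ => if i = p then χ ![z p, z q] 0 else
      if i = q then χ ![z p, z q] 1 else z i) 0
    split_ifs
    · exact analyticAt_pi_iff.1 h4 0
    · exact analyticAt_pi_iff.1 h4 1
    · exact hc i
  have hT0 : ∀ {χ : (Fin 2 → ℂ) → (Fin 2 → ℂ)}, χ 0 = 0 → T χ 0 = 0 := by
    intro χ hχ
    funext i
    simp only [T]
    rw [hpr0, hχ]
    simp
  have hTpr : ∀ χ z, (![T χ z p, T χ z q] : Fin 2 → ℂ) = χ ![z p, z q] := by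
    intro χ z
    funext i
    fin_cases i
    · simp [T]
    · simp [T, hpq.symm]
  have hTT : ∀ χ χ' z, χ (χ' ![z p, z q]) = ![z p, z q] → T χ (T χ' z) = z := by
    intro χ χ' z hz
    funext i
    change (if i = p then χ ![T χ' z p, T χ' z q] 0 else if i = q then χ ![T χ' z p, T χ' z q] 1
      else T χ' z i) = z i
    rw [hTpr, hz]
    split_ifs with hp hq
    · rw [hp]; rfl
    · rw [hq]; rfl
    · simp [T, hp, hq]
  refine ⟨T φ, T ψ, hT hφ, hT hψ, hT0 hφ0, hT0 hψ0, ?_, ?_, ?_⟩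
  · filter_upwards [hprt.eventually h1] with z hz using hTT _ _ z hz
  · filter_upwards [hprt.eventually h2] with z hz using hTT _ _ z hz
  · filter_upwards [hprt.eventually h3] with z hz
    rw [hTpr, hz]
    congr 1
    refine Finset.sum_congr rfl fun j hj => ?_
    simp only [Finset.compl_insert, Finset.mem_erase, Finset.mem_compl, Finset.mem_singleton] at hj
    simp [T, hj.1, hj.2]

theorem IsStabilizationOf.of_rightEquivalent {f : (Fin n → ℂ) → ℂ} {p q : Fin n} (hpq : p ≠ q)
    {g : (Fin 2 → ℂ) → ℂ} (hf : RightEquivalent f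
      (fun z : Fin n → ℂ => g ![z p, z q] + ∑ j ∈ {p, q}ᶜ, z j ^ 2)) {G : ℂ → ℂ → ℂ}
    (hG : RightEquivalent g (fun z => G (z 0) (z 1))) : IsStabilizationOf G f :=
  ⟨p, q, hpq, hf.trans (hG.stabilize hpq)⟩

/-- The classification of the germs `x³ + y² α(y) x + y³ β(y)` with an isolated singularity. -/
theorem exists_type_of_cubic {f : (Fin n → ℂ) → ℂ} {p q : Fin n} (hpq : p ≠ q)
    {g : (Fin 2 → ℂ) → ℂ} (hf : RightEquivalent f
      (fun z : Fin n → ℂ => g ![z p, z q] + ∑ j ∈ {p, q}ᶜ, z j ^ 2))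
    {α β : ℂ → ℂ} (hα : AnalyticAt ℂ α 0) (hβ : AnalyticAt ℂ β 0)
    (hg : ∀ᶠ z in 𝓝 0, g z = z 0 ^ 3 + z 1 ^ 2 * α (z 1) * z 0 + z 1 ^ 3 * β (z 1))
    (hi : ∀ᶠ x in 𝓝[≠] (0 : Fin 2 → ℂ), g x = 0 → fderiv ℂ g x ≠ 0) :
    ∃ r : ℕ, 1 ≤ r ∧ (IsTypeE6r r f ∨ IsTypeE6rAddOne r f ∨ IsTypeE6rAddTwo r f ∨
      ∃ i : ℕ, IsTypeJ r i f) := by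
  have h0 : ¬ ((∀ᶠ y in 𝓝 0, α y = 0) ∧ ∀ᶠ y in 𝓝 0, β y = 0) := by
    rintro ⟨h1, h2⟩
    refine not_isolated_of_eq_sq_mul (h := fun z => z 0) (analyticAt_comp_coord analyticAt_id 0) ?_
      hi
    filter_upwards [hg, eventually_coord h1 1, eventually_coord h2 1] with z h3 h4 h5
    rw [h3, h4, h5]
    ring
  obtain ⟨k, a, b, ha, hb, hαa, hβb, hmax⟩ := exists_maximal_order hα hβ h0
  -- The extra one comes from the factors `y²` and `y³` already present in `g`.
  obtain ⟨r, hr⟩ : ∃ r, r = k + 1 := ⟨_, rfl⟩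
  have hr1 : 1 ≤ r := by omega
  have hgr : ∀ᶠ z in 𝓝 0, g z = z 0 ^ 3 + z 1 ^ (2 * r) * a (z 1) * z 0 +
      z 1 ^ (3 * r) * b (z 1) := by
    filter_upwards [hg, eventually_coord hαa 1, eventually_coord hβb 1] with z h3 h4 h5
    rw [h3, h4, h5, hr]
    ring
  refine ⟨r, hr1, ?_⟩
  -- If both vanish, the first nonzero coefficient in the order `y b₁`, `y a₁`, `y² b₂` decides
  -- between `E_{6r}`, `E_{6r+1}` and `E_{6r+2}`; if none is nonzero, maximality of `k` fails.
  by_cases hab : a 0 = 0 ∧ b 0 = 0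
  · obtain ⟨a₁, ha₁, haa⟩ := exists_eq_mul_of_apply_zero ha hab.1
    obtain ⟨b₁, hb₁, hbb⟩ := exists_eq_mul_of_apply_zero hb hab.2
    by_cases hb0 : b₁ 0 = 0
    · obtain ⟨b₂, hb₂, hbb'⟩ := exists_eq_mul_of_apply_zero hb₁ hb0
      by_cases ha0 : a₁ 0 = 0
      · obtain ⟨a₂, ha₂, haa'⟩ := exists_eq_mul_of_apply_zero ha₁ ha0
        by_cases hb0' : b₂ 0 = 0
        · obtain ⟨b₃, hb₃, hbb''⟩ := exists_eq_mul_of_apply_zero hb₂ hb0'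
          refine absurd ⟨a₂, b₃, ha₂, hb₃, ?_, ?_⟩ hmax
          · filter_upwards [haa, haa'] with y h1 h2
            rw [h1, h2]
            ring
          · filter_upwards [hbb, hbb', hbb''] with y h1 h2 h3
            rw [h1, h2, h3]
            ring
        · obtain ⟨c, hc, h⟩ := exists_rightEquivalent_of_beta (N := 3 * r + 2) (j₀ := 2 * r + 2)
            (k := r - 1) (by omega) (by omega) (by omega) (by omega) ha₂ hb₂ hb0' (g := g) (by
              filter_upwards [hgr, eventually_coord haa 1, eventually_coord haa' 1,
                eventually_coord hbb 1, eventually_coord hbb' 1] with z h1 h2 h3 h4 h5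
              rw [h1, h2, h3, h4, h5]
              ring)
          exact .inr (.inr (.inl ⟨c, hc, .of_rightEquivalent hpq hf h⟩))
      · obtain ⟨c, hc, h⟩ := exists_rightEquivalent_of_alpha hr1 ha₁ ha0 hb₂ (g := g) (by
          filter_upwards [hgr, eventually_coord haa 1, eventually_coord hbb 1,
            eventually_coord hbb' 1] with z h1 h2 h4 h5
          rw [h1, h2, h4, h5]
          ring)
        exact .inr (.inl ⟨c, hc, .of_rightEquivalent hpq hf h⟩)
    · obtain ⟨c, hc, h⟩ := exists_rightEquivalent_of_beta (N := 3 * r + 1) (j₀ := 2 * r + 1)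
        (k := r - 1) (by omega) (by omega) (by omega) (by omega) ha₁ hb₁ hb0 (g := g) (by
          filter_upwards [hgr, eventually_coord haa 1, eventually_coord hbb 1] with z h1 h2 h4
          rw [h1, h2, h4]
          ring)
      exact .inl ⟨c, hc, .of_rightEquivalent hpq hf h⟩
  refine .inr (.inr (.inr ?_))
  by_cases hd : 4 * a 0 ^ 3 + 27 * b 0 ^ 2 = 0
  · obtain ⟨i, hi1, c, hc, hc0, h⟩ := exists_rightEquivalent_of_disc_eq_zero hr1 ha hb hd hab hgr hi
    refine ⟨i, ?_⟩
    rcases eq_or_lt_of_le hr1 with rfl | hr2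
    · refine .inl ⟨rfl, .of_rightEquivalent hpq hf (h.trans ?_)⟩
      have h3 : 4 + i - 1 = 3 + i := by omega
      rw [h3]
      exact rightEquivalent_D_of_disc_eq_zero hi1 hc hc0 (by simp)
    · obtain ⟨e, he, he0, h'⟩ := exists_rightEquivalent_J hr2 hi1 hc hc0
        (Eventually.of_forall fun _ => rfl)
      exact .inr (.inr ⟨hr2, hi1, e, he, he0, .of_rightEquivalent hpq hf (h.trans h')⟩)
  · refine ⟨0, ?_⟩
    rcases eq_or_lt_of_le hr1 with rfl | hr2
    · exact .inl ⟨rfl, .of_rightEquivalent hpq hf (rightEquivalent_D_four ha hb hd hgr)⟩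
    · obtain ⟨c, hc, e, he, h⟩ := exists_rightEquivalent_of_disc_ne_zero hr2 ha hb hd hgr
      exact .inr (.inl ⟨hr2, rfl, c, hc, e, he, .of_rightEquivalent hpq hf h⟩)

end Stabilization

/-! ### Orders of vanishing -/

section Order

variable {n : ℕ}

theorem isBigO_pow_norm_of_le {d e : ℕ} (h : d ≤ e) :
    (fun z : Fin n → ℂ => ‖z‖ ^ e) =O[𝓝 0] fun z => ‖z‖ ^ d := by
  refine Asymptotics.IsBigO.of_bound 1 ?_
  filter_upwards [Metric.closedBall_mem_nhds (0 : Fin n → ℂ) one_pos] with z hz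
  rw [mem_closedBall_zero_iff] at hz
  rw [one_mul, norm_pow, norm_pow, norm_norm]
  exact pow_le_pow_of_le_one (norm_nonneg z) hz h

/-- By induction on the degree: once the lower components vanish, the component of degree `k < d` is
of order `‖z‖ ^ (k + 1)`, and a homogeneous polynomial of degree `k` with this bound is zero. -/
theorem WeightGE.of_isBigO {d : ℕ} {f : (Fin n → ℂ) → ℂ} (hf : AnalyticAt ℂ f 0)
    (h : f =O[𝓝 0] fun z => ‖z‖ ^ d) : WeightGE (fun _ => 1) d f := by
  obtain ⟨p, hp⟩ := hf
  refine .of_hasFPowerSeriesAt hp fun k => ?_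
  induction k using Nat.strong_induction_on with
  | _ k ih =>
    intro hk
    have h1 := hp.isBigO_sub_partialSum_pow (k + 1)
    simp only [zero_add] at h1
    have h2 : (fun z => p k fun _ => z) =O[𝓝 0] fun z => ‖z‖ ^ (k + 1) := by
      refine ((h.trans (isBigO_pow_norm_of_le (Nat.succ_le_of_lt hk))).sub h1).congr_left
        fun z => ?_
      rw [FormalMultilinearSeries.partialSum, Finset.sum_range_succ,
        Finset.sum_eq_zero fun j hj => ih j (Finset.mem_range.1 hj)
          ((Finset.mem_range.1 hj).trans hk) z]
      ring
    exact h2.continuousMultilinearMap_apply_eq_zero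

theorem WeightGE.isBigO {d : ℕ} {f : (Fin n → ℂ) → ℂ} (hf : WeightGE (fun _ => 1) d f) :
    f =O[𝓝 0] fun z => ‖z‖ ^ d := by
  obtain ⟨C, t₀, ht₀, H⟩ := GermSupp.exists_wscale hf (w := fun _ => 1) (fun _ => one_pos)
    (d := d) fun m hm => hm
  have hb : ∀ t : ℝ, 0 < t → t ≤ t₀ → ∀ z : Fin n → ℂ, ‖z‖ ≤ t → ‖f z‖ ≤ C * t ^ d := by
    intro t ht ht' z hz
    obtain ⟨a, -, ha, haz⟩ := H t ht ht'
    have ht0 : (t : ℂ) ≠ 0 := by exact_mod_cast ht.ne'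
    have h1 : ‖(t : ℂ)⁻¹ • z‖ ≤ 1 := by
      rw [norm_smul, norm_inv, Complex.norm_real, Real.norm_of_nonneg ht.le]
      exact (inv_mul_le_one₀ ht).2 hz
    have h2 := haz _ h1
    have h3 : (fun i => (t : ℂ) ^ 1 * ((t : ℂ)⁻¹ • z) i) = z := by
      funext i
      rw [pow_one, Pi.smul_apply, smul_eq_mul, mul_inv_cancel_left₀ ht0]
    rw [h3] at h2
    rw [h2]
    exact (norm_eval_le h1 a).trans ha
  refine Asymptotics.IsBigO.of_bound C ?_
  filter_upwards [Metric.closedBall_mem_nhds (0 : Fin n → ℂ) ht₀] with z hz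
  rw [mem_closedBall_zero_iff] at hz
  rw [norm_pow, norm_norm]
  rcases eq_or_lt_of_le (norm_nonneg z) with h | h
  -- At `z = 0` the scale `t = ‖z‖` is not allowed, so the bound is obtained as `t → 0`.
  · rw [← h]
    have hc : Tendsto (fun t : ℝ => C * t ^ d) (𝓝[>] 0) (𝓝 (C * 0 ^ d)) :=
      ((continuous_const.mul (continuous_pow d)).tendsto 0).mono_left nhdsWithin_le_nhds
    refine ge_of_tendsto hc ?_
    filter_upwards [Ioc_mem_nhdsGT ht₀] with t ht
    exact hb t ht.1 ht.2 z (by rw [← h]; exact ht.1.le)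
  · exact hb _ h hz z le_rfl

variable {F : Type*} [NormedAddCommGroup F] [NormedSpace ℂ F]

/-- The Taylor expansion to third order. -/
theorem _root_.AnalyticAt.exists_taylor_two {G : (Fin n → ℂ) → F} (hG : AnalyticAt ℂ G 0) :
    ∃ Q : (Fin n → ℂ) → F, Differentiable ℂ Q ∧ (∀ (t : ℂ) u, Q (t • u) = t ^ 2 • Q u) ∧
      (fun z => G z - G 0 - fderiv ℂ G 0 z - Q z) =O[𝓝 0] fun z => ‖z‖ ^ 3 := by
  obtain ⟨p, hp⟩ := hG
  refine ⟨fun u => p 2 fun _ => u, ?_, fun t u => ?_, ?_⟩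
  · exact (p 2).contDiff.differentiable (n := 1) one_ne_zero |>.comp
      (differentiable_pi.2 fun _ => differentiable_id)
  · have := (p 2).map_smul_univ (fun _ => t) (fun _ => u)
    simpa using this
  · refine (hp.isBigO_sub_partialSum_pow 3).congr_left fun z => ?_
    rw [hp.fderiv_eq, ← hp.coeff_zero (fun _ => (0 : Fin n → ℂ)), zero_add]
    simp only [FormalMultilinearSeries.partialSum, Finset.sum_range_succ, Finset.sum_range_zero,
      zero_add, continuousMultilinearCurryFin1_apply]
    have h0 : (p 0 fun _ => z) = p 0 fun _ => 0 := congrArg (p 0) (Subsingleton.elim _ _)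
    have h1 : (Fin.snoc 0 z : Fin 1 → Fin n → ℂ) = fun _ => z := by
      funext i
      rw [Subsingleton.elim (α := Fin 1) i (Fin.last 0), Fin.snoc_last]
    rw [h0, h1]
    abel

theorem _root_.AnalyticAt.isBigO_sub_fderiv {G : (Fin n → ℂ) → F} (hG : AnalyticAt ℂ G 0) :
    (fun z => G z - G 0 - fderiv ℂ G 0 z) =O[𝓝 0] fun z => ‖z‖ ^ 2 := by
  obtain ⟨p, hp⟩ := hG
  refine (hp.isBigO_sub_partialSum_pow 2).congr_left fun z => ?_
  rw [hp.fderiv_eq, ← hp.coeff_zero (fun _ => (0 : Fin n → ℂ)), zero_add]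
  simp only [FormalMultilinearSeries.partialSum, Finset.sum_range_succ, Finset.sum_range_zero,
    zero_add, continuousMultilinearCurryFin1_apply]
  have h0 : (p 0 fun _ => z) = p 0 fun _ => 0 := congrArg (p 0) (Subsingleton.elim _ _)
  have h1 : (Fin.snoc 0 z : Fin 1 → Fin n → ℂ) = fun _ => z := by
    funext i
    rw [Subsingleton.elim (α := Fin 1) i (Fin.last 0), Fin.snoc_last]
  rw [h0, h1]
  abel

end Order

/-! ### The Hessian form -/

section Hessian

variable {n : ℕ} {f : (Fin n → ℂ) → ℂ}

/-- The second derivative at the origin. -/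
def hessian (f : (Fin n → ℂ) → ℂ) : (Fin n → ℂ) →L[ℂ] (Fin n → ℂ) →L[ℂ] ℂ :=
  fderiv ℂ (fderiv ℂ f) 0

theorem hessian_comm (hf : AnalyticAt ℂ f 0) (u v : Fin n → ℂ) :
    hessian f u v = hessian f v u :=
  (hf.contDiffAt (n := ⊤)).isSymmSndFDerivAt_of_omega u v

/-- The differential of the difference is of order `‖z‖ ^ 2` by the Taylor formula for `fderiv ℂ f`;
the mean value inequality on balls gains one more power. -/
theorem weightGE_sub_hessian (hf : AnalyticAt ℂ f 0) (h0 : f 0 = 0) (h1 : fderiv ℂ f 0 = 0) :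
    WeightGE (fun _ => 1) 3 (fun z => f z - 1 / 2 * hessian f z z) := by
  have hB : ∀ z, HasFDerivAt (fun z => 1 / 2 * hessian f z z) (hessian f z) z := by
    intro z
    have := (((hessian f).hasFDerivAt (x := z)).clm_apply (hasFDerivAt_id z)).const_mul (1 / 2 : ℂ)
    refine this.congr_fderiv ?_
    ext w
    simp [hessian_comm hf w z]
    ring
  have hBa : AnalyticAt ℂ (fun z => 1 / 2 * hessian f z z) 0 := by
    have : AnalyticAt ℂ (fun z => hessian f z z) 0 :=
      AnalyticAt.comp (g := fun p : (Fin n → ℂ) × (Fin n → ℂ) => hessian f p.1 p.2)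
        (f := fun z => (z, z)) ((hessian f).analyticAt_bilinear (0, 0))
        (analyticAt_id.prod analyticAt_id)
    exact analyticAt_const.mul this
  refine .of_isBigO (hf.sub hBa) ?_
  obtain ⟨C, hC0, hC⟩ := hf.fderiv.isBigO_sub_fderiv.exists_pos
  replace hC := hC.bound
  simp only [h1, sub_zero, norm_pow, norm_norm] at hC
  obtain ⟨ε, hε, H⟩ := Metric.eventually_nhds_iff_ball.1 (hC.and hf.eventually_analyticAt)
  refine Asymptotics.IsBigO.of_bound C ?_
  filter_upwards [Metric.ball_mem_nhds (0 : Fin n → ℂ) hε] with z hz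
  have hsub : Metric.closedBall (0 : Fin n → ℂ) ‖z‖ ⊆ Metric.ball 0 ε :=
    Metric.closedBall_subset_ball (by simpa using hz)
  have := (convex_closedBall (0 : Fin n → ℂ) ‖z‖).norm_image_sub_le_of_norm_hasFDerivWithin_le
    (f := fun z => f z - 1 / 2 * hessian f z z) (f' := fun z => fderiv ℂ f z - hessian f z)
    (C := C * ‖z‖ ^ 2) (x := 0) (y := z) (fun x hx => ?_) (fun x hx => ?_) (by simp) (by simp)
  · simp only [h0, map_zero, mul_zero, sub_zero] at this
    rw [norm_pow, norm_norm, pow_succ, ← mul_assoc]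
    exact this
  · exact ((H x (hsub hx)).2.differentiableAt.hasFDerivAt.sub (hB x)).hasFDerivWithinAt
  · have hx' : ‖x‖ ≤ ‖z‖ := mem_closedBall_zero_iff.1 hx
    have h2 := (H x (hsub hx)).1
    refine h2.trans ?_
    gcongr

/-- Diagonalization of the Hessian form. -/
theorem exists_hessian_basis (hf : AnalyticAt ℂ f 0) :
    ∃ (T : (Fin n → ℂ) ≃L[ℂ] (Fin n → ℂ)) (Z : Finset (Fin n)),
      ∀ z w, hessian f (T z) (T w) = 2 * ∑ j ∈ Zᶜ, z j * w j := by
  let B : LinearMap.BilinForm ℂ (Fin n → ℂ) :=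
    LinearMap.mk₂ ℂ (fun u v => hessian f u v) (by simp) (by simp) (by simp) (by simp)
  have hB : LinearMap.IsSymm B := ⟨fun u v => hessian_comm hf u v⟩
  have : Invertible (2 : ℂ) := invertibleOfNonzero two_ne_zero
  obtain ⟨v₀, hv₀⟩ := LinearMap.BilinForm.exists_orthogonal_basis (B := B) hB
  let v₁ := v₀.reindex (finCongr (Module.finrank_fin_fun ℂ))
  have hv₁ : ∀ i j, i ≠ j → hessian f (v₁ i) (v₁ j) = 0 := by
    intro i j hij
    simp only [v₁, Module.Basis.reindex_apply]
    exact hv₀ (by simpa using hij)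
  -- Diagonal entries are normalized to `2`, so that the `1 / 2` of the Taylor formula leaves a
  -- plain sum of squares.
  have hc : ∀ i, ∃ c : ℂˣ, hessian f (v₁ i) (v₁ i) ≠ 0 →
      (c : ℂ) ^ 2 * hessian f (v₁ i) (v₁ i) = 2 := by
    intro i
    by_cases h : hessian f (v₁ i) (v₁ i) = 0
    · exact ⟨1, fun h' => absurd h h'⟩
    · obtain ⟨c, hc⟩ := IsAlgClosed.exists_pow_nat_eq (2 / hessian f (v₁ i) (v₁ i)) two_pos
      have hc0 : c ≠ 0 := by
        rintro rfl
        rw [zero_pow two_ne_zero] at hc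
        exact div_ne_zero two_ne_zero h hc.symm
      exact ⟨Units.mk0 c hc0, fun _ => by rw [Units.val_mk0, hc, div_mul_cancel₀ _ h]⟩
  choose c hc using hc
  let v := v₁.unitsSMul c
  have hv : ∀ i j, i ≠ j → hessian f (v i) (v j) = 0 := by
    intro i j hij
    simp [v, Module.Basis.unitsSMul_apply, Units.smul_def, hv₁ i j hij]
  let Z : Finset (Fin n) := Finset.univ.filter fun i => hessian f (v₁ i) (v₁ i) = 0
  have hvv : ∀ i, hessian f (v i) (v i) = if i ∈ Z then 0 else 2 := by
    intro i
    have h : hessian f (v i) (v i) = (c i : ℂ) ^ 2 * hessian f (v₁ i) (v₁ i) := by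
      simp only [v, Module.Basis.unitsSMul_apply, Units.smul_def, map_smul,
        _root_.smul_apply, smul_eq_mul]
      ring
    rw [h]
    split_ifs with hi
    · rw [(Finset.mem_filter.1 hi).2, mul_zero]
    · exact hc i fun h' => hi (Finset.mem_filter.2 ⟨Finset.mem_univ i, h'⟩)
  refine ⟨v.equivFun.symm.toContinuousLinearEquiv, Z, fun z w => ?_⟩
  have hT : ∀ z : Fin n → ℂ, v.equivFun.symm.toContinuousLinearEquiv z = ∑ i, z i • v i := fun z =>
    v.equivFun_symm_apply z
  rw [hT, hT]
  simp only [map_sum, map_smul, _root_.sum_apply, _root_.smul_apply, smul_eq_mul]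
  rw [Finset.mul_sum, ← Finset.sum_subset (Finset.subset_univ Zᶜ)]
  · refine Finset.sum_congr rfl fun j hj => ?_
    rw [Finset.sum_eq_single j (fun i _ hij => by rw [hv _ _ (by tauto)]; ring) (by simp), hvv,
      if_neg (by simpa using hj)]
    ring
  · intro j _ hj
    refine mul_eq_zero_of_right _ (Finset.sum_eq_zero fun i _ => ?_)
    by_cases hij : i = j
    · rw [hij, hvv, if_pos (by simpa using hj)]
      ring
    · rw [hv _ _ (by tauto)]
      ring

end Hessian

/-! ### Bounds for the Milnor number -/

section Milnor

variable {n : ℕ} {k : (Fin n → ℂ) → ℂ}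

/-- Elements of the Jacobian ideal vanish along a curve to the order to which the differential
does. -/
theorem isBigO_of_mem_jacobianIdeal {γ : ℂ → (Fin n → ℂ)} (hγ : Tendsto γ (𝓝 0) (𝓝 0)) {m : ℕ}
    (h : (fun s => fderiv ℂ k (γ s)) =O[𝓝 0] fun s => s ^ m) {φ : analyticGerms n}
    (hφ : φ ∈ jacobianIdeal k) :
    ∀ F : (Fin n → ℂ) → ℂ, (φ : Germ (𝓝 (0 : Fin n → ℂ)) ℂ) = Germ.ofFun F →
      (fun s => F (γ s)) =O[𝓝 0] fun s => s ^ m := by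
  induction hφ using Submodule.span_induction with
  | mem φ hφ =>
    intro F hF
    obtain ⟨j, hj⟩ := hφ
    have h1 : F =ᶠ[𝓝 0] fun z => fderiv ℂ k z (Pi.single j 1) := Germ.coe_eq.1 (hF.symm.trans hj)
    refine Asymptotics.IsBigO.congr' ?_ (h1.comp_tendsto hγ).symm EventuallyEq.rfl
    refine Asymptotics.IsBigO.trans ?_ h
    refine Asymptotics.IsBigO.of_bound ‖(Pi.single j 1 : Fin n → ℂ)‖ (Eventually.of_forall fun s => ?_)
    rw [mul_comm]
    exact ContinuousLinearMap.le_opNorm _ _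
  | zero =>
    intro F hF
    have h1 : F =ᶠ[𝓝 0] fun _ => (0 : ℂ) := Germ.coe_eq.1 hF.symm
    exact (Asymptotics.isBigO_zero _ _).congr' (h1.comp_tendsto hγ).symm EventuallyEq.rfl
  | add x y _ _ hx hy =>
    intro F hF
    obtain ⟨F₁, -, hF₁⟩ := x.2
    obtain ⟨F₂, -, hF₂⟩ := y.2
    have h1 : F =ᶠ[𝓝 0] F₁ + F₂ := by
      refine Germ.coe_eq.1 (hF.symm.trans ?_)
      rw [Subalgebra.coe_add, hF₁, hF₂]
      rfl
    exact ((hx F₁ hF₁).add (hy F₂ hF₂)).congr' (h1.comp_tendsto hγ).symm EventuallyEq.rfl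
  | smul a x _ hx =>
    intro F hF
    obtain ⟨F₁, hF₁a, hF₁⟩ := a.2
    obtain ⟨F₂, -, hF₂⟩ := x.2
    have h1 : F =ᶠ[𝓝 0] F₁ * F₂ := by
      refine Germ.coe_eq.1 (hF.symm.trans ?_)
      rw [smul_eq_mul, Subalgebra.coe_mul, hF₁, hF₂]
      rfl
    have h2 : (fun s => F₁ (γ s)) =O[𝓝 0] fun _ => (1 : ℂ) :=
      (hF₁a.continuousAt.tendsto.comp hγ).isBigO_one ℂ
    refine ((h2.mul (hx F₂ hF₂)).congr' (h1.comp_tendsto hγ).symm ?_)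
    exact Eventually.of_forall fun s => one_mul _

/-- A family of analytic functions whose linear independence modulo the Jacobian ideal is seen on
curves bounds the Milnor number from below. -/
theorem card_le_milnorNumber {ι : Type} [Fintype ι] (b : ι → (Fin n → ℂ) → ℂ)
    (hb : ∀ i, AnalyticAt ℂ (b i) 0)
    (H : ∀ c : ι → ℂ, (∀ (γ : ℂ → (Fin n → ℂ)) (m : ℕ), Tendsto γ (𝓝 0) (𝓝 0) →
      ((fun s => fderiv ℂ k (γ s)) =O[𝓝 0] fun s => s ^ m) →
      (fun s => ∑ i, c i * b i (γ s)) =O[𝓝 0] fun s => s ^ m) → ∀ i, c i = 0) :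
    (Fintype.card ι : ℕ∞) ≤ milnorNumber k := by
  rw [milnorNumber, Cardinal.natCast_le_toENat, ← Cardinal.mk_fintype]
  let β : ι → analyticGerms n := fun i => ⟨Germ.ofFun (b i), b i, hb i, rfl⟩
  refine LinearIndependent.cardinal_le_rank
    (v := fun i => Ideal.Quotient.mk (jacobianIdeal k) (β i)) ?_
  rw [Fintype.linearIndependent_iff]
  intro c hc
  refine H c fun γ m hγ h => ?_
  have h1 : ∑ i, c i • β i ∈ jacobianIdeal k := by
    rw [← Ideal.Quotient.eq_zero_iff_mem, map_sum]
    exact hc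
  refine isBigO_of_mem_jacobianIdeal hγ h h1 (fun z => ∑ i, c i * b i z) ?_
  have h2 : ∀ s : Finset ι, ((∑ i ∈ s, c i • β i : analyticGerms n) :
      Germ (𝓝 (0 : Fin n → ℂ)) ℂ) = Germ.ofFun (fun z => ∑ i ∈ s, c i * b i z) := by
    classical
    intro s
    induction s using Finset.induction_on with
    | empty => simp; rfl
    | insert i s hi ih =>
      rw [Finset.sum_insert hi, Subalgebra.coe_add, ih]
      simp only [Finset.sum_insert hi]
      rfl
  exact h2 Finset.univ

/-- Used repeatedly to read off the Taylor coefficients along a curve one at a time; the punctured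
neighbourhood allows division by `s`. -/
theorem eq_zero_of_isBigO {a : ℂ} {g : ℂ → ℂ} (hg : ContinuousAt g 0) {m : ℕ}
    (h : (fun s => a + s * g s) =O[𝓝[≠] 0] fun s => s ^ (m + 1)) :
    a = 0 ∧ g =O[𝓝[≠] 0] fun s => s ^ m := by
  have h1 : Tendsto (fun s => a + s * g s) (𝓝[≠] 0) (𝓝 (a + 0 * g 0)) :=
    (tendsto_const_nhds.add (tendsto_id.mul hg.tendsto)).mono_left nhdsWithin_le_nhds
  have h2 : Tendsto (fun s : ℂ => s ^ (m + 1)) (𝓝[≠] 0) (𝓝 0) := by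
    have := (continuous_pow (m + 1)).tendsto (0 : ℂ)
    rw [zero_pow (by omega)] at this
    exact this.mono_left nhdsWithin_le_nhds
  have ha : a = 0 := by
    simpa using tendsto_nhds_unique h1 (h.trans_tendsto h2)
  refine ⟨ha, ?_⟩
  rw [ha] at h
  refine ((Asymptotics.isBigO_refl (fun s : ℂ => s⁻¹) (𝓝[≠] 0)).mul h).congr' ?_ ?_
  · filter_upwards [self_mem_nhdsWithin] with s hs
    rw [zero_add, inv_mul_cancel_left₀ hs]
  · filter_upwards [self_mem_nhdsWithin] with s hs
    rw [pow_succ']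
    exact inv_mul_cancel_left₀ hs _

/-- The corank of the Hessian form bounds the Milnor number from below. -/
theorem corank_lt_milnorNumber (hk : AnalyticAt ℂ k 0) (hdk : fderiv ℂ k 0 = 0) {d : ℕ}
    (hd : 1 ≤ d) (ι : (Fin d → ℂ) →ₗ[ℂ] (Fin n → ℂ)) (hι : Function.Injective ι)
    (hker : ∀ x w, hessian k (ι x) w = 0) : ((d + 1 : ℕ) : ℕ∞) ≤ milnorNumber k := by
  obtain ⟨ρ, hρ⟩ := ι.exists_leftInverse_of_injective (LinearMap.ker_eq_bot.2 hι)
  have hρ' : ∀ x, ρ (ι x) = x := fun x => LinearMap.congr_fun hρ x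
  have hρa : ∀ i, AnalyticAt ℂ (fun z => ρ z i) 0 := fun i =>
    (((LinearMap.proj i).comp ρ).toContinuousLinearMap).analyticAt 0
  have hcard : d + 1 = Fintype.card (Option (Fin d)) := by simp
  rw [hcard]
  refine card_le_milnorNumber (fun i z => i.elim 1 fun j => ρ z j) ?_ ?_
  · rintro (_ | j)
    · exact analyticAt_const
    · exact hρa j
  intro c hc
  have key : ∀ j, c none = 0 ∧ c (some j) = 0 := by
    intro j
    have hγ : Tendsto (fun s : ℂ => s • ι (Pi.single j 1)) (𝓝 0) (𝓝 0) := by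
      have : ContinuousAt (fun s : ℂ => s • ι (Pi.single j 1)) 0 := by fun_prop
      have h1 := this.tendsto
      rwa [zero_smul] at h1
    -- Along a line in the radical the differential has no linear term. Elements of the Jacobian
    -- ideal thus have order at least two there, which tests `1` and the linear forms dual to the
    -- radical.
    have h2 : (fun s : ℂ => fderiv ℂ k (s • ι (Pi.single j 1))) =O[𝓝 0] fun s => s ^ 2 := by
      refine ((hk.fderiv.isBigO_sub_fderiv.comp_tendsto hγ).congr_left
        (f₂ := fun s => fderiv ℂ k (s • ι (Pi.single j 1))) fun s => ?_).trans ?_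
      · have h3 : fderiv ℂ (fderiv ℂ k) 0 (s • ι (Pi.single j 1)) = 0 := by
          ext w
          have := hker (s • Pi.single j 1) w
          rw [map_smul] at this
          exact this
        simp only [Function.comp]
        rw [hdk, h3, sub_zero, sub_zero]
      · refine Asymptotics.IsBigO.of_bound (‖ι (Pi.single j 1)‖ ^ 2)
          (Eventually.of_forall fun s => ?_)
        simp only [Function.comp, norm_smul, norm_pow, norm_mul, norm_norm]
        rw [mul_pow, mul_comm]
    have h4 := hc _ 2 hγ h2
    have h5 : (fun s : ℂ => c none + s * c (some j)) =O[𝓝[≠] 0] fun s => s ^ (1 + 1) := by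
      refine (h4.mono nhdsWithin_le_nhds).congr_left fun s => ?_
      rw [Fintype.sum_option, map_smul, hρ']
      simp only [Option.elim, mul_one, Pi.smul_apply, smul_eq_mul]
      rw [Finset.sum_eq_single j (fun i _ hij => by simp [hij]) (by simp)]
      rw [Pi.single_eq_same, mul_one, mul_comm]
    obtain ⟨h6, h7⟩ := eq_zero_of_isBigO continuousAt_const h5
    exact ⟨h6, (eq_zero_of_isBigO (g := fun _ => 0) (m := 0) continuousAt_const
      (by simpa using h7)).1⟩
  rintro (_ | j)
  · exact (key ⟨0, hd⟩).1
  · exact (key j).2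

end Milnor

section Milnor

variable {n : ℕ} {k : (Fin n → ℂ) → ℂ}

theorem norm_le_pow_of_hasDerivAt {κ κ' : ℂ → ℂ} {m : ℕ} (h0 : κ 0 = 0)
    (hκ : ∀ᶠ s in 𝓝 0, HasDerivAt κ (κ' s) s) (h : κ' =O[𝓝 0] fun s => s ^ m) :
    κ =O[𝓝 0] fun s => s ^ (m + 1) := by
  obtain ⟨C, hC0, hC⟩ := h.exists_pos
  obtain ⟨ε, hε, H⟩ := Metric.eventually_nhds_iff_ball.1 (hC.bound.and hκ)
  refine Asymptotics.IsBigO.of_bound C ?_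
  filter_upwards [Metric.ball_mem_nhds (0 : ℂ) hε] with z hz
  have hsub : Metric.closedBall (0 : ℂ) ‖z‖ ⊆ Metric.ball 0 ε :=
    Metric.closedBall_subset_ball (by simpa using hz)
  have := (convex_closedBall (0 : ℂ) ‖z‖).norm_image_sub_le_of_norm_hasDerivWithin_le
    (f := κ) (f' := κ') (C := C * ‖z‖ ^ m) (x := 0) (y := z)
    (fun x hx => ((H x (hsub hx)).2).hasDerivWithinAt) (fun x hx => ?_) (by simp) (by simp)
  · simp only [h0, sub_zero] at this
    rw [norm_pow, pow_succ, ← mul_assoc]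
    exact this
  · have hx' : ‖x‖ ≤ ‖z‖ := mem_closedBall_zero_iff.1 hx
    refine (H x (hsub hx)).1.trans ?_
    rw [norm_pow]
    gcongr

/-- A kernel direction of the Hessian form in which the cubic part vanishes gives Milnor number at
least three. -/
theorem three_le_milnorNumber (hk : AnalyticAt ℂ k 0) (hk0 : k 0 = 0) (hdk : fderiv ℂ k 0 = 0)
    {v : Fin n → ℂ} (hv : v ≠ 0) (hker : ∀ w, hessian k v w = 0)
    (h : (fun s : ℂ => k (s • v)) =O[𝓝 0] fun s => s ^ 4) : 3 ≤ milnorNumber k := by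
  -- In corank at least two the bound by the corank suffices. Otherwise the radical is spanned by
  -- `v`, and a suitable curve tangent to `v` is needed.
  by_cases H : ∃ u, (∀ w, hessian k u w = 0) ∧ LinearIndependent ℂ ![v, u]
  · obtain ⟨u, hu, hvu⟩ := H
    refine corank_lt_milnorNumber hk hdk (d := 2) one_le_two
      (Fintype.linearCombination ℂ ![v, u]) ?_ fun x w => ?_
    · rw [injective_iff_map_eq_zero]
      exact fun x hx => funext (Fintype.linearIndependent_iff.1 hvu x hx)
    · rw [Fintype.linearCombination_apply]
      simp [Fin.sum_univ_two, hker w, hu w]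
  let B : (Fin n → ℂ) →ₗ[ℂ] Module.Dual ℂ (Fin n → ℂ) :=
    { toFun := fun u => (hessian k u : (Fin n → ℂ) →ₗ[ℂ] ℂ)
      map_add' := fun x y => by ext; simp
      map_smul' := fun c x => by ext; simp }
  have hBker : LinearMap.ker B = Submodule.span ℂ {v} := by
    refine le_antisymm (fun u hu => ?_) ?_
    · have hu' : ∀ w, hessian k u w = 0 := fun w => LinearMap.congr_fun (LinearMap.mem_ker.1 hu) w
      by_contra hus
      refine H ⟨u, hu', ?_⟩
      rw [LinearIndependent.pair_iff' hv]
      intro a ha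
      exact hus (Submodule.mem_span_singleton.2 ⟨a, ha⟩)
    · rw [Submodule.span_singleton_le_iff_mem, LinearMap.mem_ker]
      exact LinearMap.ext hker
  -- Symmetry puts the range in the annihilator of `v`, and the dimensions agree because the radical
  -- is a line.
  have hBrange : LinearMap.range B = LinearMap.ker (Module.Dual.eval ℂ (Fin n → ℂ) v) := by
    refine Submodule.eq_of_le_of_finrank_eq ?_ ?_
    · rintro _ ⟨u, rfl⟩
      exact (hessian_comm hk u v).trans (hker u)
    · have h1 := LinearMap.finrank_range_add_finrank_ker B
      have h2 := LinearMap.finrank_range_add_finrank_ker (Module.Dual.eval ℂ (Fin n → ℂ) v)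
      rw [hBker, finrank_span_singleton hv] at h1
      rw [Subspace.dual_finrank_eq] at h2
      have h3 : Module.finrank ℂ (LinearMap.range (Module.Dual.eval ℂ (Fin n → ℂ) v)) = 1 := by
        have : LinearMap.range (Module.Dual.eval ℂ (Fin n → ℂ) v) = ⊤ := by
          refine LinearMap.range_eq_top.2 (LinearMap.surjective ?_)
          intro h4
          exact hv ((Module.forall_dual_apply_eq_zero_iff ℂ v).1 fun f => LinearMap.congr_fun h4 f)
        rw [this, finrank_top, Module.finrank_self]
      omega
  obtain ⟨Q, hQ, hQs, hQO⟩ := hk.fderiv.exists_taylor_two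
  simp only [hdk, sub_zero] at hQO
  have hline : ∀ w : Fin n → ℂ, Tendsto (fun s : ℂ => s • (v + s • w)) (𝓝 0) (𝓝 0) := by
    intro w
    have : ContinuousAt (fun s : ℂ => s • (v + s • w)) 0 := by fun_prop
    have h1 := this.tendsto
    rwa [zero_smul] at h1
  have hcurve : ∀ w : Fin n → ℂ, (fun s : ℂ => fderiv ℂ k (s • (v + s • w)) -
      s ^ 2 • (hessian k w + Q (v + s • w))) =O[𝓝 0] fun s => s ^ 3 := by
    intro w
    refine ((hQO.comp_tendsto (hline w)).congr_left (f₂ := fun s : ℂ =>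
      fderiv ℂ k (s • (v + s • w)) - s ^ 2 • (hessian k w + Q (v + s • w))) fun s => ?_).trans ?_
    · have h3 : fderiv ℂ (fderiv ℂ k) 0 (s • (v + s • w)) = s ^ 2 • hessian k w := by
        have hv0 : hessian k v = 0 := by
          ext w
          exact hker w
        change hessian k _ = _
        rw [map_smul, map_add, hv0, map_smul, zero_add, smul_smul, sq]
      simp only [Function.comp]
      rw [h3, hQs, smul_add (s ^ 2), sub_add_eq_sub_sub]
    · have h4 : (fun s : ℂ => v + s • w) =O[𝓝 0] fun _ => (1 : ℂ) := by
        have : ContinuousAt (fun s : ℂ => v + s • w) 0 := by fun_prop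
        exact this.tendsto.isBigO_one ℂ
      have h5 : (fun s : ℂ => s • (v + s • w)) =O[𝓝 0] fun s : ℂ => s := by
        simpa using (Asymptotics.isBigO_refl (fun s : ℂ => s) (𝓝 0)).smul h4
      exact h5.norm_left.pow 3
  -- Integrating `dk(sv)v = s² Q(v)v + O(s³)` gives `k(sv) = Q(v)v s³/3 + O(s⁴)`, so `Q(v)v` is the
  -- cubic part along `v` up to a factor.
  have hQvv : Q v v = 0 := by
    have h1 : (fun s : ℂ => k (s • v) - Q v v / 3 * s ^ 3) =O[𝓝 0] fun s => s ^ (3 + 1) := by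
      refine norm_le_pow_of_hasDerivAt (κ' := fun s => fderiv ℂ k (s • v) v - s ^ 2 * Q v v)
        (by simp [hk0]) ?_ ?_
      · have h2 := (hline 0).eventually hk.eventually_analyticAt
        simp only [smul_zero, add_zero] at h2
        filter_upwards [h2] with s hs
        have h3 : HasDerivAt (fun s : ℂ => s • v) v s := by
          simpa using (hasDerivAt_id s).smul_const v
        have h4 := hs.differentiableAt.hasFDerivAt.comp_hasDerivAt s h3
        refine (h4.sub (((hasDerivAt_id s).pow 3).const_mul (Q v v / 3))).congr_deriv ?_
        simp
        ring
      · have h2 := hcurve 0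
        simp only [smul_zero, add_zero, map_zero, zero_add] at h2
        refine Asymptotics.IsBigO.trans ?_ h2
        refine Asymptotics.IsBigO.of_bound ‖v‖ (Eventually.of_forall fun s => ?_)
        exact (ContinuousLinearMap.le_opNorm (fderiv ℂ k (s • v) - s ^ 2 • Q v) v).trans_eq
          (mul_comm _ _)
    have h2 : (fun s : ℂ => 0 + s * (s * (s * (Q v v / 3)))) =O[𝓝[≠] 0] fun s => s ^ (3 + 1) := by
      refine ((h.sub h1).mono nhdsWithin_le_nhds).congr_left fun s => ?_
      ring
    have h3 := (eq_zero_of_isBigO (by fun_prop) h2).2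
    have h4 := (eq_zero_of_isBigO (a := 0) (g := fun s => s * (Q v v / 3)) (by fun_prop) (h3.congr_left fun s => by ring)).2
    have h5 := (eq_zero_of_isBigO (a := 0) (g := fun _ => Q v v / 3) (by fun_prop)
      (h4.congr_left fun s => by ring)).2
    have h6 := (eq_zero_of_isBigO (a := Q v v / 3) (g := fun _ => 0) (m := 0) (by fun_prop)
      (h5.congr_left fun s => by ring)).1
    simpa using h6
  -- Along `s(v + sw)` the quadratic term of `dk` is `hessian k w + Q v`; this choice of `w` cancels
  -- it, so `dk` has order three on the curve.
  obtain ⟨w, hw⟩ : ∃ w, hessian k w = -Q v := by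
    have : -(Q v : (Fin n → ℂ) →ₗ[ℂ] ℂ) ∈ LinearMap.range B := by
      rw [hBrange, LinearMap.mem_ker]
      simp [hQvv]
    obtain ⟨w, hw⟩ := this
    refine ⟨w, ?_⟩
    ext u
    exact LinearMap.congr_fun hw u
  obtain ⟨j, hj⟩ := Function.ne_iff.1 hv
  have h3 : (fun s : ℂ => fderiv ℂ k (s • (v + s • w))) =O[𝓝 0] fun s => s ^ 3 := by
    have h4 : (fun s : ℂ => Q (v + s • w) - Q v) =O[𝓝 0] fun s : ℂ => s := by
      have h5 : DifferentiableAt ℂ (fun s : ℂ => Q (v + s • w)) 0 := by fun_prop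
      simpa using h5.isBigO_sub
    have h5 := (Asymptotics.isBigO_refl (fun s : ℂ => s ^ 2) (𝓝 0)).smul h4
    refine ((hcurve w).add (h5.congr_right fun s => ?_)).congr_left fun s => ?_
    · rw [smul_eq_mul]; ring
    · rw [hw, add_comm (-Q v), ← sub_eq_add_neg]
      abel
  have hja : AnalyticAt ℂ (fun z : Fin n → ℂ => z j) 0 :=
    (ContinuousLinearMap.proj (R := ℂ) (φ := fun _ : Fin n => ℂ) j).analyticAt 0
  -- Since `v j ≠ 0`, the functions `1`, `z j`, `z j ^ 2` have orders exactly `0`, `1`, `2` on the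
  -- curve, whereas the Jacobian ideal has order at least three there.
  refine le_trans (by simp) (card_le_milnorNumber (k := k) (ι := Fin 3)
    ![fun _ => 1, fun z => z j, fun z => z j ^ 2] ?_ ?_)
  · intro i
    fin_cases i
    · exact analyticAt_const
    · exact hja
    · exact hja.pow 2
  · intro c hc
    have h4 := hc _ 3 (hline w) h3
    have h5 : (fun s : ℂ => c 0 + s * (c 1 * v j + s * (c 1 * w j + c 2 * (v j + s * w j) ^ 2)))
        =O[𝓝[≠] 0] fun s => s ^ (2 + 1) := by
      refine (h4.mono nhdsWithin_le_nhds).congr_left fun s => ?_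
      simp [Fin.sum_univ_three]
      ring
    obtain ⟨h6, h7⟩ := eq_zero_of_isBigO (by fun_prop) h5
    obtain ⟨h8, h9⟩ := eq_zero_of_isBigO (by fun_prop) h7
    obtain h10 : c 1 = 0 := (mul_eq_zero.1 h8).resolve_right hj
    have h11 : (fun s : ℂ => c 2 * v j ^ 2 + s * (c 2 * (2 * v j * w j + s * w j ^ 2)))
        =O[𝓝[≠] 0] fun s => s ^ (0 + 1) := by
      refine h9.congr_left fun s => ?_
      rw [h10]
      ring
    have h12 := (mul_eq_zero.1 (eq_zero_of_isBigO (by fun_prop) h11).1).resolve_right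
      (pow_ne_zero 2 hj)
    intro i
    fin_cases i
    · exact h6
    · exact h10
    · exact h12

/-- Hadamard's lemma. -/
theorem exists_eq_sum_mul {E : (Fin n → ℂ) → ℂ} (hE : AnalyticAt ℂ E 0) (h0 : E 0 = 0) :
    ∃ q : Fin n → (Fin n → ℂ) → ℂ, (∀ j, AnalyticAt ℂ (q j) 0) ∧
      ∀ᶠ y in 𝓝 0, E y = ∑ j, y j * q j y := by
  obtain ⟨ρ, hρ, a, ha, h⟩ := (WeightGE.of_apply_zero (w := fun _ => 1) (fun _ => one_pos) hE
    h0).exists_eval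
  obtain ⟨ψ, hψ, q, -, hq⟩ := exists_eq_add_sum_X_mul ∅ ha
  have hψ0 : ψ = 0 := by
    ext m
    refine mem_supp.1 hψ m fun hm => ?_
    have h1 : m = 0 := by
      ext i
      exact hm.1 i (Finset.notMem_empty i)
    have h2 := hm.2
    rw [h1] at h2
    simp at h2
  rw [hψ0, zero_add, Finset.compl_empty] at hq
  refine ⟨fun j y => (ρ : ℂ)⁻¹ * eval ((ρ : ℂ)⁻¹ • y) (q j), fun j => ?_, ?_⟩
  · refine analyticAt_const.mul (AnalyticAt.comp (g := fun z => eval z (q j)) ?_ (by fun_prop))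
    rw [smul_zero]
    exact (q j).analyticAt_eval
  · have hcont : Tendsto (fun z : Fin n → ℂ => (ρ : ℂ)⁻¹ • z) (𝓝 0) (𝓝 0) := by
      simpa using (continuous_const_smul (ρ : ℂ)⁻¹).tendsto (0 : Fin n → ℂ)
    filter_upwards [h, hcont (Metric.closedBall_mem_nhds (0 : Fin n → ℂ) one_pos)] with y hy hy'
    have hz : ‖(ρ : ℂ)⁻¹ • y‖ ≤ 1 := mem_closedBall_zero_iff.1 hy'
    rw [hy, hq, ← evalHom_apply _ hz, map_sum]
    refine Finset.sum_congr rfl fun j _ => ?_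
    rw [map_mul, evalHom_apply, evalHom_apply, eval_X, Pi.smul_apply, smul_eq_mul]
    ring

theorem rank_le_one_of_forall {V : Type*} [AddCommGroup V] [Module ℂ V] (v₀ : V)
    (h : ∀ v, ∃ c : ℂ, c • v₀ = v) : Module.rank ℂ V ≤ 1 :=
  rank_le_one_iff.2 ⟨v₀, h⟩

/-- A nondegenerate critical point has Milnor number at most one. -/
theorem milnorNumber_le_one (hk : AnalyticAt ℂ k 0) (hdk : fderiv ℂ k 0 = 0)
    (hnd : ∀ v, (∀ w, hessian k v w = 0) → v = 0) : milnorNumber k ≤ 1 := by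
  -- The derivative of the gradient map is the Hessian, so at a nondegenerate critical point the
  -- partial derivatives are local coordinates.
  let G : (Fin n → ℂ) → (Fin n → ℂ) := fun z j => fderiv ℂ k z (Pi.single j 1)
  let L : ((Fin n → ℂ) →L[ℂ] ℂ) →L[ℂ] (Fin n → ℂ) :=
    ContinuousLinearMap.pi fun j => ContinuousLinearMap.apply ℂ ℂ (Pi.single j 1)
  have hGL : G = fun z => L (fderiv ℂ k z) := rfl
  have hG : AnalyticAt ℂ G 0 := (L.analyticAt _).comp hk.fderiv
  have hG0 : G 0 = 0 := by
    change L (fderiv ℂ k 0) = 0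
    rw [hdk, map_zero]
  have hGd : fderiv ℂ G 0 = L.comp (hessian k) :=
    (L.hasFDerivAt.comp (0 : Fin n → ℂ) hk.fderiv.differentiableAt.hasFDerivAt).fderiv
  obtain ⟨H, hH, hH0, hHG, -⟩ := exists_analytic_inverse hG hG0 (by
    rw [hGd, injective_iff_map_eq_zero]
    intro v hv
    refine hnd v fun w => ?_
    have h1 : (hessian k v : (Fin n → ℂ) →ₗ[ℂ] ℂ) = 0 := by
      refine LinearMap.pi_ext' fun j => ?_
      ext
      exact congrFun hv j
    exact LinearMap.congr_fun h1 w)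
  rw [milnorNumber, Cardinal.toENat_le_one]
  refine rank_le_one_of_forall (Ideal.Quotient.mk (jacobianIdeal k) 1) fun x => ?_
  obtain ⟨φ, rfl⟩ := Ideal.Quotient.mk_surjective x
  obtain ⟨F, hF, hφF⟩ := φ.2
  refine ⟨F 0, ?_⟩
  -- Hadamard's lemma in the coordinates `y = G z` puts `F - F 0` in the Jacobian ideal, so
  -- constants span the quotient.
  have hE : AnalyticAt ℂ (fun y => F (H y) - F 0) 0 :=
    (AnalyticAt.comp (g := F) (by rwa [hH0]) hH).sub analyticAt_const
  obtain ⟨q, hq, hqE⟩ := exists_eq_sum_mul hE (by simp [hH0])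
  have hqa : ∀ j, AnalyticAt ℂ (fun z => q j (G z)) 0 := fun j =>
    AnalyticAt.comp (g := q j) (by rw [hG0]; exact hq j) hG
  have hGa : ∀ j, AnalyticAt ℂ (fun z => G z j) 0 := fun j => analyticAt_pi_iff.1 hG j
  let β : Fin n → analyticGerms n := fun j => ⟨Germ.ofFun fun z => q j (G z), _, hqa j, rfl⟩
  let g : Fin n → analyticGerms n := fun j => ⟨Germ.ofFun fun z => G z j, _, hGa j, rfl⟩
  have hmem : ∑ j, β j * g j ∈ jacobianIdeal k :=
    Submodule.sum_mem _ fun j _ => Ideal.mul_mem_left _ _ (Ideal.subset_span ⟨j, rfl⟩)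
  have hsum : φ = algebraMap ℂ _ (F 0) + ∑ j, β j * g j := by
    have h1 : ∀ s : Finset (Fin n), ((∑ j ∈ s, β j * g j : analyticGerms n) :
        Germ (𝓝 (0 : Fin n → ℂ)) ℂ) = Germ.ofFun (fun z => ∑ j ∈ s, q j (G z) * G z j) := by
      intro s
      induction s using Finset.induction_on with
      | empty => simp; rfl
      | insert i s hi ih =>
        rw [Finset.sum_insert hi, Subalgebra.coe_add, ih]
        simp only [Finset.sum_insert hi]
        rfl
    refine Subtype.ext ?_
    rw [Subalgebra.coe_add, h1, hφF, Subalgebra.coe_algebraMap, Algebra.algebraMap_eq_smul_one]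
    refine Germ.coe_eq.2 ?_
    have hGt : Tendsto G (𝓝 0) (𝓝 0) := by
      have := hG.continuousAt.tendsto
      rwa [hG0] at this
    filter_upwards [hHG, hGt.eventually hqE] with z h2 h3
    rw [h2] at h3
    change F z = F 0 * 1 + ∑ j, q j (G z) * G z j
    rw [sub_eq_iff_eq_add'.1 h3, mul_one]
    congr 1
    exact Finset.sum_congr rfl fun j _ => mul_comm _ _
  rw [hsum, map_add, Ideal.Quotient.eq_zero_iff_mem.2 hmem, add_zero, Algebra.algebraMap_eq_smul_one]
  rfl

end Milnor

/-! ### Sections by general hyperplanes -/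

section Sections

variable {n N : ℕ} {f : (Fin n → ℂ) → ℂ}

/-- A general matrix is injective and nondegenerate for a given bilinear form, as soon as some
matrix is nondegenerate. -/
theorem exists_matrix {P : MvPolynomial (Fin n × Fin N) ℂ} (hP : P ≠ 0)
    (Q : Matrix (Fin n) (Fin n) ℂ) (M₁ : Matrix (Fin n) (Fin N) ℂ)
    (h : (M₁.transpose * Q * M₁).det ≠ 0) :
    ∃ M : Matrix (Fin n) (Fin N) ℂ, Function.Injective M.mulVec ∧
      MvPolynomial.eval (fun p => M p.1 p.2) P ≠ 0 ∧ (M.transpose * Q * M).det ≠ 0 := by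
  let Y : Matrix (Fin n) (Fin N) (MvPolynomial (Fin n × Fin N) ℂ) :=
    Matrix.of fun i j => MvPolynomial.X (i, j)
  let Q' : Matrix (Fin n) (Fin n) (MvPolynomial (Fin n × Fin N) ℂ) := Q.map MvPolynomial.C
  -- Nondegeneracy of the restricted form is the nonvanishing of the polynomial `R` in the entries,
  -- and `M₁` shows `R ≠ 0`. The product `P * R` is then nonzero at some point.
  let R : MvPolynomial (Fin n × Fin N) ℂ := Matrix.det (Matrix.transpose Y * Q' * Y)
  have hR : ∀ M : Matrix (Fin n) (Fin N) ℂ,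
      MvPolynomial.eval (fun p => M p.1 p.2) R = (M.transpose * Q * M).det := by
    intro M
    rw [RingHom.map_det]
    congr 1
    ext a b
    simp [Matrix.mul_apply, Y, Q']
  have hR0 : R ≠ 0 := by
    intro hR0
    have := hR M₁
    rw [hR0, map_zero] at this
    exact h this.symm
  obtain ⟨x, hx⟩ : ∃ x, MvPolynomial.eval x (P * R) ≠ 0 := by
    by_contra! H
    exact mul_ne_zero hP hR0 (MvPolynomial.funext fun x => by rw [H x, map_zero])
  rw [map_mul] at hx
  obtain ⟨hx1, hx2⟩ := mul_ne_zero_iff.1 hx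
  let M : Matrix (Fin n) (Fin N) ℂ := Matrix.of fun i j => x (i, j)
  have hM : (M.transpose * Q * M).det ≠ 0 := by
    rw [← hR M]
    exact hx2
  refine ⟨M, ?_, hx1, hM⟩
  have h1 : Function.Injective M.mulVecLin := by
    rw [injective_iff_map_eq_zero]
    intro v hv
    refine Matrix.eq_zero_of_mulVec_eq_zero hM ?_
    rw [← Matrix.mulVec_mulVec, ← Matrix.mulVecLin_apply M, hv, Matrix.mulVec_zero]
  exact h1

theorem exists_injective_matrix (hN : N ≤ n) {P : MvPolynomial (Fin n × Fin N) ℂ} (hP : P ≠ 0) :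
    ∃ M : Matrix (Fin n) (Fin N) ℂ, Function.Injective M.mulVec ∧
      MvPolynomial.eval (fun p => M p.1 p.2) P ≠ 0 := by
  let M₁ : Matrix (Fin n) (Fin N) ℂ := Matrix.of fun i j => if i = Fin.castLE hN j then 1 else 0
  obtain ⟨M, h1, h2, -⟩ := exists_matrix hP 1 M₁ (by
    rw [Matrix.mul_one]
    have : M₁.transpose * M₁ = 1 := by
      ext a b
      simp [M₁, Matrix.mul_apply, Matrix.one_apply, eq_comm]
    rw [this, Matrix.det_one]
    exact one_ne_zero)
  exact ⟨M, h1, h2⟩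

theorem hessian_comp (hf : AnalyticAt ℂ f 0) (L : (Fin N → ℂ) →L[ℂ] (Fin n → ℂ))
    (x y : Fin N → ℂ) : hessian (fun z => f (L z)) x y = hessian f (L x) (L y) := by
  have hL : Tendsto L (𝓝 0) (𝓝 0) := by
    have := L.continuous.tendsto 0
    rwa [map_zero] at this
  let Λ : ((Fin n → ℂ) →L[ℂ] ℂ) →L[ℂ] ((Fin N → ℂ) →L[ℂ] ℂ) :=
    (ContinuousLinearMap.compL ℂ (Fin N → ℂ) (Fin n → ℂ) ℂ).flip L
  have h1 : fderiv ℂ (fun z => f (L z)) =ᶠ[𝓝 0] fun z => Λ (fderiv ℂ f (L z)) := by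
    filter_upwards [hL.eventually hf.eventually_analyticAt] with z hz
    exact (hz.differentiableAt.hasFDerivAt.comp z L.hasFDerivAt).fderiv
  have h2 : HasFDerivAt (fderiv ℂ f) (hessian f) (L 0) := by
    rw [map_zero]
    exact hf.fderiv.differentiableAt.hasFDerivAt
  have h3 : HasFDerivAt (fun z => Λ (fderiv ℂ f (L z))) (Λ.comp ((hessian f).comp L)) 0 :=
    Λ.hasFDerivAt.comp 0 (h2.comp 0 L.hasFDerivAt)
  rw [hessian, h1.fderiv_eq, h3.fderiv]
  rfl

theorem fderiv_comp_zero (hf : AnalyticAt ℂ f 0) (hdf : fderiv ℂ f 0 = 0)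
    (L : (Fin N → ℂ) →L[ℂ] (Fin n → ℂ)) : fderiv ℂ (fun z => f (L z)) 0 = 0 := by
  have h2 : HasFDerivAt f (0 : (Fin n → ℂ) →L[ℂ] ℂ) (L 0) := by
    rw [map_zero, ← hdf]
    exact hf.differentiableAt.hasFDerivAt
  exact (h2.comp 0 L.hasFDerivAt).fderiv.trans (ContinuousLinearMap.zero_comp L)

theorem analyticAt_comp_zero (hf : AnalyticAt ℂ f 0) (L : (Fin N → ℂ) →L[ℂ] (Fin n → ℂ)) :
    AnalyticAt ℂ (fun z => f (L z)) 0 :=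
  AnalyticAt.comp (g := f) (by rwa [map_zero]) (L.analyticAt 0)

theorem hessian_eq_sum (u v : Fin n → ℂ) : hessian f u v =
    ∑ i, ∑ j, u i * hessian f (Pi.single i 1) (Pi.single j 1) * v j := by
  have h : ∀ u : Fin n → ℂ, u = ∑ i, u i • (Pi.single i 1 : Fin n → ℂ) := fun u => by
    rw [← pi_eq_sum_univ' u]
  conv_lhs => rw [h u, h v]
  simp only [map_sum, map_smul, _root_.sum_apply, _root_.smul_apply, smul_eq_mul]
  simp only [Finset.mul_sum]
  rw [Finset.sum_comm]
  exact Finset.sum_congr rfl fun i _ => Finset.sum_congr rfl fun j _ => by ring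

variable {T : (Fin n → ℂ) ≃L[ℂ] (Fin n → ℂ)} {Z : Finset (Fin n)}

/-- A hyperplane meets a coordinate subspace in codimension at most one. -/
theorem exists_section_kernel
    (L : (Fin N → ℂ) →L[ℂ] (Fin n → ℂ)) {d : ℕ} (hd : d + n ≤ Z.card + N) :
    ∃ b : Fin d → (Fin N → ℂ), LinearIndependent ℂ b ∧
      ∀ i, ∀ j ∉ Z, T.symm (L (b i)) j = 0 := by
  -- The coordinate subspace is cut out by `n - Z.card` equations, so its preimage has dimension at
  -- least `N - (n - Z.card)`.
  let Φ : (Fin N → ℂ) →ₗ[ℂ] ({j // j ∈ Zᶜ} → ℂ) :=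
    LinearMap.pi fun j => (LinearMap.proj j.1).comp
      ((T.symm : (Fin n → ℂ) →ₗ[ℂ] (Fin n → ℂ)).comp (L : (Fin N → ℂ) →ₗ[ℂ] (Fin n → ℂ)))
  have h1 := LinearMap.finrank_range_add_finrank_ker Φ
  have h2 := Submodule.finrank_le (LinearMap.range Φ)
  rw [Module.finrank_pi, Fintype.card_coe, Finset.card_compl, Fintype.card_fin] at h2
  rw [Module.finrank_pi, Fintype.card_fin] at h1
  have h3 := Finset.card_le_univ Z
  rw [Fintype.card_fin] at h3
  obtain ⟨b, hb⟩ := exists_linearIndependent_of_le_finrank (R := ℂ) (M := LinearMap.ker Φ) (n := d)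
    (by omega)
  refine ⟨fun i => b i, hb.map' (LinearMap.ker Φ).subtype (Submodule.ker_subtype _), ?_⟩
  intro i j hj
  exact congrFun (LinearMap.mem_ker.1 (b i).2) ⟨j, by simpa using hj⟩

theorem hessian_eq_zero_of_mem (hT : ∀ z w, hessian f (T z) (T w) = 2 * ∑ j ∈ Zᶜ, z j * w j)
    {u : Fin n → ℂ} (hu : ∀ j ∉ Z, T.symm u j = 0) (w : Fin n → ℂ) : hessian f u w = 0 := by
  have h := hT (T.symm u) (T.symm w)
  rw [T.apply_symm_apply, T.apply_symm_apply] at h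
  rw [h, Finset.sum_eq_zero fun j hj => by rw [hu j (by simpa using hj), zero_mul], mul_zero]

/-- Vectors mapped by `L` into the radical of the Hessian of `f` lie in the radical of the Hessian
of the section. -/
theorem le_milnorNumber_section (hf : AnalyticAt ℂ f 0) (hdf : fderiv ℂ f 0 = 0)
    (hT : ∀ z w, hessian f (T z) (T w) = 2 * ∑ j ∈ Zᶜ, z j * w j)
    (L : (Fin N → ℂ) →L[ℂ] (Fin n → ℂ)) {d : ℕ} (hd1 : 1 ≤ d) (hd : d + n ≤ Z.card + N) :
    ((d + 1 : ℕ) : ℕ∞) ≤ milnorNumber (fun z => f (L z)) := by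
  obtain ⟨b, hb, hbZ⟩ := exists_section_kernel (T := T) (Z := Z) L hd
  refine corank_lt_milnorNumber (analyticAt_comp_zero hf L) (fderiv_comp_zero hf hdf L) hd1
    (Fintype.linearCombination ℂ b) ?_ fun x w => ?_
  · rw [injective_iff_map_eq_zero]
    exact fun x hx => funext (Fintype.linearIndependent_iff.1 hb x hx)
  · rw [hessian_comp hf, Fintype.linearCombination_apply, map_sum]
    simp only [map_sum, map_smul, _root_.sum_apply, _root_.smul_apply]
    exact Finset.sum_eq_zero fun i _ => by rw [hessian_eq_zero_of_mem hT (hbZ i), smul_zero]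

/-- In corank at least two every hyperplane section is degenerate, hence has Milnor number at least
two. -/
theorem card_le_one_of_sectionalMilnorNumber (hn : 1 ≤ n) (hf : AnalyticAt ℂ f 0)
    (hdf : fderiv ℂ f 0 = 0) (hT : ∀ z w, hessian f (T z) (T w) = 2 * ∑ j ∈ Zᶜ, z j * w j)
    (h : HasSectionalMilnorNumber f (n - 1) 1) : Z.card ≤ 1 := by
  by_contra! hZ
  obtain ⟨P, hP, H⟩ := h
  obtain ⟨M, hM, hMP⟩ := exists_injective_matrix (Nat.sub_le n 1) hP
  have h1 := le_milnorNumber_section hf hdf hT M.mulVecLin.toContinuousLinearMap (d := 1) le_rfl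
    (by omega)
  have h2 := H M hM hMP
  have h3 : ((1 + 1 : ℕ) : ℕ∞) ≤ 1 := h2 ▸ h1
  exact absurd (by exact_mod_cast h3) (by norm_num : ¬ (2 : ℕ) ≤ 1)

theorem card_eq_two_of_sectionalMilnorNumber (hn : 1 ≤ n) (hf : AnalyticAt ℂ f 0) (h0 : f 0 = 0)
    (hdf : fderiv ℂ f 0 = 0) (hT : ∀ z w, hessian f (T z) (T w) = 2 * ∑ j ∈ Zᶜ, z j * w j)
    (h : HasSectionalMilnorNumber f (n - 1) 2) : Z.card = 2 ∧
      ∃ u : Fin n → ℂ, (∀ j ∉ Z, u j = 0) ∧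
        ¬ (fun s : ℂ => f (T (s • u))) =O[𝓝 0] fun s => s ^ 4 := by
  obtain ⟨P, hP, H⟩ := h
  have h2 : 2 ≤ Z.card := by
    by_contra! hZ
    -- In corank at most one, `n - 1` basis vectors outside the radical span a hyperplane on which
    -- the Hessian is nondegenerate; so is a general one, and its Milnor number is at most one.
    obtain ⟨e, he⟩ : ∃ e : Fin (n - 1) → Fin n, Function.Injective e ∧ ∀ i, e i ∉ Z := by
      have h1 : Fintype.card (Fin (n - 1)) ≤ Fintype.card {j // j ∈ Zᶜ} := by
        rw [Fintype.card_coe, Finset.card_compl, Fintype.card_fin, Fintype.card_fin]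
        omega
      obtain ⟨e⟩ := Function.Embedding.nonempty_of_card_le h1
      exact ⟨fun i => (e i).1, Subtype.val_injective.comp e.injective,
        fun i => Finset.mem_compl.1 (e i).2⟩
    let Q : Matrix (Fin n) (Fin n) ℂ :=
      Matrix.of fun i j => hessian f (Pi.single i 1) (Pi.single j 1)
    have hQ : ∀ (M : Matrix (Fin n) (Fin (n - 1)) ℂ) (x y : Fin (n - 1) → ℂ),
        hessian f (M.mulVec x) (M.mulVec y) =
          dotProduct (Matrix.vecMul x (M.transpose * Q * M)) y := by
      intro M x y
      rw [hessian_eq_sum, ← Matrix.vecMul_vecMul, ← Matrix.dotProduct_mulVec,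
        ← Matrix.vecMul_vecMul, Matrix.vecMul_transpose, ← Matrix.dotProduct_mulVec]
      simp only [dotProduct, Matrix.mulVec, Finset.mul_sum, Q, Matrix.of_apply, mul_assoc]
    obtain ⟨M, hM, hMP, hMQ⟩ := exists_matrix hP Q
      (Matrix.of fun i j => T (Pi.single (e j) 1) i) (by
        generalize hM₁ : (Matrix.of fun i j => T (Pi.single (e j) 1) i :
          Matrix (Fin n) (Fin (n - 1)) ℂ) = M₁
        have hcol : ∀ a, M₁.mulVec (Pi.single a 1) = T (Pi.single (e a) 1) := by
          intro a
          rw [Matrix.mulVec_single_one, ← hM₁]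
          rfl
        have h1 : M₁.transpose * Q * M₁ = (2 : ℂ) • (1 : Matrix (Fin (n - 1)) (Fin (n - 1)) ℂ) := by
          ext a b
          have h2 := hQ M₁ (Pi.single a 1) (Pi.single b 1)
          rw [hcol, hcol, hT, Matrix.single_one_vecMul, dotProduct_single_one] at h2
          rw [Matrix.smul_apply, smul_eq_mul, Matrix.one_apply]
          refine h2.symm.trans ?_
          congr 1
          rw [Finset.sum_eq_single (e a)]
          · simp [Pi.single_apply, he.1.eq_iff]
          · intro j _ hj
            simp [hj]
          · intro h3
            exact absurd (Finset.mem_compl.2 (he.2 a)) h3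
        rw [h1, Matrix.det_smul, Matrix.det_one, mul_one]
        exact pow_ne_zero _ two_ne_zero)
    have h3 := H M hM hMP
    have h4 := milnorNumber_le_one
      (analyticAt_comp_zero hf M.mulVecLin.toContinuousLinearMap)
      (fderiv_comp_zero hf hdf M.mulVecLin.toContinuousLinearMap) fun v hv => by
        refine Matrix.eq_zero_of_vecMul_eq_zero hMQ ?_
        refine dotProduct_eq_zero _ fun w => ?_
        rw [← hQ]
        have := hv w
        rwa [hessian_comp hf] at this
    have h5 : (2 : ℕ∞) ≤ 1 := h3 ▸ h4
    exact absurd (by exact_mod_cast h5) (by norm_num : ¬ (2 : ℕ) ≤ 1)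
  obtain ⟨M, hM, hMP⟩ := exists_injective_matrix (Nat.sub_le n 1) hP
  have hμ := H M hM hMP
  refine ⟨le_antisymm ?_ h2, ?_⟩
  · by_contra! hZ
    have h1 := le_milnorNumber_section hf hdf hT M.mulVecLin.toContinuousLinearMap (d := 2)
      one_le_two (by omega)
    have h3 : ((2 + 1 : ℕ) : ℕ∞) ≤ 2 := hμ ▸ h1
    exact absurd (by exact_mod_cast h3) (by norm_num : ¬ (3 : ℕ) ≤ 2)
  -- A hyperplane meets the two-dimensional radical in a nonzero vector; if the cubic part vanished
  -- on the radical, the section would have Milnor number at least three.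
  · by_contra! hu
    let L := M.mulVecLin.toContinuousLinearMap
    obtain ⟨b, hb, hbZ⟩ := exists_section_kernel (T := T) (Z := Z) L (d := 1) (by omega)
    have h1 := three_le_milnorNumber (analyticAt_comp_zero hf L) (by simpa using h0)
      (fderiv_comp_zero hf hdf L) (v := b 0) (hb.ne_zero 0) (fun w => by
        rw [hessian_comp hf, hessian_eq_zero_of_mem hT (hbZ 0)]) (by
        refine (hu _ (hbZ 0)).congr_left fun s => ?_
        rw [map_smul, T.apply_symm_apply, map_smul])
    have h3 : (3 : ℕ∞) ≤ 2 := hμ ▸ h1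
    exact absurd (by exact_mod_cast h3) (by norm_num : ¬ (3 : ℕ) ≤ 2)

end Sections

/-! ### Singularities of corank at most one -/

section Corank

variable {n : ℕ} {f : (Fin n → ℂ) → ℂ}

theorem RightEquivalent.comp_update {u : ℂ → ℂ} (hu : AnalyticAt ℂ u 0) (h0 : u 0 = 0)
    (hu' : deriv u 0 ≠ 0) (p : Fin n) (g : (Fin n → ℂ) → ℂ) :
    RightEquivalent g (fun z => g (Function.update z p (u (z p)))) := by
  obtain ⟨v, hv, hv0, hvu, huv⟩ := exists_left_inverse hu h0 hu'
  have hc : ∀ i : Fin n, AnalyticAt ℂ (fun z : Fin n → ℂ => z i) 0 := fun i =>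
    (ContinuousLinearMap.proj (R := ℂ) (φ := fun _ : Fin n => ℂ) i).analyticAt 0
  have ht : Tendsto (fun z : Fin n → ℂ => z p) (𝓝 0) (𝓝 0) := (hc p).continuousAt.tendsto
  have ha : ∀ {w : ℂ → ℂ}, AnalyticAt ℂ w 0 →
      AnalyticAt ℂ (fun z : Fin n → ℂ => Function.update z p (w (z p))) 0 := by
    intro w hw
    refine AnalyticAt.pi fun i => ?_
    simp only [Function.update_apply]
    split_ifs
    · exact AnalyticAt.comp (g := w) hw (hc p)
    · exact hc i
  refine ⟨_, fun z => Function.update z p (v (z p)), ha hu, ha hv, ?_, ?_, ?_, ?_,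
    Eventually.of_forall fun _ => rfl⟩
  · simp [h0]
  · simp [hv0]
  · filter_upwards [ht.eventually hvu] with z hz
    simp [hz]
  · filter_upwards [ht.eventually huv] with z hz
    simp [hz]

theorem tendsto_smul_const_zero (v : Fin n → ℂ) :
    Tendsto (fun t : ℂ => t • v) (𝓝 0) (𝓝 0) := by
  have : ContinuousAt (fun t : ℂ => t • v) 0 := by fun_prop
  have h1 := this.tendsto
  rwa [zero_smul] at h1

theorem WeightGE.isBigO_smul {d : ℕ} (hf : WeightGE (fun _ => 1) d f) (v : Fin n → ℂ) :
    (fun t : ℂ => f (t • v)) =O[𝓝 0] fun t => t ^ d := by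
  refine (hf.isBigO.comp_tendsto (tendsto_smul_const_zero v)).trans ?_
  refine Asymptotics.IsBigO.of_bound (‖v‖ ^ d) (Eventually.of_forall fun s => ?_)
  simp only [Function.comp, norm_smul, norm_pow, norm_mul, norm_norm]
  rw [mul_pow, mul_comm]

/-- A germ with Hessian form of corank at most one is of type `A`. -/
theorem exists_isTypeA (hn : 1 ≤ n) {Z : Finset (Fin n)} (hZ : Z.card ≤ 1)
    (hf : WeightGE (fun _ => 1) 3 (fun z => f z - ∑ j ∈ Zᶜ, z j ^ 2)) (hfa : AnalyticAt ℂ f 0)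
    (hi : ∀ᶠ x in 𝓝[≠] (0 : Fin n → ℂ), f x = 0 → fderiv ℂ f x ≠ 0) :
    ∃ k : ℕ, 1 ≤ k ∧ IsTypeA k f := by
  obtain ⟨ψ, hψ, hψ3, hψZ, -, hfψ⟩ := exists_rightEquivalent_splitting Z hf
  -- In corank zero the germ is a sum of squares, and any coordinate can play the role of the first
  -- one, with `k = 1`; in corank one a germ `χ` of one variable remains.
  rcases Nat.le_one_iff_eq_zero_or_eq_one.1 hZ with h | h
  · rw [Finset.card_eq_zero] at h
    subst h
    refine ⟨1, le_rfl, ⟨0, hn⟩, hfψ.trans (.of_eventuallyEq (Eventually.of_forall fun z => ?_))⟩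
    have h1 : ψ 0 = 0 := by
      have h2 : ψ =O[𝓝 0] fun z => ‖z - 0‖ ^ 3 := by simpa using hψ3.isBigO
      exact h2.eq_zero_of_norm_pow three_ne_zero
    have h2 : ψ z = 0 := by rw [hψZ z 0 (by simp), h1]
    simp only [h2, zero_add, Finset.compl_empty]
    rw [← Finset.sum_add_sum_compl {(⟨0, hn⟩ : Fin n)}, Finset.sum_singleton]
  · obtain ⟨p, rfl⟩ := Finset.card_eq_one.1 h
    let χ : ℂ → ℂ := fun t => ψ (t • Pi.single p 1)
    have hψχ : ∀ z, ψ z = χ (z p) := fun z => hψZ _ _ fun i hi => by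
      rw [Finset.mem_singleton.1 hi]
      simp
    have hχ : AnalyticAt ℂ χ 0 := by
      refine AnalyticAt.comp (g := ψ) (by rwa [zero_smul]) ?_
      fun_prop
    have hχ3 : χ =O[𝓝 0] fun t => t ^ 3 := hψ3.isBigO_smul _
    -- If `χ` vanished, the whole axis of the remaining variable would be singular.
    have hχ0 : ¬ ∀ᶠ t in 𝓝 0, χ t = 0 := by
      intro h0
      have hev : Tendsto (fun x : Fin 1 → ℂ => x 0) (𝓝 0) (𝓝 0) :=
        (continuous_apply (0 : Fin 1)).tendsto 0
      have hga : AnalyticAt ℂ (fun x : Fin 1 → ℂ => χ (x 0)) 0 :=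
        AnalyticAt.comp (g := χ) (f := fun x : Fin 1 → ℂ => x 0) hχ
          ((ContinuousLinearMap.proj (R := ℂ) (φ := fun _ : Fin 1 => ℂ) 0).analyticAt 0)
      have h1 := isolated_of_stabilization (n := n) (g := fun x : Fin 1 → ℂ => χ (x 0)) hga
        (ContinuousLinearMap.pi fun _ => ContinuousLinearMap.proj p)
        (ContinuousLinearMap.pi fun i => (Pi.single p 1 : Fin n → ℂ) i • ContinuousLinearMap.proj 0)
        (fun x => by
          funext i
          rw [Subsingleton.elim i 0]
          simp) (s := {p}ᶜ) (fun x j hj => by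
          have : j ≠ p := by simpa using hj
          simp [this]) (by
          have := hfψ.isolated hfa hi
          simp only [hψχ] at this
          exact this)
      refine not_isolated_of_line (v := fun _ => 1) (fun h => one_ne_zero (congrFun h 0)) ?_ h1
      have h2 : (fun x : Fin 1 → ℂ => χ (x 0)) =ᶠ[𝓝 0] fun _ => 0 := hev.eventually h0
      filter_upwards [(tendsto_smul_const_zero _).eventually h2.eventually_nhds] with t ht
      exact ⟨ht.self_of_nhds, by rw [EventuallyEq.fderiv_eq ht]; simp⟩
    obtain ⟨i, χ₁, hχ₁, hχ₁0, hχχ₁⟩ := exists_eq_pow_mul_ne_zero hχ hχ0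
    have hi3 : 3 ≤ i := by
      by_contra! hi3
      obtain ⟨m, hm⟩ := Nat.exists_eq_add_of_lt hi3
      have h1 : χ₁ =O[𝓝[≠] 0] fun t => t ^ (m + 1) := by
        have h2 := (Asymptotics.isBigO_refl (fun s : ℂ => (s ^ i)⁻¹) (𝓝[≠] 0)).mul
          (hχ3.mono nhdsWithin_le_nhds)
        refine h2.congr' ?_ ?_
        · filter_upwards [self_mem_nhdsWithin, hχχ₁.filter_mono nhdsWithin_le_nhds] with s hs hs'
          rw [hs', inv_mul_cancel_left₀ (pow_ne_zero _ hs)]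
        · filter_upwards [self_mem_nhdsWithin] with s hs
          rw [hm, add_assoc, pow_add, inv_mul_cancel_left₀ (pow_ne_zero _ hs)]
      refine hχ₁0 (tendsto_nhds_unique (hχ₁.continuousAt.tendsto.mono_left nhdsWithin_le_nhds)
        (h1.trans_tendsto ?_))
      have := (continuous_pow (m + 1)).tendsto (0 : ℂ)
      rw [zero_pow (by omega)] at this
      exact this.mono_left nhdsWithin_le_nhds
    obtain ⟨s, hs⟩ := IsAlgClosed.exists_pow_nat_eq (χ₁ 0) (n := i) (by omega)
    -- An `i`-th root of the unit makes `χ` the `i`-th power of the coordinate `yθ(y)`, whence `k =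
    -- i - 1`.
    obtain ⟨θ, hθ, hθ0, hθi⟩ := exists_analyticAt_pow_eq hχ₁ hχ₁0 (by omega) hs
    have hs0 : θ 0 ≠ 0 := by
      rw [hθ0]
      rintro rfl
      rw [zero_pow (by omega)] at hs
      exact hχ₁0 hs.symm
    have hu : AnalyticAt ℂ (fun y => y * θ y) 0 := by fun_prop
    have hu' : deriv (fun y => y * θ y) 0 ≠ 0 := by
      have h1 : HasDerivAt (fun y => y * θ y) _ 0 :=
        (hasDerivAt_id (0 : ℂ)).mul hθ.differentiableAt.hasDerivAt
      rw [h1.deriv]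
      simpa using hs0
    refine ⟨i - 1, by omega, p, hfψ.trans (RightEquivalent.symm
      ((RightEquivalent.comp_update hu (by simp) hu' p _).trans (.of_eventuallyEq ?_)))⟩
    have hev : Tendsto (fun x : Fin n → ℂ => x p) (𝓝 0) (𝓝 0) := (continuous_apply p).tendsto 0
    filter_upwards [hev.eventually hχχ₁, hev.eventually hθi] with z h1 h2
    rw [hψχ, h1, ← h2, Function.update_self, ← mul_pow, Nat.sub_add_cancel (by omega)]
    congr 1
    refine Finset.sum_congr rfl fun j hj => ?_
    rw [Function.update_of_ne (by simpa using hj)]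

end Corank

/-! ### Singularities of corank two with nonzero cubic part -/

section CorankTwo

/-- A germ of order three in two variables whose cubic part does not vanish at `v`. -/
theorem exists_rightEquivalent_cubic {g : (Fin 2 → ℂ) → ℂ} (hg : WeightGE (fun _ => 1) 3 g)
    {v : Fin 2 → ℂ} (hv : ¬ (fun s : ℂ => g (s • v)) =O[𝓝 0] fun s => s ^ 4) :
    ∃ α β : ℂ → ℂ, AnalyticAt ℂ α 0 ∧ AnalyticAt ℂ β 0 ∧ RightEquivalent g
      (fun z => z 0 ^ 3 + z 1 ^ 2 * α (z 1) * z 0 + z 1 ^ 3 * β (z 1)) := by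
  have hg0 : g 0 = 0 := by
    have h2 : g =O[𝓝 0] fun z => ‖z - 0‖ ^ 3 := by simpa using hg.isBigO
    exact h2.eq_zero_of_norm_pow three_ne_zero
  have hv0 : v ≠ 0 := by
    rintro rfl
    refine hv ?_
    simp only [smul_zero, hg0]
    exact Asymptotics.isBigO_zero _ _
  obtain ⟨w, hw⟩ : ∃ w : Fin 2 → ℂ, LinearIndependent ℂ ![v, w] := by
    by_cases h0 : v 0 = 0
    · refine ⟨Pi.single 0 1, LinearIndependent.pair_iff.2 fun s t hst => ?_⟩
      have h1 : v 1 ≠ 0 := fun h1 => hv0 (by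
        funext i
        fin_cases i
        · exact h0
        · exact h1)
      have h2 := congrFun hst 0
      have h3 := congrFun hst 1
      simp [h0, h1] at h2 h3
      exact ⟨h3, h2⟩
    · refine ⟨Pi.single 1 1, LinearIndependent.pair_iff.2 fun s t hst => ?_⟩
      have h2 := congrFun hst 0
      have h3 := congrFun hst 1
      simp [h0] at h2 h3
      exact ⟨h2, by simpa [h2] using h3⟩
  let T : (Fin 2 → ℂ) →L[ℂ] (Fin 2 → ℂ) :=
    (Fintype.linearCombination ℂ ![v, w]).toContinuousLinearMap
  have hTapp : ∀ z, T z = z 0 • v + z 1 • w := fun z => by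
    change Fintype.linearCombination ℂ ![v, w] z = _
    simp [Fintype.linearCombination_apply, Fin.sum_univ_two]
  have hT : Function.Injective T := by
    rw [injective_iff_map_eq_zero]
    exact fun x hx => funext (Fintype.linearIndependent_iff.1 hw x hx)
  have hga : AnalyticAt ℂ (fun z => g (T z)) 0 := analyticAt_comp_zero hg.analyticAt T
  have hg3 : WeightGE (fun _ => 1) 3 (fun z => g (T z)) := by
    refine .of_isBigO hga ?_
    have hTt : Tendsto T (𝓝 0) (𝓝 0) := by
      have := T.continuous.tendsto 0
      rwa [map_zero] at this
    refine (hg.isBigO.comp_tendsto hTt).trans ?_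
    exact ((T.isBigO_id _).norm_norm).pow 3
  obtain ⟨ρ, hρ, a, ha, haz⟩ := hg3.exists_eval
  let m₀ : Fin 2 →₀ ℕ := Finsupp.single 0 3
  -- After `v` has become the first axis, `x³` is removed; the other monomials of order at least
  -- three have weight at least four for the weights `1` and `2`.
  let a' := a - AbsSeries.coeff m₀ a • mono m₀
  have ha' : a' ∈ supp ({m | 4 ≤ Finsupp.weight ![1, 2] m} ∩
      {m | 3 ≤ Finsupp.weight (fun _ => 1) m}) := by
    rw [mem_supp]
    intro m hm
    simp only [a', map_sub, map_smul, coeff_mono, smul_eq_mul]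
    by_cases h : m = m₀
    · simp [h]
    · rw [if_neg h, mul_zero, sub_zero]
      refine mem_supp.1 ha m fun h3 => hm ⟨?_, h3⟩
      by_contra h4
      refine h ?_
      rw [Set.mem_ofPred_eq, weight_eq_sum, Fin.sum_univ_two] at h3 h4
      simp at h3 h4
      ext i
      fin_cases i
      · simp [m₀]; omega
      · simp [m₀]; omega
  have hρ0 : (ρ : ℂ) ≠ 0 := by exact_mod_cast hρ.ne'
  have heval : ∀ z : Fin 2 → ℂ, ‖z‖ ≤ 1 → eval z a = eval z a' + AbsSeries.coeff m₀ a * z 0 ^ 3 := by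
    intro z hz
    have h : a = a' + AbsSeries.coeff m₀ a • mono m₀ := by simp [a']
    conv_lhs => rw [h]
    have hprod : m₀.prod (fun i k => z i ^ k) = z 0 ^ 3 :=
      Finsupp.prod_single_index (h := fun i k => z i ^ k) (pow_zero _)
    rw [← evalHom_apply z hz, map_add, map_smul, evalHom_apply, evalHom_apply, eval_mono,
      smul_eq_mul, hprod]
  have hcont : Tendsto (fun z : Fin 2 → ℂ => (ρ : ℂ)⁻¹ • z) (𝓝 0) (𝓝 0) := by
    simpa using (continuous_const_smul (ρ : ℂ)⁻¹).tendsto (0 : Fin 2 → ℂ)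
  have hgT : ∀ᶠ z in 𝓝 0, g (T z) =
      eval ((ρ : ℂ)⁻¹ • z) a' + AbsSeries.coeff m₀ a * ((ρ : ℂ)⁻¹) ^ 3 * z 0 ^ 3 := by
    filter_upwards [haz, hcont (Metric.closedBall_mem_nhds (0 : Fin 2 → ℂ) one_pos)] with z h1 h2
    have h3 : ‖(ρ : ℂ)⁻¹ • z‖ ≤ 1 := mem_closedBall_zero_iff.1 h2
    rw [h1, heval _ h3, Pi.smul_apply, smul_eq_mul]
    ring
  -- Without the term `x³` the germ would be of order four along the first axis, where only powers
  -- of `x` survive; this contradicts `hv`.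
  have hc : AbsSeries.coeff m₀ a * ((ρ : ℂ)⁻¹) ^ 3 ≠ 0 := by
    intro hc
    refine hv ?_
    have hS := (GermSupp.of_eval_smul ha' (ρ : ℂ)⁻¹)
    obtain ⟨C, t₀, ht₀, H⟩ := hS.exists_wscale (w := ![1, 2]) (weight_pos one_pos two_pos) (d := 4)
      fun m hm => hm.1
    have hev := (tendsto_smul_const_zero (Pi.single 0 1 : Fin 2 → ℂ)).eventually hgT
    refine Asymptotics.IsBigO.of_bound C ?_
    filter_upwards [hev, Metric.closedBall_mem_nhds (0 : ℂ) ht₀] with s hs hst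
    rw [mem_closedBall_zero_iff] at hst
    have hTs : T (s • Pi.single 0 1) = s • v := by simp [hTapp]
    rw [hc, zero_mul, add_zero, hTs] at hs
    rcases eq_or_ne s 0 with rfl | hs0
    · simp [hg0]
    · have hsn : 0 < ‖s‖ := norm_pos_iff.2 hs0
      obtain ⟨b, -, hb, hbz⟩ := H ‖s‖ hsn hst
      have hsc : ((‖s‖ : ℝ) : ℂ) ≠ 0 := by exact_mod_cast hsn.ne'
      have h1 : ‖(Pi.single 0 (s / (‖s‖ : ℝ)) : Fin 2 → ℂ)‖ ≤ 1 := by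
        rw [Pi.norm_single, norm_div, Complex.norm_real, norm_norm, div_self hsn.ne']
      have h2 := hbz _ h1
      have h3 : (fun i => ((‖s‖ : ℝ) : ℂ) ^ (![1, 2] : Fin 2 → ℕ) i *
          (Pi.single 0 (s / (‖s‖ : ℝ)) : Fin 2 → ℂ) i) = s • Pi.single 0 1 := by
        funext i
        fin_cases i
        · simp; field_simp
        · simp
      rw [h3] at h2
      rw [hs, h2, norm_pow]
      exact (norm_eval_le h1 b).trans hb
  obtain ⟨l, hl0, hl⟩ := exists_pow_mul_eq_one hc (m := 3) (by norm_num)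
  let g₂ : (Fin 2 → ℂ) → ℂ := fun z => g (T (l • z))
  have hlt : Tendsto (fun z : Fin 2 → ℂ => l • z) (𝓝 0) (𝓝 0) := by
    simpa using (continuous_const_smul l).tendsto (0 : Fin 2 → ℂ)
  obtain ⟨α, β, hα, hβ, h⟩ := exists_rightEquivalent_unfolding (g := g₂) (by
    refine (GermSupp.of_eval_smul ha' ((ρ : ℂ)⁻¹ * l)).congr ?_
    filter_upwards [hlt.eventually hgT] with z hz
    simp only [g₂]
    rw [hz, smul_smul, Pi.smul_apply, smul_eq_mul]
    linear_combination z 0 ^ 3 * hl)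
  refine ⟨α, β, hα, hβ, RightEquivalent.trans (.of_linear (l • T) ?_
    (Eventually.of_forall fun z => ?_)) h⟩
  · exact (smul_right_injective _ hl0).comp hT
  · simp only [g₂, map_smul]
    rfl

variable {n : ℕ} {f : (Fin n → ℂ) → ℂ}

/-- The classification of germs with Hessian form of corank two and nonzero cubic part. -/
theorem exists_type_of_corank_two {Z : Finset (Fin n)} (hZ : Z.card = 2)
    (hf : WeightGE (fun _ => 1) 3 (fun z => f z - ∑ j ∈ Zᶜ, z j ^ 2)) (hfa : AnalyticAt ℂ f 0)
    (hi : ∀ᶠ x in 𝓝[≠] (0 : Fin n → ℂ), f x = 0 → fderiv ℂ f x ≠ 0)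
    {u : Fin n → ℂ} (hu : ∀ j ∉ Z, u j = 0)
    (hcub : ¬ (fun s : ℂ => f (s • u)) =O[𝓝 0] fun s => s ^ 4) :
    ∃ r : ℕ, 1 ≤ r ∧ (IsTypeE6r r f ∨ IsTypeE6rAddOne r f ∨ IsTypeE6rAddTwo r f ∨
      ∃ i : ℕ, IsTypeJ r i f) := by
  obtain ⟨ψ, hψ, hψ3, hψZ, hψ4, hfψ⟩ := exists_rightEquivalent_splitting Z hf
  obtain ⟨p, q, hpq, rfl⟩ := Finset.card_eq_two.1 hZ
  let ι : (Fin 2 → ℂ) →L[ℂ] (Fin n → ℂ) :=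
    (Fintype.linearCombination ℂ ![(Pi.single p 1 : Fin n → ℂ), Pi.single q 1]).toContinuousLinearMap
  have hι : ∀ x, ι x = x 0 • (Pi.single p 1 : Fin n → ℂ) + x 1 • Pi.single q 1 := fun x => by
    change Fintype.linearCombination ℂ _ x = _
    simp [Fintype.linearCombination_apply, Fin.sum_univ_two]
  let π : (Fin n → ℂ) →L[ℂ] (Fin 2 → ℂ) :=
    ContinuousLinearMap.pi ![ContinuousLinearMap.proj p, ContinuousLinearMap.proj q]
  have hπ : ∀ z, π z = ![z p, z q] := fun z => by
    funext i
    fin_cases i <;> rfl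
  have hψπ : ∀ z, ψ z = ψ (ι ![z p, z q]) := fun z => hψZ _ _ fun i hi => by
    rcases Finset.mem_insert.1 hi with rfl | h
    · simp [hι, hpq]
    · rw [Finset.mem_singleton.1 h]
      simp [hι, hpq.symm]
  have hga := analyticAt_comp_zero hψ ι
  have hfψ' : RightEquivalent f
      (fun z : Fin n → ℂ => ψ (ι ![z p, z q]) + ∑ j ∈ {p, q}ᶜ, z j ^ 2) :=
    hfψ.trans (.of_eventuallyEq (Eventually.of_forall fun z => by simp only [← hψπ]))
  have hgi : ∀ᶠ x in 𝓝[≠] (0 : Fin 2 → ℂ), ψ (ι x) = 0 →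
      fderiv ℂ (fun x => ψ (ι x)) x ≠ 0 := by
    refine isolated_of_stabilization (g := fun x => ψ (ι x)) hga π ι (fun x => ?_) (s := {p, q}ᶜ)
      (fun x j hj => ?_) ?_
    · rw [hπ]
      funext i
      fin_cases i
      · simp [hι, hpq]
      · simp [hι, hpq.symm]
    · simp only [Finset.compl_insert, Finset.mem_erase, Finset.mem_compl,
        Finset.mem_singleton] at hj
      simp [hι, hj.1, hj.2]
    · have := hfψ'.isolated hfa hi
      simp only [← hπ] at this
      exact this
  have hg3 : WeightGE (fun _ => 1) 3 (fun x => ψ (ι x)) := by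
    refine .of_isBigO hga ?_
    have hιt : Tendsto ι (𝓝 0) (𝓝 0) := by
      have := ι.continuous.tendsto 0
      rwa [map_zero] at this
    refine (hψ3.isBigO.comp_tendsto hιt).trans ?_
    exact ((ι.isBigO_id _).norm_norm).pow 3
  -- The residual germ agrees with `f` on the radical up to order four, so it inherits the nonzero
  -- cubic part.
  have hgv : ¬ (fun s : ℂ => ψ (ι (s • ![u p, u q]))) =O[𝓝 0] fun s => s ^ 4 := by
    intro h
    refine hcub (((hψ4.isBigO_smul u).add h).congr_left fun s => ?_)
    have h1 : (fun i => if i ∈ ({p, q} : Finset (Fin n)) then (s • u) i else 0) = s • u := by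
      funext i
      split_ifs with h
      · rfl
      · simp [hu i h]
    have h2 : ψ (s • u) = ψ (ι (s • ![u p, u q])) := by
      rw [hψπ]
      congr 2
      funext i
      fin_cases i <;> rfl
    rw [h1, ← h2]
    ring
  obtain ⟨α, β, hα, hβ, h⟩ := exists_rightEquivalent_cubic hg3 hgv
  exact exists_type_of_cubic hpq (hfψ'.trans (h.stabilize hpq)) hα hβ
    (Eventually.of_forall fun _ => rfl) (h.isolated hga hgi)

end CorankTwo

/-! ### Invariance of the types under right equivalence, and the theorem -/

section Transport

variable {n : ℕ} {f g : (Fin n → ℂ) → ℂ} {r : ℕ}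

theorem IsTypeA.of_rightEquivalent (h : RightEquivalent f g) (hg : IsTypeA r g) : IsTypeA r f := by
  obtain ⟨p, hp⟩ := hg
  exact ⟨p, h.trans hp⟩

theorem IsStabilizationOf.of_equivalent {G : ℂ → ℂ → ℂ} (h : RightEquivalent f g)
    (hg : IsStabilizationOf G g) : IsStabilizationOf G f := by
  obtain ⟨p, q, hpq, hp⟩ := hg
  exact ⟨p, q, hpq, h.trans hp⟩

theorem exists_type_of_rightEquivalent (h : RightEquivalent f g)
    (hg : IsTypeE6r r g ∨ IsTypeE6rAddOne r g ∨ IsTypeE6rAddTwo r g ∨ ∃ i : ℕ, IsTypeJ r i g) :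
    IsTypeE6r r f ∨ IsTypeE6rAddOne r f ∨ IsTypeE6rAddTwo r f ∨ ∃ i : ℕ, IsTypeJ r i f := by
  rcases hg with ⟨a, ha, h1⟩ | ⟨a, ha, h1⟩ | ⟨a, ha, h1⟩ | ⟨i, h1⟩
  · exact .inl ⟨a, ha, h1.of_equivalent h⟩
  · exact .inr (.inl ⟨a, ha, h1.of_equivalent h⟩)
  · exact .inr (.inr (.inl ⟨a, ha, h1.of_equivalent h⟩))
  · refine .inr (.inr (.inr ⟨i, ?_⟩))
    rcases h1 with ⟨hr, h1⟩ | ⟨hr, hi, b, hb, c, hc, h1⟩ | ⟨hr, hi, a, ha, ha0, h1⟩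
    · exact .inl ⟨hr, h1.of_equivalent h⟩
    · exact .inr (.inl ⟨hr, hi, b, hb, c, hc, h1.of_equivalent h⟩)
    · exact .inr (.inr ⟨hr, hi, a, ha, ha0, h1.of_equivalent h⟩)

end Transport

end HypersurfaceGerm

end

theorem lemma19 (n : ℕ) (hn : 1 ≤ n) (f : (Fin n → ℂ) → ℂ)
    (hf : HypersurfaceGerm.IsIsolatedSingularity f) :
    (HypersurfaceGerm.HasSectionalMilnorNumber f (n - 1) 1 →
      ∃ k : ℕ, 1 ≤ k ∧ HypersurfaceGerm.IsTypeA k f) ∧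
    (HypersurfaceGerm.HasSectionalMilnorNumber f (n - 1) 2 →
      ∃ r : ℕ, 1 ≤ r ∧
        (HypersurfaceGerm.IsTypeE6r r f ∨ HypersurfaceGerm.IsTypeE6rAddOne r f ∨
          HypersurfaceGerm.IsTypeE6rAddTwo r f ∨
          ∃ i : ℕ, HypersurfaceGerm.IsTypeJ r i f)) := by
  obtain ⟨T, Z, hT⟩ := HypersurfaceGerm.exists_hessian_basis hf.analyticAt
  have he : HypersurfaceGerm.RightEquivalent f (fun z => f (T z)) :=
    .of_linear (T : (Fin n → ℂ) →L[ℂ] (Fin n → ℂ)) T.injective (Eventually.of_forall fun _ => rfl)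
  have ha : AnalyticAt ℂ (fun z => f (T z)) 0 :=
    HypersurfaceGerm.analyticAt_comp_zero hf.analyticAt (T : (Fin n → ℂ) →L[ℂ] (Fin n → ℂ))
  have hw : HypersurfaceGerm.WeightGE (fun _ => 1) 3 (fun z => f (T z) - ∑ j ∈ Zᶜ, z j ^ 2) := by
    refine (HypersurfaceGerm.weightGE_sub_hessian ha (by simp [hf.map_zero])
      (HypersurfaceGerm.fderiv_comp_zero hf.analyticAt hf.fderiv_zero
        (T : (Fin n → ℂ) →L[ℂ] (Fin n → ℂ)))).congr (Eventually.of_forall fun z => ?_)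
    have h := HypersurfaceGerm.hessian_comp hf.analyticAt
      (T : (Fin n → ℂ) →L[ℂ] (Fin n → ℂ)) z z
    simp only [ContinuousLinearEquiv.coe_coe] at h
    simp only [h, hT, ← sq]
    ring
  have hi := he.isolated hf.analyticAt hf.isolated
  refine ⟨fun hμ => ?_, fun hμ => ?_⟩
  · obtain ⟨k, hk, h⟩ := HypersurfaceGerm.exists_isTypeA hn
      (HypersurfaceGerm.card_le_one_of_sectionalMilnorNumber hn hf.analyticAt hf.fderiv_zero hT hμ)
      hw ha hi
    exact ⟨k, hk, h.of_rightEquivalent he⟩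
  · obtain ⟨hZ, u, hu, hcub⟩ := HypersurfaceGerm.card_eq_two_of_sectionalMilnorNumber hn
      hf.analyticAt hf.map_zero hf.fderiv_zero hT hμ
    obtain ⟨r, hr, h⟩ := HypersurfaceGerm.exists_type_of_corank_two hZ hw ha hi hu hcub
    exact ⟨r, hr, HypersurfaceGerm.exists_type_of_rightEquivalent he h⟩
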